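/- **Setting.** Let $n\ge 2$, $p\ge 1$, and let $f_1,\dots,f_n:\mathbb R^p\to\mathbb R$ be differentiable with, for some $\mu>0$ and $L$, $\langle\nabla f_i(x)-\nabla f_i(x'),x-x'\rangle\ge\mu\|x-x'\|_2^2$ and $\|\nabla f_i(x)-\nabla f_i(x')\|_2\le L\|x-x'\|_2$ for all $x,x'$ and $i$. Let $x^*$ be the minimizer of $\sum_i f_i$. For $\mathbf x\in\mathbb R^{n\times p}$ with rows $x_i$, $\nabla F(\mathbf x)$ has the rows $\nabla f_i(x_i)$. Let $\mathbf R,\mathbf C\in\mathbb R^{n\times n}$ be nonnegative with positive diagonals, $\mathbf R$ row-stochastic and $\mathbf C$ column-stochastic. For a nonnegative matrix $\mathbf M$, $\mathcal G_{\mathbf M}$ is the digraph with an edge $(j,i)$ iff $m_{ij}>0$. Assume that some vertex is the root of a spanning tree of $\mathcal G_{\mathbf R}$ and also of a spanning tree of $\mathcal G_{\mathbf C^\intercal}$. **Algorithm.** Let $\gamma\in(0,1)$, $\alpha>0$. At each time $k=0,1,\dots$, independently of the other times, an agent $i_k$ is drawn uniformly from $\{1,\dots,n\}$, and, conditionally independently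 given $i_k$, $j_k$ is drawn uniformly from the out-neighbours of $i_k$ in $\mathcal G_{\mathbf R}$ other than $i_k$, and $l_k$ uniformly from those in $\mathcal G_{\mathbf C}$. Put $$\mathbf T_k=e_{j_k}e_{i_k}^\intercal-e_{j_k}e_{j_k}^\intercal,\quad \mathbf E_k=e_{l_k}e_{i_k}^\intercal-e_{i_k}e_{i_k}^\intercal,\quad \mathbf R_k=\mathbf I+\gamma\mathbf T_k,\quad \mathbf C_k=\mathbf I+\gamma\mathbf E_k,\quad \mathbf Q_k=\mathrm{diag}(e_{i_k}+e_{j_k}+e_{l_k});$$ if there is no out-neighbour to choose, the corresponding $\mathbf T_k$ or $\mathbf E_k$ is $0$ and the corresponding unit vector in $\mathbf Q_k$ is dropped. From an arbitrary deterministic $\mathbf x_0$ and $\mathbf y_0=\nabla F(\mathbf x_0)$, $$\mathbf x_{k+1}=\mathbf R_k\mathbf x_k-\alpha\mathbf Q_k\mathbf y_k,\qquad \mathbf y_{k+1}=\mathbf C_k\mathbf y_k+\nabla F(\mathbf x_{k+1})-\nabla F(\mathbf x_k).$$ **Norms.** Let $\bar{\mathbf R},\bar{\mathbf C},\bar{\mathbf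 T},\bar{\mathbf E}$ be the expectations of $\mathbf R_k,\mathbf C_k,\mathbf T_k,\mathbf E_k$, and $\tilde{\mathbf R}_k=\mathbf R_k-\bar{\mathbf R}$, $\tilde{\mathbf T}_k=\mathbf T_k-\bar{\mathbf T}$, $\tilde{\mathbf E}_k=\mathbf E_k-\bar{\mathbf E}$. Let $\bar u^\intercal\bar{\mathbf R}=\bar u^\intercal$, $\bar u^\intercal\mathbf 1=n$, $\bar{\mathbf C}\bar v=\bar v$, $\mathbf 1^\intercal\bar v=n$, and $\bar x_k=\frac1n\bar u^\intercal\mathbf x_k$, $\bar y_k=\frac1n\mathbf 1^\intercal\mathbf y_k$. Fix decompositions $\bar{\mathbf T}=\mathbf S^{-1}\mathbf J_{\mathrm T}\mathbf S$ and $\bar{\mathbf E}=\mathbf D^{-1}\mathbf J_{\mathrm E}\mathbf D$ with complex matrices, where $\mathbf J_{\mathrm T},\mathbf J_{\mathrm E}$ have top-left entry $0$ and differ from Jordan forms only in the values of the superdiagonal entries inside the Jordan blocks, and the first rows of $\mathbf S,\mathbf D$ are $\bar u^\intercal,\mathbf 1^\intercal$. For $z\in\mathbb R^n$ let $\|z\|_{\mathrm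 S}=\tau_{\mathrm S}\|\mathbf Sz\|_2$ and $\|z\|_{\mathrm D}=\tau_{\mathrm D}\|\mathbf Dz\|_2$, with $\tau_{\mathrm S},\tau_{\mathrm D}>0$ such that $\|z\|_2\le\|z\|_{\mathrm S}$ and $\|z\|_2\le\|z\|_{\mathrm D}$ for all $z$. For an $n\times p$ matrix, $\|\mathbf x\|_{\mathrm S}$ and $\|\mathbf x\|_{\mathrm D}$ are the Euclidean norms of the vectors of the norms of the columns. For an $n\times n$ matrix, $\|\mathbf W\|_2$ is the spectral norm and $\|\mathbf W\|_{\mathrm D}=\|\mathbf D\mathbf W\mathbf D^{-1}\|_2$. Let $\delta_{\mathrm{S,D}},\delta_{\mathrm{D},2}$ be constants with $\|z\|_{\mathrm S}\le\delta_{\mathrm{S,D}}\|z\|_{\mathrm D}$ and $\|z\|_{\mathrm D}\le\delta_{\mathrm{D},2}\|z\|_2$ for all $z$. **Constants.** For random real $\mathbf M_k$ and invertible $\mathbf S$ write $\mathcal V_{\mathbf S}(\mathbf M_k)=\mathbb E\big[(\mathbf S^{-1})^{\mathsf H}\mathbf M_k^{\mathsf H}\mathbf S^{\mathsf H}\mathbf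 S\mathbf M_k\mathbf S^{-1}\big]$, and put $\Pi=\mathbf I-\frac1n\mathbf 1\bar u^\intercal$, $\bar{\mathbf V}_{\mathrm T}=\mathcal V_{\mathbf S}(\Pi\tilde{\mathbf T}_k)$, $\bar{\mathbf V}_{\mathrm Q}=\mathcal V_{\mathbf S}(\Pi\mathbf Q_k)$, $\bar{\mathbf V}_{\mathrm E}=\mathcal V_{\mathbf D}(\tilde{\mathbf E}_k)$, and $$\sigma_{\bar{\mathrm R}}=\|\mathbf I-\mathrm{diag}(e_1)+\gamma\mathbf J_{\mathrm T}\|_2^2+\gamma^2\|\bar{\mathbf V}_{\mathrm T}\|_2,\quad \sigma_{\bar{\mathrm C}}=\|\mathbf I-\mathrm{diag}(e_1)+\gamma\mathbf J_{\mathrm E}\|_2^2+2\gamma^2\|\bar{\mathbf V}_{\mathrm E}\|_2,\quad \eta=\tfrac1n\bar u^\intercal\mathbb E[\mathbf Q_k]\bar v .$$ Let $\bar\gamma_{\mathrm R},\bar\gamma_{\mathrm C}$ be such that $\sigma_{\bar{\mathrm R}}<1$ for all values of the mixing weight in $(0,\bar\gamma_{\mathrm R})$ and $\sigma_{\bar{\mathrm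 C}}<1$ for all values in $(0,\bar\gamma_{\mathrm C})$. Let $$d_1=\tfrac{4}{n^2}\|\mathbb E[\mathbf Q_k^\intercal\bar u\bar u^\intercal\mathbf Q_k]\|_2,\qquad d_2=3\,\tfrac{1+\sigma_{\bar{\mathrm R}}}{1-\sigma_{\bar{\mathrm R}}}\|\bar{\mathbf V}_{\mathrm Q}\|_2,\qquad d_3=4\delta_{\mathrm D,2}^2\tfrac{1+\sigma_{\bar{\mathrm C}}}{1-\sigma_{\bar{\mathrm C}}}\big\|\mathbf I-\tfrac{\bar v\mathbf 1^\intercal}{n}\big\|_{\mathrm D}^2\,\mathbb E[\|\mathbf Q_k\|_2^2],$$ $$d_4=\tfrac{1+\sigma_{\bar{\mathrm C}}}{\sigma_{\bar{\mathrm C}}}\|\bar{\mathbf V}_{\mathrm E}\|_2\|\bar v\|_{\mathrm D}^2,\qquad d_5=\tfrac2{n^2}\|\mathbb E[\tilde{\mathbf R}_k^\intercal\bar u\bar u^\intercal\tilde{\mathbf R}_k]\|_2,$$ $$d_6=\delta_{\mathrm D,2}^2\tfrac{1+\sigma_{\bar{\mathrm C}}}{1-\sigma_{\bar{\mathrm C}}}\big\|\mathbf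 I-\tfrac{\bar v\mathbf 1^\intercal}{n}\big\|_{\mathrm D}^2\,\mathbb E[\|\mathbf R_k-\mathbf I\|_2^2],\qquad d_7=\tfrac1{n^2}\|\bar u^\intercal\mathbb E[\mathbf Q_k]\|_2^2,$$ $$\begin{aligned}c_4={}&\tfrac{6\eta L^4}{\mu n}d_2\delta_{\mathrm{S,D}}^2(d_6+\gamma^2d_4)+\tfrac{6L^4}{\eta\mu}d_2d_7\|\bar v\|_{\mathrm S}^2(2d_6+\gamma^2d_4)+\tfrac{3(1-\sigma_{\bar{\mathrm R}})}2\tfrac{L^4d_3d_7}{\eta\mu}\|\bar v\|_2^2\\&+\eta\mu L^2d_2\delta_{\mathrm{S,D}}^2(2d_6+\gamma^2d_4)+\tfrac{3(1-\sigma_{\bar{\mathrm C}})}4\tfrac{\eta L^4d_2}{\mu n}\|\bar v\|_{\mathrm S}^2,\end{aligned}$$ $$c_5=2L^2d_2d_5\delta_{\mathrm{S,D}}^2(d_6+\gamma^2d_4)+\tfrac{1-\sigma_{\bar{\mathrm C}}}4L^2d_2d_5\|\bar v\|_{\mathrm S}^2,$$ $$c_6=\tfrac1{32}\eta\mu(1-\sigma_{\bar{\mathrm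 R}})(1-\sigma_{\bar{\mathrm C}})-\tfrac{3(1-\sigma_{\bar{\mathrm R}})}2\tfrac{L^2d_4d_7}{\eta\mu}\gamma^2,$$ and let $\mathbf B$ be the $3\times3$ matrix with the entries $$\begin{aligned} b_{11}&=1-\alpha\eta\mu+2\alpha^2L^2\|\bar v\|_2^2d_1, & b_{12}&=\tfrac{2\alpha\eta L^2}{\mu n}+\tfrac{2\alpha^2L^2\|\bar v\|_2^2d_1}{n}+d_5, & b_{13}&=\tfrac{2\alpha}{\eta\mu}d_7+\alpha^2d_1,\\ b_{21}&=\alpha^2L^2d_2\|\bar v\|_{\mathrm S}^2, & b_{22}&=\tfrac{1+\sigma_{\bar{\mathrm R}}}2+\tfrac{\alpha^2L^2d_2\|\bar v\|_{\mathrm S}^2}{n}, & b_{23}&=\alpha^2d_2\delta_{\mathrm{S,D}}^2,\\ b_{31}&=2L^2(\gamma^2d_4+\alpha^2L^2d_3\|\bar v\|_2^2), & b_{32}&=2L^2\big(d_6+\tfrac{\alpha^2L^2d_3\|\bar v\|_2^2+\gamma^2d_4}{n}\big), & b_{33}&=\tfrac{1+\sigma_{\bar{\mathrm C}}}2+\alpha^2L^2d_3.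 \end{aligned}$$ **Theorem (linear convergence of G-Push-Pull).** If $$\gamma<\min\Big\{\bar\gamma_{\mathrm R},\ \bar\gamma_{\mathrm C},\ \frac{\eta\mu\sqrt{1-\sigma_{\bar{\mathrm C}}}}{8L\sqrt{d_4d_7}}\Big\}\qquad\text{and}\qquad \alpha\le\frac{2c_6}{c_5+\sqrt{c_5^2+4c_4c_6}},$$ then the spectral radius $\rho(\mathbf B)$ is less than $1$, and $\mathbb E\big[\|\bar x_k-x^*\|_2^2\big]$, $\mathbb E\big[\|\mathbf x_k-\mathbf 1\bar x_k\|_{\mathrm S}^2\big]$ and $\mathbb E\big[\|\mathbf y_k-\bar v\bar y_k\|_{\mathrm D}^2\big]$ all converge to $0$ at the linear rate $\mathcal O(\rho(\mathbf B)^k)$. -/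

import Mathlib

open Filter Topology MeasureTheory ProbabilityTheory Matrix

noncomputable section

namespace GPushPull

/-! ### Digraphs induced by nonnegative matrices, spanning trees and their roots -/

/-- The digraph induced by `M`: there is an edge from `j` to `i` iff `M i j > 0`. -/
def edge {n : ℕ} (M : Matrix (Fin n) (Fin n) ℝ) (j i : Fin n) : Prop :=
  0 < M i j

/-- `P` is the edge relation of a spanning tree, with root `r`, of the digraph with edge
relation `E`: a subgraph in which every vertex except the root has exactly one parent, the
root has none, and every vertex is reached from the root by a directed path. -/
structure IsSpanningTree {V : Type*} (E P : V → V → Prop) (r : V) : Prop where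
  sub : ∀ i j, P i j → E i j
  root_no_parent : ∀ i, ¬ P i r
  unique_parent : ∀ j, j ≠ r → ∃! i, P i j
  reach : ∀ j, Relation.ReflTransGen P r j

/-- The set of roots of all possible spanning trees of the digraph induced by `M`. -/
def roots {n : ℕ} (M : Matrix (Fin n) (Fin n) ℝ) : Set (Fin n) :=
  {r | ∃ P : Fin n → Fin n → Prop, IsSpanningTree (edge M) P r}

/-- Nonnegative, row-stochastic, with positive diagonal. -/
structure IsRowStochastic {n : ℕ} (R : Matrix (Fin n) (Fin n) ℝ) : Prop where
  nonneg : ∀ i j, 0 ≤ R i j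
  row_sum : ∀ i, ∑ j, R i j = 1
  diag_pos : ∀ i, 0 < R i i

/-- Nonnegative, column-stochastic, with positive diagonal. -/
structure IsColStochastic {n : ℕ} (C : Matrix (Fin n) (Fin n) ℝ) : Prop where
  nonneg : ∀ i j, 0 ≤ C i j
  col_sum : ∀ j, ∑ i, C i j = 1
  diag_pos : ∀ i, 0 < C i i

/-! ### The random draw of one time slot -/

open scoped Classical in
/-- The agents other than `i` to which `i` has an edge in the digraph induced by `M`. -/
def outNbr {n : ℕ} (M : Matrix (Fin n) (Fin n) ℝ) (i : Fin n) : Finset (Fin n) :=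
  Finset.univ.filter fun j => j ≠ i ∧ edge M i j

/-- The outcome `(i, j, l)` of a time slot: the agent `i` that wakes up, the out-neighbour `j`
that receives its `x` and the out-neighbour `l` that receives a share of its `y`; `none` means
that `i` has no out-neighbour in the respective graph. -/
abbrev Draw (n : ℕ) : Type := Fin n × Option (Fin n) × Option (Fin n)

instance instMeasurableSpaceDraw (n : ℕ) : MeasurableSpace (Draw n) := ⊤

open scoped Classical in
/-- The law of an out-neighbour of `i` chosen uniformly at random, if there is any. -/
def pick {n : ℕ} (M : Matrix (Fin n) (Fin n) ℝ) (i : Fin n) : Option (Fin n) → ℝ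
  | none => if outNbr M i = ∅ then 1 else 0
  | some j => if j ∈ outNbr M i then 1 / ((outNbr M i).card : ℝ) else 0

/-- The law of a draw: `i` is uniform on all agents and, given `i`, the agents `j` and `l` are
chosen independently and uniformly among its out-neighbours in the two graphs. -/
def drawProb {n : ℕ} (R C : Matrix (Fin n) (Fin n) ℝ) (d : Draw n) : ℝ :=
  1 / (n : ℝ) * pick R d.1 d.2.1 * pick C d.1 d.2.2

/-- The expectation of a function of one draw. -/
def expect {n : ℕ} {V : Type*} [AddCommMonoid V] [Module ℝ V]
    (R C : Matrix (Fin n) (Fin n) ℝ) (W : Draw n → V) : V :=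
  ∑ d, drawProb R C d • W d

/-- The unit vector `e_i`. -/
def unitVec {n : ℕ} (i : Fin n) : Fin n → ℝ := Pi.single i 1

/-- `T_k = e_j e_iᵀ - e_j e_jᵀ`, and `0` if nobody receives `x`. -/
def drawT {n : ℕ} : Draw n → Matrix (Fin n) (Fin n) ℝ
  | (_, none, _) => 0
  | (i, some j, _) => vecMulVec (unitVec j) (unitVec i) - vecMulVec (unitVec j) (unitVec j)

/-- `E_k = e_l e_iᵀ - e_i e_iᵀ`, and `0` if nobody receives `y`. -/
def drawE {n : ℕ} : Draw n → Matrix (Fin n) (Fin n) ℝ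
  | (_, _, none) => 0
  | (i, _, some l) => vecMulVec (unitVec l) (unitVec i) - vecMulVec (unitVec i) (unitVec i)

/-- `Q_k = diag (e_i + e_j + e_l)`, where a missing agent contributes nothing. -/
def drawQ {n : ℕ} (d : Draw n) : Matrix (Fin n) (Fin n) ℝ :=
  diagonal (unitVec d.1 + d.2.1.elim 0 unitVec + d.2.2.elim 0 unitVec)

/-- `R_k = I + γ T_k`. -/
def drawR {n : ℕ} (γ : ℝ) (d : Draw n) : Matrix (Fin n) (Fin n) ℝ := 1 + γ • drawT d

/-- `C_k = I + γ E_k`. -/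
def drawC {n : ℕ} (γ : ℝ) (d : Draw n) : Matrix (Fin n) (Fin n) ℝ := 1 + γ • drawE d

/-! ### The algorithm -/

/-- One vector of `ℝ^p` per agent: the rows of an `n × p` matrix. -/
abbrev Stack (n p : ℕ) : Type := Fin n → EuclideanSpace ℝ (Fin p)

/-- The product of an `n × n` matrix and a stacked (`n × p`) variable. -/
def act {n p : ℕ} (W : Matrix (Fin n) (Fin n) ℝ) (x : Stack n p) : Stack n p :=
  fun i => ∑ j, W i j • x j

/-- `∇F(x)`: the stack of the gradients `∇f_i(x_i)`. -/
def gradStack {n p : ℕ} (f : Fin n → EuclideanSpace ℝ (Fin p) → ℝ) (x : Stack n p) :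
    Stack n p :=
  fun i => gradient (f i) (x i)

/-- The pair `(x_k, y_k)` of the G-Push-Pull recursion
`x_{k+1} = R_k x_k - α Q_k y_k`, `y_{k+1} = C_k y_k + ∇F(x_{k+1}) - ∇F(x_k)`
with `y_0 = ∇F(x_0)`, driven by the sequence of draws `ξ`. -/
def iter {n p : ℕ} (γ α : ℝ) (f : Fin n → EuclideanSpace ℝ (Fin p) → ℝ) (x₀ : Stack n p)
    (ξ : ℕ → Draw n) : ℕ → Stack n p × Stack n p
  | 0 => (x₀, gradStack f x₀)
  | k + 1 =>
    let x := (iter γ α f x₀ ξ k).1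
    let y := (iter γ α f x₀ ξ k).2
    let x' := act (drawR γ (ξ k)) x - α • act (drawQ (ξ k)) y
    (x', act (drawC γ (ξ k)) y + gradStack f x' - gradStack f x)

/-- `(1/n) wᵀ x`, a vector of `ℝ^p`. -/
def wavg {n p : ℕ} (w : Fin n → ℝ) (x : Stack n p) : EuclideanSpace ℝ (Fin p) :=
  (1 / (n : ℝ)) • ∑ i, w i • x i

/-! ### Norms -/

/-- The Euclidean norm of a vector. -/
def vec2 {n : ℕ} (z : Fin n → ℝ) : ℝ := ‖WithLp.toLp 2 z‖

/-- The spectral norm of a square matrix: its operator norm for the Euclidean norm. -/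
def spec2 {𝕜 : Type*} [RCLike 𝕜] {n : ℕ} (A : Matrix (Fin n) (Fin n) 𝕜) : ℝ :=
  ‖Matrix.toEuclideanCLM (n := Fin n) (𝕜 := 𝕜) A‖

/-- A real matrix read as a complex one. -/
def cplx {m : Type*} (A : Matrix m m ℝ) : Matrix m m ℂ := A.map (fun r => (r : ℂ))

/-- The rescaled vector norm `τ ‖S z‖₂`. -/
def vecNorm {n : ℕ} (τ : ℝ) (S : Matrix (Fin n) (Fin n) ℂ) (z : Fin n → ℝ) : ℝ :=
  τ * ‖WithLp.toLp 2 (S *ᵥ fun i => (z i : ℂ))‖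

/-- The operator norm that the vector norm `τ ‖D z‖₂` induces on matrices. It does not depend
on the factor `τ`. -/
def matNorm {n : ℕ} (D : Matrix (Fin n) (Fin n) ℂ) (A : Matrix (Fin n) (Fin n) ℝ) : ℝ :=
  spec2 (D * cplx A * D⁻¹)

/-- The extension of a vector norm from `ℝ^n` to `n × p` matrices: the Euclidean norm of the
vector of the norms of the columns. -/
def stackNorm {n p : ℕ} (N : (Fin n → ℝ) → ℝ) (x : Stack n p) : ℝ :=
  Real.sqrt (∑ c : Fin p, (N fun i => x i c) ^ 2)

/-! ### Jordan-type decompositions and the contraction factors -/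

/-- `A = S⁻¹ J S`, where `J` differs from a Jordan form of `A` only in the values of the
superdiagonal entries inside the Jordan blocks, `J` has `0` on its top left and `S` has `w` as
its first row. -/
structure IsScaledJordan {n : ℕ} [NeZero n] (A : Matrix (Fin n) (Fin n) ℝ) (w : Fin n → ℝ)
    (S J : Matrix (Fin n) (Fin n) ℂ) : Prop where
  isUnit_det : IsUnit S.det
  eq : cplx A = S⁻¹ * J * S
  first_row : ∀ j, S 0 j = (w j : ℂ)
  top_left : J 0 0 = 0
  bidiagonal : ∀ i j, J i j ≠ 0 → i = j ∨ (j.val = i.val + 1 ∧ J i i = J j j)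

/-- `I - diag(e_1) + γ J`. -/
def shiftJ {n : ℕ} [NeZero n] (γ : ℝ) (J : Matrix (Fin n) (Fin n) ℂ) :
    Matrix (Fin n) (Fin n) ℂ :=
  1 - diagonal (Pi.single 0 1) + γ • J

/-- `I - 1 uᵀ / n`. -/
def projX {n : ℕ} (u : Fin n → ℝ) : Matrix (Fin n) (Fin n) ℝ :=
  1 - (1 / (n : ℝ)) • vecMulVec (fun _ => 1) u

/-- `I - v 1ᵀ / n`. -/
def projY {n : ℕ} (v : Fin n → ℝ) : Matrix (Fin n) (Fin n) ℝ :=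
  1 - (1 / (n : ℝ)) • vecMulVec v (fun _ => 1)

/-- `E[(S⁻¹)ᴴ M_kᴴ Sᴴ S M_k S⁻¹]` for a random real matrix `M_k`. -/
def secondMoment {n : ℕ} (R C : Matrix (Fin n) (Fin n) ℝ) (S : Matrix (Fin n) (Fin n) ℂ)
    (M : Draw n → Matrix (Fin n) (Fin n) ℝ) : Matrix (Fin n) (Fin n) ℂ :=
  expect R C fun d => (S⁻¹)ᴴ * (cplx (M d))ᴴ * Sᴴ * S * cplx (M d) * S⁻¹

/-- The centred matrix `T_k - E[T_k]`. -/
def centT {n : ℕ} (R C : Matrix (Fin n) (Fin n) ℝ) (d : Draw n) : Matrix (Fin n) (Fin n) ℝ :=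
  drawT d - expect R C drawT

/-- The centred matrix `E_k - E[E_k]`. -/
def centE {n : ℕ} (R C : Matrix (Fin n) (Fin n) ℝ) (d : Draw n) : Matrix (Fin n) (Fin n) ℝ :=
  drawE d - expect R C drawE

/-- The matrix `V_T`. -/
def VT {n : ℕ} (R C : Matrix (Fin n) (Fin n) ℝ) (u : Fin n → ℝ)
    (S : Matrix (Fin n) (Fin n) ℂ) : Matrix (Fin n) (Fin n) ℂ :=
  secondMoment R C S fun d => projX u * centT R C d

/-- The matrix `V_Q`. -/
def VQ {n : ℕ} (R C : Matrix (Fin n) (Fin n) ℝ) (u : Fin n → ℝ)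
    (S : Matrix (Fin n) (Fin n) ℂ) : Matrix (Fin n) (Fin n) ℂ :=
  secondMoment R C S fun d => projX u * drawQ d

/-- The matrix `V_E`. -/
def VE {n : ℕ} (R C : Matrix (Fin n) (Fin n) ℝ) (D : Matrix (Fin n) (Fin n) ℂ) :
    Matrix (Fin n) (Fin n) ℂ :=
  secondMoment R C D fun d => centE R C d

/-- `σ_R = ‖I - diag(e_1) + γ J_T‖₂² + γ² ‖V_T‖₂`. -/
def sigmaR {n : ℕ} [NeZero n] (R C : Matrix (Fin n) (Fin n) ℝ) (u : Fin n → ℝ)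
    (S J : Matrix (Fin n) (Fin n) ℂ) (γ : ℝ) : ℝ :=
  spec2 (shiftJ γ J) ^ 2 + γ ^ 2 * spec2 (VT R C u S)

/-- `σ_C = ‖I - diag(e_1) + γ J_E‖₂² + 2 γ² ‖V_E‖₂`. -/
def sigmaC {n : ℕ} [NeZero n] (R C : Matrix (Fin n) (Fin n) ℝ)
    (D J : Matrix (Fin n) (Fin n) ℂ) (γ : ℝ) : ℝ :=
  spec2 (shiftJ γ J) ^ 2 + 2 * γ ^ 2 * spec2 (VE R C D)

/-! ### Linear convergence -/

/-- The spectral radius of a real square matrix (over its complex eigenvalues). -/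
def rho {m : Type*} [Fintype m] [DecidableEq m] (B : Matrix m m ℝ) : ENNReal :=
  spectralRadius ℂ (cplx B)

/-- `a_k` converges to `0` at the linear rate `O(r^k)`. -/
def ConvergesAtRate (a : ℕ → ℝ) (r : ℝ) : Prop :=
  Tendsto a atTop (𝓝 0) ∧ a =O[atTop] fun k => r ^ k

end GPushPull

end

noncomputable section

namespace GPushPull

/-! ### Gradients of convex functions -/

section Convex

variable {E : Type*} [NormedAddCommGroup E] [InnerProductSpace ℝ E] [CompleteSpace E]

/-! Conditionally on the past, the mean square optimality, consensus and tracking errors after one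
step are at most `B` times the vector of current errors. As the draws are independent, the
expectations satisfy `z (k+1) ≤ B z k` entrywise. The matrix `B` is positive, so it has a positive
vector `w` with `B w = r w`, and `r` is its spectral radius. A multiple of `w` dominates `z 0`,
hence `z k = O(r ^ k)`. What remains is `r < 1`, which for a positive `3 × 3` matrix with diagonal
below one follows from `det (I - B) > 0`.

The one-step bounds (`optimality_recursion`, `consensus_recursion`, `tracking_recursion`) split an
error into its conditional mean and centred noise, whose mean squares add. The consensus and
tracking errors have no component along the first rows of `S` and `D`, so there the mean matrices
act as `I - diag(e_1) + γ J`; the noise is measured by second moments, and the remaining terms are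
split off by Young's inequality. The weighted average of `x` makes, up to consensus and tracking
errors, a gradient step of length `αη`; cocoercivity (`gradient_cocoercive`) gives that step the
factor `1 - αημ`.

The stepsize condition says `c₄ α² + c₅ α ≤ c₆`, which is `det (I - B) > 0` after simplifying the
entries (`transition_det_pos`). The simplification needs `α` to be small also against `d₁`, `d₃`,
`d₆` and `L`. Those bounds come from two single summands of `c₄ α² ≤ c₆`, combined with relations
between the constants: `d₁² ≤ 64 d₇`, `4 d₇ ≤ d₁`, `‖v‖² ≤ n δ²`, `n (1 - σ_C) ≤ 4γ`, and above all
`‖v‖² (1 - σ_C)² ≤ (147/400) δ² (1 + σ_C)` (`tracking_noise_bound`), where `δ` is `δD2`. The last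
one holds since the trace of the mean of `E_k` keeps `σ_C` from being small, and since either every
agent passes on some `y`, so that the noise `V_E` is bounded below, or some agent is a sink, so that
`v` is concentrated there and `δ` is large. -/

theorem hasDerivAt_along_line {h : E → ℝ} {G : E → E} (hG : ∀ x, HasGradientAt h (G x) x)
    (x v : E) (t : ℝ) :
    HasDerivAt (fun t : ℝ => h (x + t • v)) (inner ℝ (G (x + t • v)) v) t := by
  have h1 : HasDerivAt (fun t : ℝ => x + t • v) v t := by
    simpa using ((hasDerivAt_id t).smul_const v).const_add x
  exact ((hG (x + t • v)).hasFDerivAt.comp_hasDerivAt t h1).congr_deriv (by simp)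

/-- Along the segment from `x` to `x + v`, both `h` minus its tangent and the quadratic model minus
`h` have nonnegative derivative. Only one-sided inner product bounds on `G` are needed; a Lipschitz
bound is not. -/
theorem first_order_bounds {h : E → ℝ} {G : E → E} (hG : ∀ x, HasGradientAt h (G x) x)
    {ℓ : ℝ} (h0 : ∀ x y, 0 ≤ inner ℝ (G x - G y) (x - y))
    (h1 : ∀ x y, inner ℝ (G x - G y) (x - y) ≤ ℓ * ‖x - y‖ ^ 2) (x v : E) :
    h x + inner ℝ (G x) v ≤ h (x + v) ∧
      h (x + v) ≤ h x + inner ℝ (G x) v + ℓ / 2 * ‖v‖ ^ 2 := by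
  have hd := hasDerivAt_along_line hG x v
  have key : ∀ t : ℝ, inner ℝ (G (x + t • v) - G x) ((x + t • v) - x)
      = t * (inner ℝ (G (x + t • v)) v - inner ℝ (G x) v) := by
    intro t
    rw [add_sub_cancel_left, inner_smul_right, inner_sub_left]
  have lo : ∀ t ∈ interior (Set.Icc (0 : ℝ) 1),
      0 ≤ inner ℝ (G (x + t • v)) v - inner ℝ (G x) v := by
    intro t ht
    rw [interior_Icc] at ht
    have := h0 (x + t • v) x
    rw [key] at this
    exact nonneg_of_mul_nonneg_right this ht.1
  have hi : ∀ t ∈ interior (Set.Icc (0 : ℝ) 1),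
      0 ≤ inner ℝ (G x) v + ℓ * t * ‖v‖ ^ 2 - inner ℝ (G (x + t • v)) v := by
    intro t ht
    rw [interior_Icc] at ht
    have := h1 (x + t • v) x
    rw [key, add_sub_cancel_left, norm_smul, mul_pow, Real.norm_eq_abs, sq_abs] at this
    have : t * (inner ℝ (G (x + t • v)) v - inner ℝ (G x) v) ≤ t * (ℓ * t * ‖v‖ ^ 2) := by
      linarith
    have := le_of_mul_le_mul_left this ht.1
    linarith
  have d1 : ∀ t : ℝ, HasDerivAt (fun t : ℝ => h (x + t • v) - t * inner ℝ (G x) v)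
      (inner ℝ (G (x + t • v)) v - inner ℝ (G x) v) t := by
    intro t
    exact ((hd t).fun_sub ((hasDerivAt_id' t).mul_const (inner ℝ (G x) v))).congr_deriv
      (by simp)
  have d2 : ∀ t : ℝ, HasDerivAt
      (fun t : ℝ => t * inner ℝ (G x) v + ℓ / 2 * ‖v‖ ^ 2 * t ^ 2 - h (x + t • v))
      (inner ℝ (G x) v + ℓ * t * ‖v‖ ^ 2 - inner ℝ (G (x + t • v)) v) t := by
    intro t
    refine ((((hasDerivAt_id' t).mul_const (inner ℝ (G x) v)).fun_add
      ((hasDerivAt_pow 2 t).const_mul (ℓ / 2 * ‖v‖ ^ 2))).fun_sub (hd t)).congr_deriv ?_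
    simp
    ring
  have m1 := monotoneOn_of_deriv_nonneg (convex_Icc (0 : ℝ) 1)
    (fun t _ => (d1 t).continuousAt.continuousWithinAt)
    (fun t _ => (d1 t).differentiableAt.differentiableWithinAt)
    (fun t ht => by rw [(d1 t).deriv]; exact lo t ht)
  have m2 := monotoneOn_of_deriv_nonneg (convex_Icc (0 : ℝ) 1)
    (fun t _ => (d2 t).continuousAt.continuousWithinAt)
    (fun t _ => (d2 t).differentiableAt.differentiableWithinAt)
    (fun t ht => by rw [(d2 t).deriv]; exact hi t ht)
  have e1 := m1 (Set.left_mem_Icc.2 zero_le_one) (Set.right_mem_Icc.2 zero_le_one) zero_le_one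
  have e2 := m2 (Set.left_mem_Icc.2 zero_le_one) (Set.right_mem_Icc.2 zero_le_one) zero_le_one
  simp at e1 e2
  constructor <;> linarith

/-- Cocoercivity of the gradient of a convex function (Baillon–Haddad). -/
theorem gradient_cocoercive {h : E → ℝ} {G : E → E} (hG : ∀ x, HasGradientAt h (G x) x)
    {ℓ : ℝ} (h0 : ∀ x y, 0 ≤ inner ℝ (G x - G y) (x - y))
    (h1 : ∀ x y, inner ℝ (G x - G y) (x - y) ≤ ℓ * ‖x - y‖ ^ 2) (x y : E) :
    ‖G x - G y‖ ^ 2 ≤ ℓ * inner ℝ (G x - G y) (x - y) := by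
  -- The point `y - t (G y - G x)` is compared with the tangent at `x` from below and with the
  -- quadratic model at `y` from above. Adding the version with `x` and `y` exchanged cancels the
  -- function values.
  have half : ∀ (x y : E) (t : ℝ), h x + inner ℝ (G x) (y - x) + t * ‖G y - G x‖ ^ 2
      - ℓ * t ^ 2 / 2 * ‖G y - G x‖ ^ 2 ≤ h y := by
    intro x y t
    have lo := (first_order_bounds hG h0 h1 x (y - x - t • (G y - G x))).1
    have hi := (first_order_bounds hG h0 h1 y (-(t • (G y - G x)))).2
    have e : x + (y - x - t • (G y - G x)) = y + -(t • (G y - G x)) := by abel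
    rw [e] at lo
    rw [inner_sub_right, inner_smul_right] at lo
    rw [inner_neg_right, inner_smul_right, norm_neg, norm_smul, mul_pow, Real.norm_eq_abs,
      sq_abs] at hi
    have e2 : inner ℝ (G y) (G y - G x) - inner ℝ (G x) (G y - G x) = ‖G y - G x‖ ^ 2 := by
      rw [← inner_sub_left, real_inner_self_eq_norm_sq]
    rw [← e2] at hi ⊢
    nlinarith
  have sum : ∀ t : ℝ, 2 * t * ‖G x - G y‖ ^ 2 - ℓ * t ^ 2 * ‖G x - G y‖ ^ 2 ≤
      inner ℝ (G x - G y) (x - y) := by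
    intro t
    have a := half x y t
    have b := half y x t
    rw [norm_sub_rev] at a
    have e : inner ℝ (G x - G y) (x - y)
        = -(inner ℝ (G x) (y - x) + inner ℝ (G y) (x - y)) := by
      rw [inner_sub_left, ← neg_sub y x, inner_neg_right, inner_neg_right]; ring
    rw [e]; linarith
  rcases eq_or_ne x y with rfl | hxy
  · simp
  have hl : 0 ≤ ℓ := by
    have h2 := (h0 x y).trans (h1 x y)
    have : 0 < ‖x - y‖ ^ 2 := by have := norm_pos_iff.2 (sub_ne_zero.2 hxy); positivity
    exact nonneg_of_mul_nonneg_left h2 this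
  -- The best choice is `t = 1/ℓ`; for `ℓ = 0` the inner product vanishes and `t = 1` suffices.
  rcases hl.eq_or_lt with h00 | hpos
  · subst h00
    have hI : inner ℝ (G x - G y) (x - y) = 0 :=
      le_antisymm (by simpa using h1 x y) (h0 x y)
    have := sum 1
    rw [hI] at this ⊢
    linarith [sq_nonneg ‖G x - G y‖]
  · have := sum (1 / ℓ)
    have e : 2 * (1 / ℓ) * ‖G x - G y‖ ^ 2 - ℓ * (1 / ℓ) ^ 2 * ‖G x - G y‖ ^ 2
        = ‖G x - G y‖ ^ 2 / ℓ := by field_simp; ring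
    rw [e, div_le_iff₀ hpos] at this
    linarith

/-- A gradient step on a strongly convex function with Lipschitz gradient is a contraction. -/
theorem gradient_step_contraction {f : E → ℝ} {G : E → E} (hG : ∀ x, HasGradientAt f (G x) x)
    {μ L a : ℝ} (ha : 0 ≤ a) (haL : a * L ≤ 1)
    (hm : ∀ x y, μ * ‖x - y‖ ^ 2 ≤ inner ℝ (G x - G y) (x - y))
    (hL : ∀ x y, ‖G x - G y‖ ≤ L * ‖x - y‖) (x y : E) :
    ‖(x - a • G x) - (y - a • G y)‖ ^ 2 ≤ (1 - a * μ) ^ 2 * ‖x - y‖ ^ 2 := by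
  -- The step map is itself a gradient. It is monotone because `a L ≤ 1`, and strong convexity
  -- bounds it above with constant `1 - a μ`; cocoercivity followed by that bound yields the square
  -- of this factor.
  have hψ : ∀ x, HasGradientAt (fun x => (1 / 2 : ℝ) * ‖x‖ ^ 2 - a * f x) (x - a • G x) x := by
    intro x
    rw [hasGradientAt_iff_hasFDerivAt]
    have h1 := ((hasStrictFDerivAt_norm_sq x).hasFDerivAt.const_mul (1 / 2 : ℝ)).sub
      ((hG x).hasFDerivAt.const_mul a)
    refine h1.congr_fderiv ?_
    ext v
    simp
  have ex : ∀ x y, inner ℝ ((x - a • G x) - (y - a • G y)) (x - y)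
      = ‖x - y‖ ^ 2 - a * inner ℝ (G x - G y) (x - y) := by
    intro x y
    have : (x - a • G x) - (y - a • G y) = (x - y) - a • (G x - G y) := by
      rw [smul_sub]; abel
    rw [this, inner_sub_left, real_inner_self_eq_norm_sq, real_inner_smul_left]
  have cs : ∀ x y, inner ℝ (G x - G y) (x - y) ≤ L * ‖x - y‖ ^ 2 := by
    intro x y
    calc _ ≤ ‖G x - G y‖ * ‖x - y‖ := real_inner_le_norm _ _
      _ ≤ L * ‖x - y‖ * ‖x - y‖ := by gcongr; exact hL x y
      _ = _ := by ring
  have h0 : ∀ x y, 0 ≤ inner ℝ ((x - a • G x) - (y - a • G y)) (x - y) := by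
    intro x y
    rw [ex]
    have := mul_le_mul_of_nonneg_left (cs x y) ha
    nlinarith [sq_nonneg ‖x - y‖]
  have h1 : ∀ x y, inner ℝ ((x - a • G x) - (y - a • G y)) (x - y) ≤
      (1 - a * μ) * ‖x - y‖ ^ 2 := by
    intro x y
    rw [ex]
    have := mul_le_mul_of_nonneg_left (hm x y) ha
    linarith
  have hc := gradient_cocoercive hψ h0 h1 x y
  rcases eq_or_ne x y with rfl | hxy
  · simp
  have hl : 0 ≤ 1 - a * μ := by
    have h2 := (h0 x y).trans (h1 x y)
    have : 0 < ‖x - y‖ ^ 2 := by have := norm_pos_iff.2 (sub_ne_zero.2 hxy); positivity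
    exact nonneg_of_mul_nonneg_left h2 this
  calc _ ≤ _ := hc
    _ ≤ (1 - a * μ) * ((1 - a * μ) * ‖x - y‖ ^ 2) := mul_le_mul_of_nonneg_left (h1 x y) hl
    _ = _ := by ring

end Convex

/-! ### Positive matrices -/

/-- A positive matrix has a positive eigenvector for a positive eigenvalue (Perron). -/
theorem exists_perron_vector {m : Type*} [Fintype m] [Nonempty m] [DecidableEq m]
    (B : Matrix m m ℝ) (hB : ∀ i j, 0 < B i j) :
    ∃ (r : ℝ) (w : m → ℝ), 0 < r ∧ (∀ i, 0 < w i) ∧ B *ᵥ w = r • w := by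
  have hpos : ∀ z : m → ℝ, (∀ i, 0 ≤ z i) → z ≠ 0 → ∀ i, 0 < (B *ᵥ z) i := by
    intro z hz hz0 i
    obtain ⟨j, hj⟩ := Function.ne_iff.1 hz0
    exact Finset.sum_pos' (fun j _ => mul_nonneg (hB i j).le (hz j))
      ⟨j, Finset.mem_univ _, mul_pos (hB i j) (lt_of_le_of_ne (hz j) (Ne.symm hj))⟩
  -- Collatz–Wielandt: maximise `r` over pairs with `w` in the simplex and `r w ≤ B w`. The sum of
  -- all entries bounds `r`, so the set is compact.
  let M : ℝ := ∑ i, ∑ j, B i j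
  let K : Set (ℝ × (m → ℝ)) :=
    (Set.Icc 0 M ×ˢ stdSimplex ℝ m) ∩ {q | ∀ i, q.1 * q.2 i ≤ (B *ᵥ q.2) i}
  have hK : IsCompact K := by
    refine (isCompact_Icc.prod (isCompact_stdSimplex ℝ m)).inter_right ?_
    simp only [Set.ofPred_forall]
    refine isClosed_iInter fun i => isClosed_le (by fun_prop) ?_
    simp only [mulVec, dotProduct]
    fun_prop
  have simplex_ne : ∀ w ∈ stdSimplex ℝ m, w ≠ 0 := by
    rintro w hw rfl
    simpa using hw.2
  have bound : ∀ (r : ℝ) (w : m → ℝ), w ∈ stdSimplex ℝ m → (∀ i, r * w i ≤ (B *ᵥ w) i) →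
      r ≤ M := by
    intro r w hw h
    calc r = ∑ i, r * w i := by rw [← Finset.mul_sum, hw.2, mul_one]
      _ ≤ ∑ i, ∑ j, B i j * w j := Finset.sum_le_sum fun i _ => h i
      _ ≤ M := Finset.sum_le_sum fun i _ => Finset.sum_le_sum fun j _ => by
        have : w j ≤ 1 := hw.2 ▸ Finset.single_le_sum (fun i _ => hw.1 i) (Finset.mem_univ j)
        nlinarith [hB i j]
  have hne : K.Nonempty := by
    obtain ⟨i⟩ := ‹Nonempty m›
    refine ⟨(0, Pi.single i 1), ⟨⟨le_rfl, ?_⟩, single_mem_stdSimplex ℝ i⟩, fun j => ?_⟩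
    · exact Finset.sum_nonneg fun i _ => Finset.sum_nonneg fun j _ => (hB i j).le
    · simpa using (hB j i).le
  obtain ⟨⟨r, w⟩, ⟨⟨hr, hw⟩, hrw⟩, hmax⟩ := hK.exists_isMaxOn hne continuous_fst.continuousOn
  simp only at hr hw hrw
  have w0 := simplex_ne w hw
  have hBw := hpos w hw.1 w0
  -- If the gap `B w - r w ≥ 0` were nonzero, `B` would make it strictly positive, so `B w` in place
  -- of `w` would leave room to enlarge `r`.
  have heq : B *ᵥ w = r • w := by
    by_contra hcon
    let z : m → ℝ := B *ᵥ w - r • w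
    have hz : ∀ i, 0 ≤ z i := fun i => by simpa [z] using hrw i
    have hz1 := hpos z hz (sub_ne_zero.2 hcon)
    let w' : m → ℝ := B *ᵥ w
    have hstrict : ∀ i, r * w' i < (B *ᵥ w') i := by
      intro i
      have := hz1 i
      simp only [z, mulVec_sub, mulVec_smul, Pi.sub_apply, Pi.smul_apply, smul_eq_mul] at this
      simpa [w'] using this
    obtain ⟨ε, hε, hε'⟩ : ∃ ε > 0, ∀ i, (r + ε) * w' i ≤ (B *ᵥ w') i := by
      obtain ⟨i₀, -, hi₀⟩ := Finset.exists_min_image Finset.univ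
        (fun i => ((B *ᵥ w') i - r * w' i) / w' i) Finset.univ_nonempty
      refine ⟨((B *ᵥ w') i₀ - r * w' i₀) / w' i₀,
        div_pos (sub_pos.2 (hstrict i₀)) (hBw i₀), fun i => ?_⟩
      have := hi₀ i (Finset.mem_univ _)
      rw [le_div_iff₀ (hBw i)] at this
      linarith
    let σ : ℝ := ∑ i, w' i
    have hσ : 0 < σ := Finset.sum_pos (fun i _ => hBw i) Finset.univ_nonempty
    have hmem : σ⁻¹ • w' ∈ stdSimplex ℝ m := by
      refine ⟨fun i => mul_nonneg (inv_nonneg.2 hσ.le) (hBw i).le, ?_⟩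
      simp only [Pi.smul_apply, smul_eq_mul, ← Finset.mul_sum]
      exact inv_mul_cancel₀ hσ.ne'
    have hle : ∀ i, (r + ε) * (σ⁻¹ • w') i ≤ (B *ᵥ (σ⁻¹ • w')) i := by
      intro i
      have := mul_le_mul_of_nonneg_left (hε' i) (inv_nonneg.2 hσ.le)
      simp only [mulVec_smul, Pi.smul_apply, smul_eq_mul]
      linarith
    have := hmax (a := (r + ε, σ⁻¹ • w'))
      ⟨⟨⟨by linarith [hr.1], bound _ _ hmem hle⟩, hmem⟩, hle⟩
    simp only [Set.mem_ofPred_eq] at this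
    linarith
  have hr0 : 0 < r := by
    obtain ⟨i⟩ := ‹Nonempty m›
    have h1 := hBw i
    rw [heq, Pi.smul_apply, smul_eq_mul] at h1
    exact pos_of_mul_pos_left h1 (hw.1 i)
  refine ⟨r, w, hr0, fun i => ?_, heq⟩
  have h1 := hBw i
  rw [heq, Pi.smul_apply, smul_eq_mul] at h1
  exact pos_of_mul_pos_right h1 hr0.le

theorem cplx_mulVec {n : Type*} [Fintype n] (A : Matrix n n ℝ) (z : n → ℝ) :
    cplx A *ᵥ (fun i => (z i : ℂ)) = fun i => ((A *ᵥ z) i : ℂ) := by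
  ext i
  simp [cplx, mulVec, dotProduct]

/-- The spectral radius of a nonnegative matrix with a positive eigenvector. -/
theorem rho_eq_of_pos_eigenvector {m : Type*} [Fintype m] [Nonempty m] [DecidableEq m]
    {B : Matrix m m ℝ} (hB : ∀ i j, 0 ≤ B i j) {r : ℝ} (hr : 0 ≤ r) {w : m → ℝ}
    (hw : ∀ i, 0 < w i) (h : B *ᵥ w = r • w) : rho B = ENNReal.ofReal r := by
  have spec : ∀ k : ℂ, k ∈ spectrum ℂ (cplx B) ↔ ∃ z ≠ 0, cplx B *ᵥ z = k • z := by
    intro k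
    rw [← AlgEquiv.spectrum_eq (Matrix.toLinAlgEquiv' (R := ℂ) (n := m)) (cplx B),
      ← Module.End.hasEigenvalue_iff_mem_spectrum]
    constructor
    · intro hk
      obtain ⟨z, hz⟩ := hk.exists_hasEigenvector
      refine ⟨z, hz.2, ?_⟩
      simpa using hz.apply_eq_smul
    · rintro ⟨z, hz, hz'⟩
      exact Module.End.hasEigenvalue_of_hasEigenvector (x := z)
        (Module.End.hasEigenvector_iff.2 ⟨Module.End.mem_eigenspace_iff.2 (by simpa using hz'), hz⟩)
  refine le_antisymm ?_ ?_
  · refine iSup₂_le fun k hk => ?_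
    obtain ⟨z, hz, hk⟩ := (spec k).1 hk
    -- Where `|z i| / w i` is largest, the row of `B z = k z` is dominated by a multiple of the same
    -- row of `B w = r w`.
    obtain ⟨i₀, -, hi₀⟩ := Finset.exists_max_image Finset.univ
      (fun i => ‖z i‖ / w i) Finset.univ_nonempty
    set c := ‖z i₀‖ / w i₀ with hc
    have hzc : ∀ i, ‖z i‖ ≤ c * w i := fun i => by
      have := hi₀ i (Finset.mem_univ _)
      rwa [div_le_iff₀ (hw i)] at this
    have hcpos : 0 < c := by
      obtain ⟨j, hj⟩ := Function.ne_iff.1 hz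
      have h1 := hzc j
      have h2 : 0 < ‖z j‖ := norm_pos_iff.2 hj
      exact pos_of_mul_pos_left (h2.trans_le h1) (hw j).le
    have hcw : c * w i₀ = ‖z i₀‖ := div_mul_cancel₀ _ (hw i₀).ne'
    have h3 : ‖k‖ * (c * w i₀) ≤ r * (c * w i₀) := by
      calc ‖k‖ * (c * w i₀) = ‖(cplx B *ᵥ z) i₀‖ := by rw [hk, hcw]; simp
        _ ≤ ∑ j, ‖cplx B i₀ j * z j‖ := norm_sum_le _ _
        _ ≤ ∑ j, c * (B i₀ j * w j) := by
          refine Finset.sum_le_sum fun j _ => ?_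
          rw [norm_mul]
          simp only [cplx, map_apply, Complex.norm_real, Real.norm_eq_abs,
            abs_of_nonneg (hB i₀ j)]
          nlinarith [hzc j, hB i₀ j]
        _ = c * (B *ᵥ w) i₀ := by rw [← Finset.mul_sum]; rfl
        _ = _ := by rw [h]; simp; ring
    have h4 := le_of_mul_le_mul_right h3 (mul_pos hcpos (hw i₀))
    rw [← ENNReal.ofReal_coe_nnreal]
    exact ENNReal.ofReal_le_ofReal h4
  · have hmem : (r : ℂ) ∈ spectrum ℂ (cplx B) := by
      refine (spec _).2 ⟨fun i => (w i : ℂ), ?_, ?_⟩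
      · obtain ⟨i⟩ := ‹Nonempty m›
        exact fun h0 => (hw i).ne' (by simpa using congrFun h0 i)
      · rw [cplx_mulVec, h]
        ext i
        simp
    have : ENNReal.ofReal r = (‖(r : ℂ)‖₊ : ENNReal) := by
      rw [← ENNReal.ofReal_coe_nnreal]
      simp [abs_of_nonneg hr]
    rw [this]
    exact le_iSup₂ (f := fun (k : ℂ) (_ : k ∈ spectrum ℂ (cplx B)) => (‖k‖₊ : ENNReal)) _ hmem

/-- A positive eigenvalue of a positive `3 × 3` matrix `B` with `det (I - B) > 0` and diagonal
entries below `1` is below `1`. -/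
theorem eigenvalue_lt_one_of_det_pos {B : Matrix (Fin 3) (Fin 3) ℝ} (hB : ∀ i j, 0 < B i j)
    (h0 : B 0 0 < 1) (h1 : B 1 1 < 1) (h2 : B 2 2 < 1)
    (hdet : 0 < (1 - B 0 0) * (1 - B 1 1) * (1 - B 2 2) - B 0 1 * B 1 2 * B 2 0
      - B 0 2 * B 1 0 * B 2 1 - B 0 2 * B 2 0 * (1 - B 1 1) - B 0 1 * B 1 0 * (1 - B 2 2)
      - B 1 2 * B 2 1 * (1 - B 0 0))
    {r : ℝ} {w : Fin 3 → ℝ} (hw : ∀ i, 0 < w i) (h : B *ᵥ w = r • w) : r < 1 := by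
  by_contra! hr
  have e : ∀ i, B i 0 * w 0 + B i 1 * w 1 + B i 2 * w 2 = r * w i := by
    intro i
    have := congrFun h i
    simpa [mulVec, dotProduct, Fin.sum_univ_three] using this
  have e0 := e 0
  have e1 := e 1
  have e2 := e 2
  have w0 := hw 0
  have w1 := hw 1
  have w2 := hw 2
  have hB' := hB
  generalize w 0 = a at *
  generalize w 1 = b at *
  generalize w 2 = c at *
  have p01 := hB 0 1
  have p02 := hB 0 2
  have p10 := hB 1 0
  have p12 := hB 1 2
  have p20 := hB 2 0
  have p21 := hB 2 1
  generalize B 0 0 = b00 at *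
  generalize B 0 1 = b01 at *
  generalize B 0 2 = b02 at *
  generalize B 1 0 = b10 at *
  generalize B 1 1 = b11 at *
  generalize B 1 2 = b12 at *
  generalize B 2 0 = b20 at *
  generalize B 2 1 = b21 at *
  generalize B 2 2 = b22 at *
  have A0 := sub_pos.2 h0
  have A1 := sub_pos.2 h1
  have A2 := sub_pos.2 h2
  -- The minor times `1 - b00` is the determinant plus positive terms.
  have hminor : 0 < (1 - b11) * (1 - b22) - b12 * b21 := by
    have : 0 < ((1 - b11) * (1 - b22) - b12 * b21) * (1 - b00) := by
      have t1 : 0 < b01 * b12 * b20 := by positivity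
      have t2 : 0 < b02 * b10 * b21 := by positivity
      have t3 : 0 < b02 * b20 * (1 - b11) := by positivity
      have t4 : 0 < b01 * b10 * (1 - b22) := by positivity
      nlinarith
    exact pos_of_mul_pos_left this A0.le
  have c1 : 0 < b01 * (1 - b22) + b02 * b21 := by positivity
  have c2 : 0 < b02 * (1 - b11) + b01 * b12 := by positivity
  -- The first row of the adjugate of `I - B` applied to `(I - B) w = (1 - r) w`. Its entries are
  -- positive, so `r ≥ 1` contradicts a positive determinant.
  have hd : ((1 - b00) * (1 - b11) * (1 - b22) - b01 * b12 * b20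
      - b02 * b10 * b21 - b02 * b20 * (1 - b11) - b01 * b10 * (1 - b22)
      - b12 * b21 * (1 - b00)) * a
      = -((r - 1) * (((1 - b11) * (1 - b22) - b12 * b21) * a
        + (b01 * (1 - b22) + b02 * b21) * b + (b02 * (1 - b11) + b01 * b12) * c)) := by
    linear_combination (-((1 - b11) * (1 - b22) - b12 * b21)) * e0
      - (b01 * (1 - b22) + b02 * b21) * e1 - (b02 * (1 - b11) + b01 * b12) * e2
  have hp := mul_pos hdet w0
  rw [hd] at hp
  have : 0 ≤ (r - 1) * (((1 - b11) * (1 - b22) - b12 * b21) * a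
        + (b01 * (1 - b22) + b02 * b21) * b + (b02 * (1 - b11) + b01 * b12) * c) :=
    mul_nonneg (by linarith) (by positivity)
  linarith

/-- A nonnegative sequence of vectors dominated by the powers of a matrix with a positive
eigenvector decays at the rate of the eigenvalue. -/
theorem convergesAtRate_of_le_mulVec {m : Type*} [Fintype m] [Nonempty m]
    {B : Matrix m m ℝ} (hB : ∀ i j, 0 ≤ B i j) {r : ℝ} (hr : 0 ≤ r) (hr1 : r < 1) {w : m → ℝ}
    (hw : ∀ i, 0 < w i) (h : B *ᵥ w = r • w) {z : ℕ → m → ℝ} (hz : ∀ k i, 0 ≤ z k i)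
    (hstep : ∀ k i, z (k + 1) i ≤ (B *ᵥ z k) i) (i : m) :
    ConvergesAtRate (fun k => z k i) r := by
  obtain ⟨i₀, -, hi₀⟩ := Finset.exists_max_image Finset.univ
    (fun i => z 0 i / w i) Finset.univ_nonempty
  set c := z 0 i₀ / w i₀ with hc
  have hbound : ∀ k i, z k i ≤ c * r ^ k * w i := by
    intro k
    induction k with
    | zero =>
      intro i
      have := hi₀ i (Finset.mem_univ _)
      rw [div_le_iff₀ (hw i)] at this
      simpa using this
    | succ k ih =>
      intro i
      calc z (k + 1) i ≤ (B *ᵥ z k) i := hstep k i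
        _ ≤ (B *ᵥ ((c * r ^ k) • w)) i :=
          Finset.sum_le_sum fun j _ => mul_le_mul_of_nonneg_left (ih j) (hB i j)
        _ = _ := by
          rw [mulVec_smul, h]
          simp only [Pi.smul_apply, smul_eq_mul]
          ring
  have hO : (fun k => z k i) =O[atTop] fun k => r ^ k := by
    refine Asymptotics.IsBigO.of_bound (c * w i) (Eventually.of_forall fun k => ?_)
    rw [Real.norm_of_nonneg (hz k i), Real.norm_of_nonneg (pow_nonneg hr k)]
    linarith [hbound k i]
  exact ⟨hO.trans_tendsto (tendsto_pow_atTop_nhds_zero_of_lt_one hr hr1), hO⟩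

/-! ### Averaging over one draw -/

instance instDiscreteMeasurableSpaceDraw (n : ℕ) : DiscreteMeasurableSpace (Draw n) :=
  ⟨fun _ => trivial⟩

section Integral

variable {n : ℕ} {Ω : Type*} [MeasurableSpace Ω] {P : Measure Ω} [IsProbabilityMeasure P]
  {ξ : ℕ → Ω → Draw n}

/-- The function factors through the finite set of values of the first `k` draws. The sample `ω₀`
only fills in later draws, on which `ψ` does not depend. -/
theorem integrable_of_past (hξm : ∀ k, Measurable (ξ k)) {k : ℕ} {ψ : (ℕ → Draw n) → ℝ}
    (hψ : ∀ s s' : ℕ → Draw n, (∀ m < k, s m = s' m) → ψ s = ψ s') :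
    Integrable (fun ω => ψ fun m => ξ m ω) P := by
  obtain ⟨ω₀⟩ := nonempty_of_isProbabilityMeasure P
  let Y : Ω → (Finset.range k → Draw n) := fun ω i => ξ i ω
  have hY : Measurable Y := measurable_pi_lambda _ fun i => hξm i
  let g : (Finset.range k → Draw n) → ℝ := fun t =>
    ψ fun m => if h : m ∈ Finset.range k then t ⟨m, h⟩ else ξ m ω₀
  have : (fun ω => ψ fun m => ξ m ω) = g ∘ Y := by
    ext ω
    refine hψ _ _ fun m hm => ?_
    rw [dif_pos (Finset.mem_range.2 hm)]
  rw [this]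
  have hi : Integrable g (P.map Y) :=
    have := Measure.isProbabilityMeasure_map (μ := P) hY.aemeasurable
    Integrable.of_finite
  exact hi.comp_measurable hY

/-- The draw of time `k` is independent of the past, so that it can be averaged first. -/
theorem integral_draw (R C : Matrix (Fin n) (Fin n) ℝ) (hξm : ∀ k, Measurable (ξ k))
    (hξi : iIndepFun ξ P) (hξ : ∀ k d, P.real (ξ k ⁻¹' {d}) = drawProb R C d) {k : ℕ}
    {ψ : (ℕ → Draw n) → Draw n → ℝ}
    (hψ : ∀ (s s' : ℕ → Draw n) (d : Draw n), (∀ m < k, s m = s' m) → ψ s d = ψ s' d) :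
    ∫ ω, ψ (fun m => ξ m ω) (ξ k ω) ∂P
      = ∫ ω, ∑ d, drawProb R C d * ψ (fun m => ξ m ω) d ∂P := by
  classical
  obtain ⟨ω₀⟩ := nonempty_of_isProbabilityMeasure P
  let Y : Ω → (Finset.range k → Draw n) := fun ω i => ξ i ω
  have hY : Measurable Y := measurable_pi_lambda _ fun i => hξm i
  let g : Draw n → (Finset.range k → Draw n) → ℝ := fun d t =>
    ψ (fun m => if h : m ∈ Finset.range k then t ⟨m, h⟩ else ξ m ω₀) d
  have hg : ∀ ω d, ψ (fun m => ξ m ω) d = g d (Y ω) := by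
    intro ω d
    refine hψ _ _ d fun m hm => ?_
    rw [dif_pos (Finset.mem_range.2 hm)]
  have hint : ∀ d, Integrable (fun ω => ψ (fun m => ξ m ω) d) P := fun d =>
    integrable_of_past hξm fun s s' h => hψ s s' d h
  have hind : IndepFun (ξ k) Y P := by
    have h := hξi.indepFun_finset {k} (Finset.range k) (by simp) hξm
    have hφ : Measurable fun t : ({k} : Finset ℕ) → Draw n =>
        t ⟨k, Finset.mem_singleton_self k⟩ := measurable_pi_apply _
    exact h.comp hφ measurable_id
  -- After splitting by the value of the draw at time `k`, each indicator is independent of the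
  -- factor made of earlier draws.
  have hterm : ∀ d, ∫ ω, ({d} : Set (Draw n)).indicator (fun _ => (1 : ℝ)) (ξ k ω)
      * ψ (fun m => ξ m ω) d ∂P = drawProb R C d * ∫ ω, ψ (fun m => ξ m ω) d ∂P := by
    intro d
    have h := (hind.comp (φ := ({d} : Set (Draw n)).indicator fun _ => (1 : ℝ)) (ψ := g d)
      (measurable_of_finite _) (measurable_of_finite _)).integral_mul_eq_mul_integral
      ((measurable_of_finite _).comp (hξm k)).aestronglyMeasurable
      ((measurable_of_finite _).comp hY).aestronglyMeasurable
    have h1 : ∫ ω, (({d} : Set (Draw n)).indicator (fun _ => (1 : ℝ)) ∘ ξ k) ω ∂P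
        = drawProb R C d := by
      rw [← hξ k d, ← integral_indicator_one ((hξm k) (measurableSet_singleton d))]
      rfl
    rw [h1] at h
    simp_rw [hg]
    exact h
  have hsum : ∀ ω, ψ (fun m => ξ m ω) (ξ k ω)
      = ∑ d, ({d} : Set (Draw n)).indicator (fun _ => (1 : ℝ)) (ξ k ω)
        * ψ (fun m => ξ m ω) d := by
    intro ω
    rw [Finset.sum_eq_single (ξ k ω)]
    · simp
    · intro d _ hd
      simp [Ne.symm hd]
    · simp
  simp_rw [hsum]
  rw [integral_finsetSum, integral_finsetSum]
  · refine Finset.sum_congr rfl fun d _ => ?_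
    rw [hterm, integral_const_mul]
  · exact fun d _ => (hint d).const_mul _
  · intro d _
    have : (fun ω => ({d} : Set (Draw n)).indicator (fun _ => (1 : ℝ)) (ξ k ω)
        * ψ (fun m => ξ m ω) d) = (ξ k ⁻¹' {d}).indicator fun ω => ψ (fun m => ξ m ω) d := by
      ext ω
      by_cases h : ξ k ω = d <;> simp [Set.indicator, h]
    rw [this]
    exact (hint d).indicator (hξm k (measurableSet_singleton d))

end Integral

theorem iter_congr {n p : ℕ} {γ α : ℝ} {f : Fin n → EuclideanSpace ℝ (Fin p) → ℝ}
    {x₀ : Stack n p} {s s' : ℕ → Draw n} {k : ℕ} (h : ∀ m < k, s m = s' m) :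
    iter γ α f x₀ s k = iter γ α f x₀ s' k := by
  induction k with
  | zero => rfl
  | succ k ih =>
    simp only [iter, ih fun m hm => h m (hm.trans k.lt_succ_self), h k k.lt_succ_self]

/-! ### The law of a draw -/

section Law

variable {n : ℕ} (R C M : Matrix (Fin n) (Fin n) ℝ)

theorem pick_nonneg (i : Fin n) (o : Option (Fin n)) : 0 ≤ pick M i o := by
  cases o <;> simp only [pick] <;> split_ifs <;> positivity

theorem sum_pick (i : Fin n) : ∑ o, pick M i o = 1 := by
  classical
  rw [Fintype.sum_option]
  simp only [pick]
  by_cases h : outNbr M i = ∅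
  · simp [h]
  · rw [if_neg h, ← Finset.sum_filter]
    have : (outNbr M i).card ≠ 0 := by simpa using h
    simp only [Finset.filter_mem_eq_inter, Finset.univ_inter, Finset.sum_const, nsmul_eq_mul]
    field_simp
    simp

theorem ne_of_pick_ne_zero {i j : Fin n} (h : pick M i (some j) ≠ 0) : j ≠ i := by
  simp only [pick] at h
  split_ifs at h with h1
  · simp only [outNbr, Finset.mem_filter] at h1
    exact h1.2.1
  · exact absurd rfl h

theorem outNbr_eq_empty_of_pick_none {i : Fin n} (h : pick M i none ≠ 0) : outNbr M i = ∅ := by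
  simp only [pick] at h
  split_ifs at h with h1
  · exact h1
  · exact absurd rfl h

theorem outNbr_ne_empty_of_pick_some {i j : Fin n} (h : pick M i (some j) ≠ 0) :
    outNbr M i ≠ ∅ := by
  simp only [pick] at h
  split_ifs at h with h1
  · exact Finset.ne_empty_of_mem h1
  · exact absurd rfl h

theorem drawProb_nonneg (d : Draw n) : 0 ≤ drawProb R C d :=
  mul_nonneg (mul_nonneg (by positivity) (pick_nonneg R _ _)) (pick_nonneg C _ _)

theorem sum_drawProb_fst (φ : Fin n → ℝ) :
    ∑ d, drawProb R C d * φ d.1 = 1 / n * ∑ i, φ i := by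
  simp only [drawProb, Fintype.sum_prod_type, Finset.mul_sum]
  refine Finset.sum_congr rfl fun i _ => ?_
  simp only [mul_right_comm _ _ (φ i), ← Finset.mul_sum, sum_pick, mul_one]

theorem sum_drawProb [NeZero n] : ∑ d, drawProb R C d = 1 := by
  have := sum_drawProb_fst R C fun _ => 1
  simpa [NeZero.ne n] using this

variable {R C}

theorem pick_left_ne_zero {d : Draw n} (h : drawProb R C d ≠ 0) : pick R d.1 d.2.1 ≠ 0 :=
  fun h0 => h (by simp [drawProb, h0])

theorem pick_right_ne_zero {d : Draw n} (h : drawProb R C d ≠ 0) : pick C d.1 d.2.2 ≠ 0 :=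
  fun h0 => h (by simp [drawProb, h0])

/-- The type `Draw n` contains impossible outcomes such as `j = i`; facts about neighbours hold only
where the probability is nonzero. -/
theorem sum_drawProb_congr {φ ψ : Draw n → ℝ} (h : ∀ d, drawProb R C d ≠ 0 → φ d = ψ d) :
    ∑ d, drawProb R C d * φ d = ∑ d, drawProb R C d * ψ d := by
  refine Finset.sum_congr rfl fun d _ => ?_
  by_cases h0 : drawProb R C d = 0
  · simp [h0]
  · rw [h d h0]

theorem sum_drawProb_le {φ ψ : Draw n → ℝ} (h : ∀ d, drawProb R C d ≠ 0 → φ d ≤ ψ d) :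
    ∑ d, drawProb R C d * φ d ≤ ∑ d, drawProb R C d * ψ d := by
  refine Finset.sum_le_sum fun d _ => ?_
  by_cases h0 : drawProb R C d = 0
  · simp [h0]
  · exact mul_le_mul_of_nonneg_left (h d h0) (drawProb_nonneg R C d)

variable (R C)

theorem expect_const [NeZero n] {V : Type*} [AddCommMonoid V] [Module ℝ V] (w : V) :
    expect R C (fun _ => w) = w := by
  rw [expect, ← Finset.sum_smul, sum_drawProb, one_smul]

theorem expect_mulVec (W : Draw n → Matrix (Fin n) (Fin n) ℝ) (z : Fin n → ℝ) :
    expect R C W *ᵥ z = expect R C fun d => W d *ᵥ z := by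
  simp only [expect, sum_mulVec, smul_mulVec]

theorem expect_vecMul (W : Draw n → Matrix (Fin n) (Fin n) ℝ) (z : Fin n → ℝ) :
    z ᵥ* expect R C W = expect R C fun d => z ᵥ* W d := by
  simp only [expect, vecMul_sum, vecMul_smul]

theorem expect_one_add_smul [NeZero n] (γ : ℝ) (W : Draw n → Matrix (Fin n) (Fin n) ℝ) :
    expect R C (fun d => 1 + γ • W d) = 1 + γ • expect R C W := by
  have : expect R C (fun d => 1 + γ • W d)
      = expect R C (fun _ => (1 : Matrix (Fin n) (Fin n) ℝ)) + γ • expect R C W := by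
    simp only [expect, smul_add, Finset.sum_add_distrib, Finset.smul_sum]
    congr 1
    exact Finset.sum_congr rfl fun d _ => smul_comm _ _ _
  rw [this, expect_const]

theorem expect_drawR [NeZero n] (γ : ℝ) :
    expect R C (drawR γ) = 1 + γ • expect R C drawT := expect_one_add_smul R C γ drawT

theorem expect_drawC [NeZero n] (γ : ℝ) :
    expect R C (drawC γ) = 1 + γ • expect R C drawE := expect_one_add_smul R C γ drawE

theorem sum_drawProb_smul_centT [NeZero n] : ∑ d, drawProb R C d • centT R C d = 0 := by
  simp only [centT, smul_sub, Finset.sum_sub_distrib, ← Finset.sum_smul, sum_drawProb, one_smul]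
  exact sub_self _

theorem sum_drawProb_smul_centE [NeZero n] : ∑ d, drawProb R C d • centE R C d = 0 := by
  simp only [centE, smul_sub, Finset.sum_sub_distrib, ← Finset.sum_smul, sum_drawProb, one_smul]
  exact sub_self _

/-! ### The matrices of a draw -/

theorem unitVec_vecMulVec_mulVec (i j : Fin n) (z : Fin n → ℝ) :
    vecMulVec (unitVec i) (unitVec j) *ᵥ z = z j • unitVec i := by
  rw [vecMulVec_mulVec, unitVec, unitVec, single_one_dotProduct]
  simp

theorem drawT_some_mulVec (i j : Fin n) (o : Option (Fin n)) (z : Fin n → ℝ) :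
    drawT (i, some j, o) *ᵥ z = (z i - z j) • unitVec j := by
  simp only [drawT, sub_mulVec, unitVec_vecMulVec_mulVec, sub_smul]

theorem drawE_some_mulVec (i l : Fin n) (o : Option (Fin n)) (z : Fin n → ℝ) :
    drawE (i, o, some l) *ᵥ z = z i • (unitVec l - unitVec i) := by
  simp only [drawE, sub_mulVec, unitVec_vecMulVec_mulVec, smul_sub]

/-- Passing on `x` does not disturb consensus, so every bound on `T_k x` may use the consensus error
in place of `x`. -/
theorem drawT_mulVec_const (d : Draw n) (c : ℝ) : drawT d *ᵥ (fun _ => c) = 0 := by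
  obtain ⟨i, j, l⟩ := d
  cases j with
  | none => simp [drawT]
  | some j => simp [drawT_some_mulVec]

theorem sum_drawE_mulVec (d : Draw n) (z : Fin n → ℝ) : ∑ a, (drawE d *ᵥ z) a = 0 := by
  obtain ⟨i, j, l⟩ := d
  cases l with
  | none => simp [drawE]
  | some l => simp [drawE_some_mulVec, unitVec, ← Finset.mul_sum]

theorem expect_drawT_mulVec_const (c : ℝ) : expect R C drawT *ᵥ (fun _ => c) = 0 := by
  rw [expect_mulVec]
  simp [expect, drawT_mulVec_const]

variable {R C}

/-- A draw that wakes `i` sends `z` to `z i` times `e_l - e_i` with `l ≠ i`, a vector of squared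
length two. This is the source of the lower bound on `V_E`. -/
theorem sum_sq_drawE_mulVec (hout : ∀ i, outNbr C i ≠ ∅) (z : Fin n → ℝ) :
    ∑ d, drawProb R C d * ∑ a, ((drawE d *ᵥ z) a) ^ 2 = 2 / n * ∑ i, z i ^ 2 := by
  rw [sum_drawProb_congr (ψ := fun d => 2 * z d.1 ^ 2), sum_drawProb_fst R C fun i => 2 * z i ^ 2,
    ← Finset.mul_sum]
  · ring
  · rintro ⟨i, j, l⟩ h
    have h := pick_right_ne_zero h
    cases l with
    | none => exact absurd (outNbr_eq_empty_of_pick_none C h) (hout i)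
    | some l =>
      have hl : l ≠ i := ne_of_pick_ne_zero C h
      have key : ∀ a, (unitVec l a - unitVec i a) ^ 2 = unitVec l a + unitVec i a := by
        intro a
        simp only [unitVec, Pi.single_apply]
        split_ifs with h1 h2
        · exact absurd (h1.symm.trans h2) hl
        all_goals norm_num
      simp only [drawE_some_mulVec, Pi.smul_apply, Pi.sub_apply, smul_eq_mul, mul_pow,
        ← Finset.mul_sum, key, Finset.sum_add_distrib]
      simp [unitVec]
      ring

-- A draw with a receiver has trace `-1` because `l ≠ i`, a draw without one has trace `0`.
open scoped Classical in
theorem trace_expect_drawE :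
    trace (expect R C drawE) = -(1 / n * ∑ i, if outNbr C i = ∅ then (0 : ℝ) else 1) := by
  have h1 : trace (expect R C drawE) = ∑ d, drawProb R C d * trace (drawE d) := by
    simp [expect, trace_sum, trace_smul]
  rw [h1, sum_drawProb_congr (ψ := fun d => -(if outNbr C d.1 = ∅ then (0 : ℝ) else 1)),
    sum_drawProb_fst R C fun i => -(if outNbr C i = ∅ then (0 : ℝ) else 1)]
  · simp only [Finset.sum_neg_distrib, mul_neg]
  · rintro ⟨i, j, l⟩ h
    have h := pick_right_ne_zero h
    cases l with
    | none => simp [drawE, outNbr_eq_empty_of_pick_none C h]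
    | some l =>
      have hl : l ≠ i := ne_of_pick_ne_zero C h
      simp [drawE, trace_vecMulVec, unitVec, outNbr_ne_empty_of_pick_some C h, hl.symm]

theorem expect_drawE_mulVec_unitVec {s : Fin n} (hs : outNbr C s = ∅) :
    expect R C drawE *ᵥ unitVec s = 0 := by
  rw [expect_mulVec]
  refine Finset.sum_eq_zero fun d _ => ?_
  obtain ⟨i, j, l⟩ := d
  by_cases h : drawProb R C (i, j, l) = 0
  · rw [h, zero_smul]
  · have h := pick_right_ne_zero h
    cases l with
    | none => simp [drawE]
    | some l =>
      have : i ≠ s := by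
        rintro rfl
        exact outNbr_ne_empty_of_pick_some C h hs
      have hz : unitVec s i = 0 := by simp [unitVec, this]
      simp only [drawE_some_mulVec, hz, zero_smul, smul_zero]

/-- The diagonal of `Q_k`. -/
def drawQVec (d : Draw n) : Fin n → ℝ :=
  unitVec d.1 + d.2.1.elim 0 unitVec + d.2.2.elim 0 unitVec

theorem drawQ_mulVec (d : Draw n) (z : Fin n → ℝ) : drawQ d *ᵥ z = drawQVec d * z := by
  ext i
  simp [drawQ, drawQVec, mulVec_diagonal]

theorem option_elim_unitVec_nonneg (o : Option (Fin n)) (a : Fin n) :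
    0 ≤ (o.elim 0 unitVec : Fin n → ℝ) a := by
  cases o
  · simp
  · simp only [Option.elim, unitVec, Pi.single_apply]
    split_ifs <;> norm_num

theorem option_elim_unitVec_le_one (o : Option (Fin n)) (a : Fin n) :
    (o.elim 0 unitVec : Fin n → ℝ) a ≤ 1 := by
  cases o
  · simp
  · simp only [Option.elim, unitVec, Pi.single_apply]
    split_ifs <;> norm_num

theorem drawQVec_nonneg (d : Draw n) (a : Fin n) : 0 ≤ drawQVec d a :=
  add_nonneg (add_nonneg (option_elim_unitVec_nonneg (some d.1) a)
    (option_elim_unitVec_nonneg _ a)) (option_elim_unitVec_nonneg _ a)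

theorem one_le_drawQVec (d : Draw n) : 1 ≤ drawQVec d d.1 := by
  have h1 := option_elim_unitVec_nonneg d.2.1 d.1
  have h2 := option_elim_unitVec_nonneg d.2.2 d.1
  have h3 : unitVec d.1 d.1 = 1 := by simp [unitVec]
  simp only [drawQVec, Pi.add_apply]
  linarith

/-- The agents `i` and `j` are distinct, so only the third unit vector can overlap one of the first
two. -/
theorem drawQVec_le_two {d : Draw n} (h : drawProb R C d ≠ 0) (a : Fin n) :
    drawQVec d a ≤ 2 := by
  obtain ⟨i, j, l⟩ := d
  have h1 := option_elim_unitVec_le_one l a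
  have h2 : unitVec i a + (j.elim 0 unitVec : Fin n → ℝ) a ≤ 1 := by
    cases j with
    | none => simpa using option_elim_unitVec_le_one (some i) a
    | some j =>
      have hj : j ≠ i := ne_of_pick_ne_zero R (pick_left_ne_zero h)
      simp only [Option.elim, unitVec, Pi.single_apply]
      split_ifs with h3 h4
      · exact absurd (h4.symm.trans h3) hj
      all_goals norm_num
  simp only [drawQVec, Pi.add_apply]
  linarith

/-- A root of a spanning tree has an out-neighbour. -/
theorem outNbr_ne_empty_of_mem_roots (hn : 2 ≤ n) {M : Matrix (Fin n) (Fin n) ℝ} {r : Fin n}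
    (hr : r ∈ roots M) : outNbr M r ≠ ∅ := by
  obtain ⟨P, hP⟩ := hr
  have : Nontrivial (Fin n) := Fin.nontrivial_iff_two_le.2 hn
  obtain ⟨j, hj⟩ := exists_ne r
  rcases (hP.reach j).cases_head with h | ⟨a, ha, -⟩
  · exact absurd h.symm hj
  · have har : a ≠ r := by
      rintro rfl
      exact hP.root_no_parent _ ha
    refine Finset.ne_empty_of_mem (a := a) ?_
    simp [outNbr, har, hP.sub _ _ ha]

end Law

/-! ### The spectral norm -/

section Spectral

variable {𝕜 : Type*} [RCLike 𝕜] {n : ℕ}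

theorem spec2_nonneg (A : Matrix (Fin n) (Fin n) 𝕜) : 0 ≤ spec2 A := norm_nonneg _

theorem norm_toLp_mulVec_le (A : Matrix (Fin n) (Fin n) 𝕜) (z : Fin n → 𝕜) :
    ‖WithLp.toLp 2 (A *ᵥ z)‖ ≤ spec2 A * ‖WithLp.toLp 2 z‖ := by
  rw [← toEuclideanCLM_toLp]
  exact ContinuousLinearMap.le_opNorm _ _

theorem norm_diag_le_spec2 (A : Matrix (Fin n) (Fin n) 𝕜) (i : Fin n) : ‖A i i‖ ≤ spec2 A := by
  have h := norm_toLp_mulVec_le A (Pi.single i 1)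
  have h1 : ‖A i i‖ ≤ ‖WithLp.toLp 2 (A *ᵥ Pi.single i 1)‖ := by
    have := PiLp.norm_apply_le (WithLp.toLp 2 (A *ᵥ Pi.single i 1)) i
    simpa using this
  have h2 : ‖WithLp.toLp 2 (Pi.single i 1 : Fin n → 𝕜)‖ = 1 := by simp
  rw [h2, mul_one] at h
  exact h1.trans h

theorem norm_star_dotProduct_mulVec_le (A : Matrix (Fin n) (Fin n) 𝕜) (z : Fin n → 𝕜) :
    ‖star z ⬝ᵥ (A *ᵥ z)‖ ≤ spec2 A * ‖WithLp.toLp 2 z‖ ^ 2 := by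
  have h : star z ⬝ᵥ (A *ᵥ z) = inner 𝕜 (WithLp.toLp 2 z) (WithLp.toLp 2 (A *ᵥ z)) := by
    rw [EuclideanSpace.inner_eq_star_dotProduct, dotProduct_comm]
  rw [h]
  calc _ ≤ ‖WithLp.toLp 2 z‖ * ‖WithLp.toLp 2 (A *ᵥ z)‖ := norm_inner_le_norm _ _
    _ ≤ ‖WithLp.toLp 2 z‖ * (spec2 A * ‖WithLp.toLp 2 z‖) := by
      gcongr
      exact norm_toLp_mulVec_le A z
    _ = _ := by ring

theorem star_dotProduct_self_eq_norm_sq (z : Fin n → 𝕜) :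
    star z ⬝ᵥ z = ((‖WithLp.toLp 2 z‖ ^ 2 : ℝ) : 𝕜) := by
  have h : star z ⬝ᵥ z = inner 𝕜 (WithLp.toLp 2 z) (WithLp.toLp 2 z) := by
    rw [EuclideanSpace.inner_eq_star_dotProduct, dotProduct_comm]
  rw [h, inner_self_eq_norm_sq_to_K]
  push_cast
  rfl

theorem vec2_nonneg (z : Fin n → ℝ) : 0 ≤ vec2 z := norm_nonneg _

theorem vec2_sq (z : Fin n → ℝ) : vec2 z ^ 2 = ∑ i, z i ^ 2 := by
  rw [vec2, EuclideanSpace.norm_sq_eq]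
  simp

theorem vec2_pos {z : Fin n → ℝ} (hz : z ≠ 0) : 0 < vec2 z := by
  rw [vec2, norm_pos_iff]
  simpa using hz

theorem vec2_mulVec_le (A : Matrix (Fin n) (Fin n) ℝ) (z : Fin n → ℝ) :
    vec2 (A *ᵥ z) ≤ spec2 A * vec2 z := norm_toLp_mulVec_le A z

/-- The second moment of a random linear form `uᵀ M_k` bounds the mean square of its values. -/
theorem sum_sq_dotProduct_mulVec_le {ι : Type*} [Fintype ι] (q : ι → ℝ)
    (M : ι → Matrix (Fin n) (Fin n) ℝ) (u z : Fin n → ℝ) :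
    ∑ d, q d * (u ⬝ᵥ (M d *ᵥ z)) ^ 2 ≤
      spec2 (∑ d, q d • ((M d)ᵀ * vecMulVec u u * M d)) * vec2 z ^ 2 := by
  have h := norm_star_dotProduct_mulVec_le (∑ d, q d • ((M d)ᵀ * vecMulVec u u * M d)) z
  refine le_trans (le_of_eq_of_le ?_ (le_abs_self _)) h
  rw [sum_mulVec, dotProduct_sum]
  refine Finset.sum_congr rfl fun d _ => ?_
  have h1 : vecMulVec u u *ᵥ (M d *ᵥ z) = (u ⬝ᵥ (M d *ᵥ z)) • u := by
    rw [vecMulVec_mulVec]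
    ext i
    simp [mul_comm]
  have h2 : z ⬝ᵥ ((M d)ᵀ *ᵥ u) = u ⬝ᵥ (M d *ᵥ z) := by
    rw [dotProduct_mulVec, vecMul_transpose, dotProduct_comm]
  rw [smul_mulVec, dotProduct_smul, smul_eq_mul, ← mulVec_mulVec, ← mulVec_mulVec, h1,
    star_trivial, mulVec_smul, dotProduct_smul, h2, smul_eq_mul, sq]

end Spectral

/-! ### The norms of the decomposition -/

section Jordan

variable {n : ℕ}

/-- A real vector read as a complex one. -/
def cvec (z : Fin n → ℝ) : Fin n → ℂ := fun i => (z i : ℂ)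

theorem cvec_add (z z' : Fin n → ℝ) : cvec (z + z') = cvec z + cvec z' := by
  ext; simp [cvec]

theorem cvec_sub (z z' : Fin n → ℝ) : cvec (z - z') = cvec z - cvec z' := by
  ext; simp [cvec]

theorem cvec_smul (a : ℝ) (z : Fin n → ℝ) : cvec (a • z) = (a : ℂ) • cvec z := by
  ext; simp [cvec]

theorem cplx_mulVec_cvec (A : Matrix (Fin n) (Fin n) ℝ) (z : Fin n → ℝ) :
    cplx A *ᵥ cvec z = cvec (A *ᵥ z) := cplx_mulVec A z

theorem cvec_vecMul_cplx (A : Matrix (Fin n) (Fin n) ℝ) (z : Fin n → ℝ) :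
    cvec z ᵥ* cplx A = cvec (z ᵥ* A) := by
  ext i
  simp [cplx, vecMul, dotProduct, cvec]

theorem vecNorm_nonneg {τ : ℝ} (hτ : 0 ≤ τ) (S : Matrix (Fin n) (Fin n) ℂ) (z : Fin n → ℝ) :
    0 ≤ vecNorm τ S z := mul_nonneg hτ (norm_nonneg _)

theorem vecNorm_eq (τ : ℝ) (S : Matrix (Fin n) (Fin n) ℂ) (z : Fin n → ℝ) :
    vecNorm τ S z = τ * ‖WithLp.toLp 2 (S *ᵥ cvec z)‖ := rfl

/-- The second moment of a random matrix bounds its mean square in the weighted norm. -/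
theorem sum_sq_le_secondMoment (R C : Matrix (Fin n) (Fin n) ℝ) {S : Matrix (Fin n) (Fin n) ℂ}
    (hS : IsUnit S.det) (M : Draw n → Matrix (Fin n) (Fin n) ℝ) (z : Fin n → ℝ) :
    ∑ d, drawProb R C d * ‖WithLp.toLp 2 (S *ᵥ cvec (M d *ᵥ z))‖ ^ 2 ≤
      spec2 (secondMoment R C S M) * ‖WithLp.toLp 2 (S *ᵥ cvec z)‖ ^ 2 := by
  have h := norm_star_dotProduct_mulVec_le (secondMoment R C S M) (S *ᵥ cvec z)
  refine le_trans (le_of_eq_of_le ?_ (Complex.re_le_norm _)) h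
  rw [secondMoment, expect, sum_mulVec, dotProduct_sum, Complex.re_sum]
  refine Finset.sum_congr rfl fun d _ => ?_
  have e : ((S⁻¹)ᴴ * (cplx (M d))ᴴ * Sᴴ * S * cplx (M d) * S⁻¹) *ᵥ (S *ᵥ cvec z)
      = (S⁻¹)ᴴ *ᵥ ((cplx (M d))ᴴ *ᵥ (Sᴴ *ᵥ (S *ᵥ cvec (M d *ᵥ z)))) := by
    rw [← cplx_mulVec_cvec]
    simp only [mulVec_mulVec, ← mul_assoc]
    rw [mul_assoc _ S⁻¹ S, nonsing_inv_mul _ hS, mul_one]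
  have e2 : star (S *ᵥ cvec z) ⬝ᵥ
      ((S⁻¹)ᴴ *ᵥ ((cplx (M d))ᴴ *ᵥ (Sᴴ *ᵥ (S *ᵥ cvec (M d *ᵥ z)))))
      = star (S *ᵥ cvec (M d *ᵥ z)) ⬝ᵥ (S *ᵥ cvec (M d *ᵥ z)) := by
    rw [dotProduct_mulVec, ← star_mulVec, dotProduct_mulVec, ← star_mulVec, dotProduct_mulVec,
      ← star_mulVec, mulVec_mulVec _ S⁻¹ S, nonsing_inv_mul _ hS, one_mulVec, cplx_mulVec_cvec]
  rw [smul_mulVec, dotProduct_smul, e, e2, star_dotProduct_self_eq_norm_sq]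
  simp [-Complex.ofReal_pow]

theorem norm_mulVec_le_matNorm {D : Matrix (Fin n) (Fin n) ℂ} (hD : IsUnit D.det)
    (W : Matrix (Fin n) (Fin n) ℝ) (z : Fin n → ℝ) :
    ‖WithLp.toLp 2 (D *ᵥ cvec (W *ᵥ z))‖ ≤ matNorm D W * ‖WithLp.toLp 2 (D *ᵥ cvec z)‖ := by
  have h := norm_toLp_mulVec_le (D * cplx W * D⁻¹) (D *ᵥ cvec z)
  rwa [← cplx_mulVec_cvec, mulVec_mulVec, ← nonsing_inv_mul_cancel_right _ (D * cplx W) hD,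
    ← mulVec_mulVec]

theorem eq_zero_of_fixed {K : Matrix (Fin n) (Fin n) ℂ} (hK : spec2 K < 1) {ζ : Fin n → ℂ}
    (h : K *ᵥ ζ = ζ) : ζ = 0 := by
  have h1 := norm_toLp_mulVec_le K ζ
  rw [h] at h1
  have h2 : ‖WithLp.toLp 2 ζ‖ = 0 := by
    nlinarith [norm_nonneg (WithLp.toLp 2 ζ)]
  simpa using h2

theorem cvec_injective {z z' : Fin n → ℝ} (h : cvec z = cvec z') : z = z' := by
  ext i
  simpa [cvec] using congrFun h i

variable [NeZero n] {A : Matrix (Fin n) (Fin n) ℝ} {w : Fin n → ℝ}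
  {S J : Matrix (Fin n) (Fin n) ℂ}

namespace IsScaledJordan

theorem mul_eq (h : IsScaledJordan A w S J) : S * cplx A = J * S := by
  rw [h.eq, mul_assoc, ← mul_assoc S, mul_nonsing_inv _ h.isUnit_det, one_mul]

theorem mulVec_eq (h : IsScaledJordan A w S J) (z : Fin n → ℝ) :
    S *ᵥ cvec (A *ᵥ z) = J *ᵥ (S *ᵥ cvec z) := by
  rw [← cplx_mulVec_cvec, mulVec_mulVec, h.mul_eq, mulVec_mulVec]

theorem injective (h : IsScaledJordan A w S J) {a b : Fin n → ℂ} (hab : S *ᵥ a = S *ᵥ b) :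
    a = b := by
  have := congrArg (S⁻¹ *ᵥ ·) hab
  simpa [mulVec_mulVec, nonsing_inv_mul _ h.isUnit_det] using this

theorem mulVec_zero (h : IsScaledJordan A w S J) (z : Fin n → ℝ) :
    (S *ᵥ cvec z) 0 = ((w ⬝ᵥ z : ℝ) : ℂ) := by
  simp [mulVec, dotProduct, h.first_row, cvec]

/-- An upper bidiagonal matrix has only its top left entry in the first column, and that entry is
`0`. -/
theorem col_zero (h : IsScaledJordan A w S J) (i : Fin n) : J i 0 = 0 := by
  by_contra h0
  rcases h.bidiagonal i 0 h0 with h1 | ⟨h1, -⟩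
  · exact h0 (h1 ▸ h.top_left)
  · simp at h1

theorem mulVec_single (h : IsScaledJordan A w S J) (c : ℂ) : J *ᵥ (Pi.single 0 c) = 0 := by
  ext i
  simp [h.col_zero]

theorem shiftJ_mulVec (γ : ℝ) {ζ : Fin n → ℂ} (hζ : ζ 0 = 0) :
    shiftJ γ J *ᵥ ζ = ζ + (γ : ℂ) • (J *ᵥ ζ) := by
  have h1 : diagonal (Pi.single 0 1) *ᵥ ζ = 0 := by
    ext i
    rw [mulVec_diagonal]
    by_cases hi : i = 0 <;> simp [hi, hζ]
  have h2 : (γ • J) *ᵥ ζ = (γ : ℂ) • (J *ᵥ ζ) := by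
    rw [smul_mulVec]
    ext i
    simp
  rw [shiftJ, add_mulVec, sub_mulVec, h1, h2]
  simp

/-- On the kernel of `wᵀ` the matrix `I + γ A` acts as `I - diag(e_1) + γ J`. -/
theorem mulVec_add_smul (h : IsScaledJordan A w S J) (γ : ℝ) {z : Fin n → ℝ}
    (hz : w ⬝ᵥ z = 0) :
    S *ᵥ cvec (z + γ • (A *ᵥ z)) = shiftJ γ J *ᵥ (S *ᵥ cvec z) := by
  rw [shiftJ_mulVec _ (by rw [h.mulVec_zero, hz]; simp), cvec_add, cvec_smul, mulVec_add,
    mulVec_smul, h.mulVec_eq]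

theorem norm_mulVec_add_smul_le (h : IsScaledJordan A w S J) (γ : ℝ) {z : Fin n → ℝ}
    (hz : w ⬝ᵥ z = 0) :
    ‖WithLp.toLp 2 (S *ᵥ cvec (z + γ • (A *ᵥ z)))‖ ≤
      spec2 (shiftJ γ J) * ‖WithLp.toLp 2 (S *ᵥ cvec z)‖ := by
  rw [h.mulVec_add_smul γ hz]
  exact norm_toLp_mulVec_le _ _

/-- The kernel of `A` is one-dimensional. -/
theorem mulVec_eq_single (h : IsScaledJordan A w S J) {γ : ℝ} (hs : spec2 (shiftJ γ J) < 1)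
    {z : Fin n → ℝ} (hz : A *ᵥ z = 0) :
    S *ᵥ cvec z = Pi.single 0 ((w ⬝ᵥ z : ℝ) : ℂ) := by
  -- Without its top component the vector is killed by `J`, hence fixed by `shiftJ γ J`, which is a
  -- strict contraction.
  set ζ := S *ᵥ cvec z - Pi.single 0 ((w ⬝ᵥ z : ℝ) : ℂ) with hζ
  have h0 : ζ 0 = 0 := by simp [hζ, h.mulVec_zero]
  have hJ : J *ᵥ ζ = 0 := by
    rw [hζ, mulVec_sub, h.mulVec_single, ← h.mulVec_eq, hz]
    ext i
    simp [cvec, mulVec, dotProduct]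
  have := eq_zero_of_fixed hs (ζ := ζ) (by rw [shiftJ_mulVec _ h0, hJ, smul_zero, add_zero])
  exact sub_eq_zero.1 this

theorem eq_of_mulVec_eq_zero (h : IsScaledJordan A w S J) {γ : ℝ}
    (hs : spec2 (shiftJ γ J) < 1) {z z' : Fin n → ℝ} (hz : A *ᵥ z = 0) (hz' : A *ᵥ z' = 0)
    (hw : w ⬝ᵥ z = w ⬝ᵥ z') : z = z' := by
  refine cvec_injective (h.injective ?_)
  rw [h.mulVec_eq_single hs hz, h.mulVec_eq_single hs hz', hw]

/-- The left kernel of `A` is one-dimensional. -/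
theorem exists_smul_of_vecMul_eq_zero (h : IsScaledJordan A w S J) {γ : ℝ}
    (hs : spec2 (shiftJ γ J) < 1) (hw : w ᵥ* A = 0) {z : Fin n → ℝ} (hz : z ᵥ* A = 0) :
    ∃ c : ℂ, cvec z = c • cvec w := by
  have hrow : ∀ z : Fin n → ℝ, z ᵥ* A = 0 → (cvec z ᵥ* S⁻¹) ᵥ* J = 0 := by
    intro z hz
    have h1 : cvec z ᵥ* (S⁻¹ * J * S) = 0 := by
      rw [← h.eq, cvec_vecMul_cplx, hz]
      ext i
      simp [cvec]
    have h2 : (cvec z ᵥ* (S⁻¹ * J * S)) ᵥ* S⁻¹ = (cvec z ᵥ* S⁻¹) ᵥ* J := by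
      rw [vecMul_vecMul, mul_nonsing_inv_cancel_right _ _ h.isUnit_det, vecMul_vecMul]
    rw [← h2, h1, zero_vecMul]
  have hwS : cvec w ᵥ* S⁻¹ = Pi.single 0 1 := by
    have : cvec w = Pi.single 0 1 ᵥ* S := by
      ext j
      simp [cvec, h.first_row]
    rw [this, vecMul_vecMul, mul_nonsing_inv _ h.isUnit_det, vecMul_one]
  set r := cvec z ᵥ* S⁻¹ with hr
  have e0 := hrow w hw
  rw [hwS] at e0
  -- The same argument for rows: `ρ` has no top entry and is killed by `J`, hence by `I - shiftJ γ J
  -- = diag(e_1) - γ J`, which is invertible.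
  set ρ := r - r 0 • (Pi.single 0 1 : Fin n → ℂ) with hρ
  have hρ0 : ρ 0 = 0 := by simp [hρ]
  have hρJ : ρ ᵥ* J = 0 := by
    rw [hρ, sub_vecMul, smul_vecMul, e0, hrow z hz, smul_zero, sub_zero]
  have hdet : IsUnit (1 - shiftJ γ J).det := by
    rw [← isUnit_iff_isUnit_det, ← mulVec_injective_iff_isUnit]
    intro a b hab
    have : shiftJ γ J *ᵥ (a - b) = a - b := by
      have h3 : (1 - shiftJ γ J) *ᵥ (a - b) = 0 := by rw [mulVec_sub]; exact sub_eq_zero.2 hab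
      rw [sub_mulVec, one_mulVec, sub_eq_zero] at h3
      exact h3.symm
    exact sub_eq_zero.1 (eq_zero_of_fixed hs this)
  have hfix : ρ ᵥ* (1 - shiftJ γ J) = 0 := by
    have h4 : (1 - shiftJ γ J) = diagonal (Pi.single 0 1) - γ • J := by
      rw [shiftJ]; abel
    rw [h4, vecMul_sub, vecMul_smul, hρJ, smul_zero, sub_zero]
    ext i
    rw [vecMul_diagonal]
    by_cases hi : i = 0 <;> simp [hi, hρ0]
  have hρz : ρ = 0 := by
    have := congrArg (· ᵥ* (1 - shiftJ γ J)⁻¹) hfix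
    simpa [vecMul_vecMul, mul_nonsing_inv _ hdet] using this
  refine ⟨r 0, ?_⟩
  have h5 : r = r 0 • (cvec w ᵥ* S⁻¹) := by
    rw [hwS]
    exact sub_eq_zero.1 hρz
  have h6 := congrArg (· ᵥ* S) h5
  simpa [hr, smul_vecMul, vecMul_vecMul, nonsing_inv_mul _ h.isUnit_det] using h6

theorem trace_eq (h : IsScaledJordan A w S J) : ((trace A : ℝ) : ℂ) = ∑ i, J i i := by
  have h1 : ((trace A : ℝ) : ℂ) = trace (cplx A) := by simp [trace, cplx]
  rw [h1, h.eq, trace_mul_comm, ← mul_assoc, mul_nonsing_inv _ h.isUnit_det, one_mul]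
  rfl

/-- The trace bounds the contraction factor from below. -/
theorem le_spec2_shiftJ (h : IsScaledJordan A w S J) (γ : ℝ) :
    (n - 1 : ℝ) + γ * trace A ≤ (n - 1) * spec2 (shiftJ γ J) := by
  -- Diagonal entries are bounded by the spectral norm. As `J 0 0 = 0`, the other `n - 1` entries
  -- carry the whole trace, and summing gives the claim.
  have hd : ∀ i : Fin n, i ≠ 0 → 1 + γ * (J i i).re ≤ spec2 (shiftJ γ J) := by
    intro i hi
    have h1 := (Complex.re_le_norm _).trans (norm_diag_le_spec2 (shiftJ γ J) i)
    simpa [shiftJ, hi] using h1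
  have ht : trace A = ∑ i ∈ Finset.univ.erase (0 : Fin n), (J i i).re := by
    have h2 := congrArg Complex.re h.trace_eq
    rw [Complex.ofReal_re, Complex.re_sum, ← Finset.add_sum_erase _ _ (Finset.mem_univ 0)] at h2
    simpa [h.top_left] using h2
  have hc : ((Finset.univ.erase (0 : Fin n)).card : ℝ) = n - 1 := by
    rw [Finset.card_erase_of_mem (Finset.mem_univ _), Finset.card_univ, Fintype.card_fin,
      Nat.cast_sub (Nat.one_le_iff_ne_zero.2 (NeZero.ne n))]
    simp
  calc (n - 1 : ℝ) + γ * trace A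
      = ∑ i ∈ Finset.univ.erase (0 : Fin n), (1 + γ * (J i i).re) := by
        rw [Finset.sum_add_distrib, ← Finset.mul_sum, ← ht, ← hc]
        simp
    _ ≤ ∑ i ∈ Finset.univ.erase (0 : Fin n), spec2 (shiftJ γ J) :=
        Finset.sum_le_sum fun i hi => hd i (Finset.ne_of_mem_erase hi)
    _ = _ := by rw [Finset.sum_const, nsmul_eq_mul, hc]

end IsScaledJordan

end Jordan

/-! ### Weighted sums of squared norms -/

section Weighted

variable {ι H : Type*} [Fintype ι] [NormedAddCommGroup H]

theorem norm_add_sq_le_div {θ : ℝ} (h0 : 0 < θ) (h1 : θ < 1) (a b : H) :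
    ‖a + b‖ ^ 2 ≤ 1 / θ * ‖a‖ ^ 2 + 1 / (1 - θ) * ‖b‖ ^ 2 := by
  have h2 : 0 < 1 - θ := by linarith
  calc ‖a + b‖ ^ 2 ≤ (‖a‖ + ‖b‖) ^ 2 := by gcongr; exact norm_add_le a b
    _ ≤ _ := by
      have : 1 / θ * ‖a‖ ^ 2 + 1 / (1 - θ) * ‖b‖ ^ 2 - (‖a‖ + ‖b‖) ^ 2
          = ((1 - θ) * ‖a‖ - θ * ‖b‖) ^ 2 / (θ * (1 - θ)) := by
        field_simp
        ring
      have h3 : 0 ≤ ((1 - θ) * ‖a‖ - θ * ‖b‖) ^ 2 / (θ * (1 - θ)) := by positivity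
      linarith

theorem norm_add_sq_le_two (a b : H) : ‖a + b‖ ^ 2 ≤ 2 * ‖a‖ ^ 2 + 2 * ‖b‖ ^ 2 := by
  have := norm_add_sq_le_div (θ := 1 / 2) (by norm_num) (by norm_num) a b
  norm_num at this
  exact this

theorem norm_sub_sq_le_two (a b : H) : ‖a - b‖ ^ 2 ≤ 2 * ‖a‖ ^ 2 + 2 * ‖b‖ ^ 2 := by
  simpa [sub_eq_add_neg] using norm_add_sq_le_two a (-b)

theorem norm_add_add_sq_le_three (a b c : H) :
    ‖a + b + c‖ ^ 2 ≤ 3 * (‖a‖ ^ 2 + ‖b‖ ^ 2 + ‖c‖ ^ 2) := by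
  have h1 := norm_add_sq_le_div (θ := 2 / 3) (by norm_num) (by norm_num) (a + b) c
  have h2 := norm_add_sq_le_two a b
  norm_num at h1
  linarith

variable {q : ι → ℝ}

/-- Young's inequality with weight `θ = 2σ/(1+σ)`: a factor `σ` on the first part becomes `(1+σ)/2`,
still below one, at the price `(1+σ)/(1-σ)` on the second. -/
theorem sum_norm_add_sq_le (hq : ∀ d, 0 ≤ q d) {σ : ℝ} (h0 : 0 < σ) (h1 : σ < 1)
    (a b : ι → H) :
    ∑ d, q d * ‖a d + b d‖ ^ 2 ≤ (1 + σ) / (2 * σ) * ∑ d, q d * ‖a d‖ ^ 2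
      + (1 + σ) / (1 - σ) * ∑ d, q d * ‖b d‖ ^ 2 := by
  rw [Finset.mul_sum, Finset.mul_sum, ← Finset.sum_add_distrib]
  refine Finset.sum_le_sum fun d _ => ?_
  have h2 : 0 < 1 - σ := by linarith
  have h3 : 0 < 1 + σ := by linarith
  have e : 1 - 2 * σ / (1 + σ) = (1 - σ) / (1 + σ) := by field_simp; ring
  have := norm_add_sq_le_div (θ := 2 * σ / (1 + σ)) (by positivity)
    (by rw [div_lt_one h3]; linarith) (a d) (b d)
  rw [e, one_div_div, one_div_div] at this
  have := mul_le_mul_of_nonneg_left this (hq d)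
  linarith

theorem sum_norm_add_sq_le_of_le (hq : ∀ d, 0 ≤ q d) {σ Z : ℝ} (h0 : 0 ≤ σ) (h1 : σ < 1)
    {a : ι → H} (b : ι → H) (hZ : 0 ≤ Z) (ha : ∑ d, q d * ‖a d‖ ^ 2 ≤ σ * Z) :
    ∑ d, q d * ‖a d + b d‖ ^ 2 ≤ (1 + σ) / 2 * Z
      + (1 + σ) / (1 - σ) * ∑ d, q d * ‖b d‖ ^ 2 := by
  -- For `σ = 0` the weight degenerates, but then `a` vanishes wherever `q` is nonzero and the
  -- second part stands alone.
  rcases h0.eq_or_lt with rfl | hpos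
  · have hz : ∀ d ∈ Finset.univ, q d * ‖a d‖ ^ 2 = 0 := by
      refine (Finset.sum_eq_zero_iff_of_nonneg fun d _ =>
        mul_nonneg (hq d) (sq_nonneg _)).1 (le_antisymm (by simpa using ha) ?_)
      exact Finset.sum_nonneg fun d _ => mul_nonneg (hq d) (sq_nonneg _)
    have : ∀ d, q d * ‖a d + b d‖ ^ 2 = q d * ‖b d‖ ^ 2 := by
      intro d
      rcases mul_eq_zero.1 (hz d (Finset.mem_univ d)) with h | h
      · simp [h]
      · have : a d = 0 := by simpa using h
        simp [this]
    simp only [this]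
    norm_num
    linarith
  · refine (sum_norm_add_sq_le hq hpos h1 a b).trans ?_
    have : (1 + σ) / (2 * σ) * ∑ d, q d * ‖a d‖ ^ 2 ≤ (1 + σ) / (2 * σ) * (σ * Z) := by
      gcongr
    have e : (1 + σ) / (2 * σ) * (σ * Z) = (1 + σ) / 2 * Z := by field_simp
    linarith

variable [InnerProductSpace ℝ H]

/-- Bias and variance: the cross term has mean zero. -/
theorem sum_norm_add_sq_of_centred (hq1 : ∑ d, q d = 1) (a : H) {b : ι → H}
    (hb : ∑ d, q d • b d = 0) :
    ∑ d, q d * ‖a + b d‖ ^ 2 = ‖a‖ ^ 2 + ∑ d, q d * ‖b d‖ ^ 2 := by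
  have h1 : ∀ d, q d * ‖a + b d‖ ^ 2
      = q d * ‖a‖ ^ 2 + 2 * inner ℝ a (q d • b d) + q d * ‖b d‖ ^ 2 := by
    intro d
    rw [norm_add_sq_real, inner_smul_right]
    ring
  simp only [h1, Finset.sum_add_distrib, ← Finset.sum_mul, ← Finset.mul_sum, ← inner_sum, hq1, hb]
  simp

end Weighted

/-! ### The contraction of the consensus errors, column by column -/

section Column

variable {n : ℕ} {R C : Matrix (Fin n) (Fin n) ℝ} {u v : Fin n → ℝ}
  {S D J : Matrix (Fin n) (Fin n) ℂ} {γ τ : ℝ}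

theorem vecMul_expect_drawT_eq_zero [NeZero n] (hγ : γ ≠ 0) (hu : u ᵥ* expect R C (drawR γ) = u) :
    u ᵥ* expect R C drawT = 0 := by
  rw [expect_drawR, vecMul_add, vecMul_one, vecMul_smul] at hu
  exact (smul_eq_zero.1 (add_eq_left.1 hu)).resolve_left hγ

theorem expect_drawE_mulVec_eq_zero [NeZero n] (hγ : γ ≠ 0) (hv : expect R C (drawC γ) *ᵥ v = v) :
    expect R C drawE *ᵥ v = 0 := by
  rw [expect_drawC, add_mulVec, one_mulVec, smul_mulVec] at hv
  exact (smul_eq_zero.1 (add_eq_left.1 hv)).resolve_left hγ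

theorem projX_mulVec (u z : Fin n → ℝ) :
    projX u *ᵥ z = z - fun _ => 1 / (n : ℝ) * (u ⬝ᵥ z) := by
  rw [projX, sub_mulVec, one_mulVec, smul_mulVec, vecMulVec_mulVec]
  ext i
  simp

theorem projY_mulVec (v z : Fin n → ℝ) :
    projY v *ᵥ z = z - (1 / (n : ℝ) * ∑ i, z i) • v := by
  rw [projY, sub_mulVec, one_mulVec, smul_mulVec, vecMulVec_mulVec]
  ext i
  simp [dotProduct]
  ring

/-- The vector whose norm is `vecNorm τ S`. -/
def toSpace (τ : ℝ) (S : Matrix (Fin n) (Fin n) ℂ) :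
    (Fin n → ℝ) →ₗ[ℝ] EuclideanSpace ℂ (Fin n) where
  toFun z := τ • WithLp.toLp 2 (S *ᵥ cvec z)
  map_add' a b := by
    rw [cvec_add, mulVec_add, WithLp.toLp_add, smul_add]
  map_smul' c a := by
    rw [cvec_smul, mulVec_smul, smul_comm]
    ext i
    simp

theorem norm_toSpace (hτ : 0 ≤ τ) (z : Fin n → ℝ) : ‖toSpace τ S z‖ = vecNorm τ S z := by
  change ‖τ • WithLp.toLp 2 (S *ᵥ cvec z)‖ = _
  rw [norm_smul, Real.norm_of_nonneg hτ, vecNorm_eq]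

theorem sum_vecNorm_sq_le_secondMoment (hS : IsUnit S.det)
    (M : Draw n → Matrix (Fin n) (Fin n) ℝ) (z : Fin n → ℝ) :
    ∑ d, drawProb R C d * vecNorm τ S (M d *ᵥ z) ^ 2 ≤
      spec2 (secondMoment R C S M) * vecNorm τ S z ^ 2 := by
  have h := mul_le_mul_of_nonneg_left (sum_sq_le_secondMoment R C hS M z) (sq_nonneg τ)
  simp only [vecNorm_eq, mul_pow]
  calc _ = τ ^ 2 * ∑ d, drawProb R C d * ‖WithLp.toLp 2 (S *ᵥ cvec (M d *ᵥ z))‖ ^ 2 := by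
        rw [Finset.mul_sum]
        exact Finset.sum_congr rfl fun d _ => by ring
    _ ≤ _ := h
    _ = _ := by ring

theorem vecNorm_add_smul_sq_le [NeZero n] {A : Matrix (Fin n) (Fin n) ℝ} {w : Fin n → ℝ}
    (hA : IsScaledJordan A w S J) {z : Fin n → ℝ} (hz : w ⬝ᵥ z = 0) :
    vecNorm τ S (z + γ • (A *ᵥ z)) ^ 2 ≤ spec2 (shiftJ γ J) ^ 2 * vecNorm τ S z ^ 2 := by
  have h := hA.norm_mulVec_add_smul_le γ hz
  simp only [vecNorm_eq, mul_pow]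
  have := mul_le_mul_of_nonneg_left (pow_le_pow_left₀ (norm_nonneg _) h 2) (sq_nonneg τ)
  rw [mul_pow] at this
  linarith

/-- Since `T_k` kills constants, the error `z = Π a` becomes `(I + γ T̄) z`, plus the centred noise
`γ Π T̃_k z`, plus the step `-α Π Q_k b`. As `uᵀ z = 0`, the first two together give exactly `σ_R`,
and the third is split off by Young's inequality. -/
theorem consensus_contraction [NeZero n] (hτ : 0 ≤ τ)
    (hS : IsScaledJordan (expect R C drawT) u S J) (huT : u ᵥ* expect R C drawT = 0)
    (hu1 : ∑ i, u i = n) (hσ : sigmaR R C u S J γ < 1) (α : ℝ) (a b : Fin n → ℝ) :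
    ∑ d, drawProb R C d *
        vecNorm τ S (projX u *ᵥ (drawR γ d *ᵥ a - α • (drawQ d *ᵥ b))) ^ 2 ≤
      (1 + sigmaR R C u S J γ) / 2 * vecNorm τ S (projX u *ᵥ a) ^ 2
      + (1 + sigmaR R C u S J γ) / (1 - sigmaR R C u S J γ) * (α ^ 2 *
        (spec2 (VQ R C u S) * vecNorm τ S b ^ 2)) := by
  set σ := sigmaR R C u S J γ with hσdef
  have hn : (n : ℝ) ≠ 0 := Nat.cast_ne_zero.2 (NeZero.ne n)
  set z := projX u *ᵥ a with hz
  have huz : u ⬝ᵥ z = 0 := by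
    rw [hz, projX_mulVec, dotProduct_sub]
    have : u ⬝ᵥ (fun _ => 1 / (n : ℝ) * (u ⬝ᵥ a)) = (∑ i, u i) * (1 / (n : ℝ) * (u ⬝ᵥ a)) := by
      rw [dotProduct, Finset.sum_mul]
    rw [this, hu1]
    field_simp
    ring
  have haz : ∀ d, drawT d *ᵥ a = drawT d *ᵥ z := by
    intro d
    rw [hz, projX_mulVec, mulVec_sub, drawT_mulVec_const, sub_zero]
  have hfix : ∀ w : Fin n → ℝ, u ⬝ᵥ w = 0 → projX u *ᵥ w = w := by
    intro w hw
    rw [projX_mulVec, hw]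
    ext i
    simp
  have hT0 : projX u *ᵥ (expect R C drawT *ᵥ z) = expect R C drawT *ᵥ z :=
    hfix _ (by rw [dotProduct_mulVec, huT, zero_dotProduct])
  have hsplit : ∀ d, projX u *ᵥ (drawR γ d *ᵥ a - α • (drawQ d *ᵥ b))
      = ((z + γ • (expect R C drawT *ᵥ z)) + γ • ((projX u * centT R C d) *ᵥ z))
        + (-α) • ((projX u * drawQ d) *ᵥ b) := by
    intro d
    have h1 : projX u *ᵥ (drawR γ d *ᵥ a) = z + γ • (projX u *ᵥ (drawT d *ᵥ z)) := by
      rw [drawR, add_mulVec, one_mulVec, smul_mulVec, haz, mulVec_add, mulVec_smul, ← hz]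
    have h2 : projX u *ᵥ (drawT d *ᵥ z)
        = expect R C drawT *ᵥ z + (projX u * centT R C d) *ᵥ z := by
      rw [← mulVec_mulVec, centT, sub_mulVec, mulVec_sub, hT0]
      abel
    rw [mulVec_sub, h1, h2, mulVec_smul, ← mulVec_mulVec b (projX u)]
    simp only [smul_add, neg_smul]
    abel
  have hcent : ∑ d, drawProb R C d •
      toSpace τ S (γ • ((projX u * centT R C d) *ᵥ z)) = 0 := by
    have : ∀ d, drawProb R C d • toSpace τ S (γ • ((projX u * centT R C d) *ᵥ z))
        = toSpace τ S (γ • (projX u *ᵥ ((drawProb R C d • centT R C d) *ᵥ z))) := by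
      intro d
      rw [← map_smul, smul_mulVec, mulVec_smul, ← mulVec_mulVec z (projX u), smul_comm]
    simp only [this]
    rw [← map_sum, ← Finset.smul_sum, ← mulVec_sum, ← sum_mulVec, sum_drawProb_smul_centT]
    simp
  have hmain : ∑ d, drawProb R C d * ‖toSpace τ S (z + γ • (expect R C drawT *ᵥ z))
      + toSpace τ S (γ • ((projX u * centT R C d) *ᵥ z))‖ ^ 2 ≤ σ * vecNorm τ S z ^ 2 := by
    rw [sum_norm_add_sq_of_centred (sum_drawProb R C) _ hcent]
    have h1 := vecNorm_add_smul_sq_le (τ := τ) (γ := γ) hS huz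
    have h2 := sum_vecNorm_sq_le_secondMoment (τ := τ) (R := R) (C := C) hS.isUnit_det
      (fun d => projX u * centT R C d) z
    have h3 : ∑ d, drawProb R C d * ‖toSpace τ S (γ • ((projX u * centT R C d) *ᵥ z))‖ ^ 2
        = γ ^ 2 * ∑ d, drawProb R C d * vecNorm τ S ((projX u * centT R C d) *ᵥ z) ^ 2 := by
      rw [Finset.mul_sum]
      refine Finset.sum_congr rfl fun d _ => ?_
      rw [map_smul, norm_smul, norm_toSpace hτ, mul_pow, Real.norm_eq_abs, sq_abs]
      ring
    have h4 := mul_le_mul_of_nonneg_left h2 (sq_nonneg γ)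
    rw [h3, norm_toSpace hτ, hσdef, sigmaR, VT]
    linarith
  have hσ0 : 0 ≤ σ :=
    add_nonneg (sq_nonneg _) (mul_nonneg (sq_nonneg _) (spec2_nonneg _))
  have hy := sum_norm_add_sq_le_of_le (drawProb_nonneg R C) hσ0 hσ
    (fun d => toSpace τ S ((-α) • ((projX u * drawQ d) *ᵥ b))) (sq_nonneg _) hmain
  have hL : ∀ d, vecNorm τ S (projX u *ᵥ (drawR γ d *ᵥ a - α • (drawQ d *ᵥ b)))
      = ‖toSpace τ S (z + γ • (expect R C drawT *ᵥ z))
        + toSpace τ S (γ • ((projX u * centT R C d) *ᵥ z))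
        + toSpace τ S ((-α) • ((projX u * drawQ d) *ᵥ b))‖ := by
    intro d
    rw [← map_add, ← map_add, norm_toSpace hτ, hsplit]
  simp only [hL]
  refine hy.trans (add_le_add le_rfl ?_)
  refine mul_le_mul_of_nonneg_left ?_ (div_nonneg (by linarith) (by linarith))
  have h5 := sum_vecNorm_sq_le_secondMoment (τ := τ) (R := R) (C := C) hS.isUnit_det
    (fun d => projX u * drawQ d) b
  refine le_of_eq_of_le ?_ (mul_le_mul_of_nonneg_left h5 (sq_nonneg α))
  rw [Finset.mul_sum]
  refine Finset.sum_congr rfl fun d _ => ?_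
  rw [map_smul, norm_smul, norm_toSpace hτ, mul_pow, Real.norm_eq_abs, sq_abs, neg_sq]
  ring

/-- The columns of `E_k` sum to zero, so the projection leaves `E_k b` alone, and the mean part acts
only on `w = (I - v 1ᵀ/n) b` because `v` is in the kernel of the mean. The noise, however, acts on
all of `b = w + β v`. -/
theorem tracking_contraction [NeZero n] (hτ : 0 ≤ τ)
    (hD : IsScaledJordan (expect R C drawE) (fun _ => 1) D J)
    (hEv : expect R C drawE *ᵥ v = 0) (hv1 : ∑ i, v i = n)
    (hσ0 : 0 < sigmaC R C D J γ) (hσ : sigmaC R C D J γ < 1) {δ : ℝ}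
    (hδ : ∀ z : Fin n → ℝ, vecNorm τ D z ≤ δ * vec2 z) (b : Fin n → ℝ)
    (g : Draw n → Fin n → ℝ) :
    ∑ d, drawProb R C d * vecNorm τ D (projY v *ᵥ (drawC γ d *ᵥ b + g d)) ^ 2 ≤
      (1 + sigmaC R C D J γ) / 2 * vecNorm τ D (projY v *ᵥ b) ^ 2
      + γ ^ 2 * ((1 + sigmaC R C D J γ) / sigmaC R C D J γ * spec2 (VE R C D)
        * vecNorm τ D v ^ 2) * (1 / n * ∑ i, b i) ^ 2
      + (1 + sigmaC R C D J γ) / (1 - sigmaC R C D J γ) * (matNorm D (projY v) ^ 2 * δ ^ 2 *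
        ∑ d, drawProb R C d * vec2 (g d) ^ 2) := by
  set σ := sigmaC R C D J γ with hσdef
  have hn : (n : ℝ) ≠ 0 := Nat.cast_ne_zero.2 (NeZero.ne n)
  set w := projY v *ᵥ b with hw
  set β := 1 / (n : ℝ) * ∑ i, b i with hβ
  have hb : b = w + β • v := by rw [hw, projY_mulVec]; abel
  have hw1 : ∑ i, w i = 0 := by
    rw [hw, projY_mulVec]
    simp only [Pi.sub_apply, Pi.smul_apply, smul_eq_mul, Finset.sum_sub_distrib,
      ← Finset.mul_sum, hv1]
    field_simp
    ring
  have hfix : ∀ z : Fin n → ℝ, ∑ i, z i = 0 → projY v *ᵥ z = z := by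
    intro z hz
    rw [projY_mulVec, hz]
    simp
  have hE0 : ∀ d z, projY v *ᵥ (drawE d *ᵥ z) = drawE d *ᵥ z := fun d z =>
    hfix _ (sum_drawE_mulVec d z)
  have hsplit : ∀ d, projY v *ᵥ (drawC γ d *ᵥ b + g d)
      = ((w + γ • (expect R C drawE *ᵥ w)) + γ • (centE R C d *ᵥ b)) + projY v *ᵥ g d := by
    intro d
    have hEb : expect R C drawE *ᵥ b = expect R C drawE *ᵥ w := by
      conv_lhs => rw [hb]
      rw [mulVec_add, mulVec_smul, hEv, smul_zero, add_zero]
    rw [mulVec_add, drawC, add_mulVec, one_mulVec, smul_mulVec, mulVec_add, mulVec_smul, hE0,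
      ← hw, centE, sub_mulVec, hEb, smul_sub]
    abel
  have hcent : ∑ d, drawProb R C d • toSpace τ D (γ • (centE R C d *ᵥ b)) = 0 := by
    have : ∀ d, drawProb R C d • toSpace τ D (γ • (centE R C d *ᵥ b))
        = toSpace τ D (γ • ((drawProb R C d • centE R C d) *ᵥ b)) := by
      intro d
      rw [← map_smul, smul_mulVec, smul_comm]
    simp only [this]
    rw [← map_sum, ← Finset.smul_sum, ← sum_mulVec, sum_drawProb_smul_centE]
    simp
  have hmain : ∑ d, drawProb R C d * ‖toSpace τ D (w + γ • (expect R C drawE *ᵥ w))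
      + toSpace τ D (γ • (centE R C d *ᵥ b))‖ ^ 2 ≤ σ * vecNorm τ D w ^ 2
        + 2 * γ ^ 2 * (spec2 (VE R C D) * (vecNorm τ D v ^ 2 * β ^ 2)) := by
    rw [sum_norm_add_sq_of_centred (sum_drawProb R C) _ hcent]
    have h1 := vecNorm_add_smul_sq_le (τ := τ) (γ := γ) hD (z := w)
      (by simpa [dotProduct] using hw1)
    have h2 := sum_vecNorm_sq_le_secondMoment (τ := τ) (R := R) (C := C) hD.isUnit_det
      (fun d => centE R C d) b
    have h3 : ∑ d, drawProb R C d * ‖toSpace τ D (γ • (centE R C d *ᵥ b))‖ ^ 2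
        = γ ^ 2 * ∑ d, drawProb R C d * vecNorm τ D (centE R C d *ᵥ b) ^ 2 := by
      rw [Finset.mul_sum]
      refine Finset.sum_congr rfl fun d _ => ?_
      rw [map_smul, norm_smul, norm_toSpace hτ, mul_pow, Real.norm_eq_abs, sq_abs]
      ring
    have h4 := mul_le_mul_of_nonneg_left h2 (sq_nonneg γ)
    -- The `w` part explains the factor `2` before `V_E` in `σ_C`; the `v` part becomes the `d₄`
    -- term.
    have h5 : vecNorm τ D b ^ 2 ≤ 2 * vecNorm τ D w ^ 2 + 2 * (vecNorm τ D v ^ 2 * β ^ 2) := by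
      have := norm_add_sq_le_two (toSpace τ D w) (toSpace τ D (β • v))
      rw [← map_add, ← hb, map_smul, norm_smul, norm_toSpace hτ, norm_toSpace hτ,
        norm_toSpace hτ, mul_pow, Real.norm_eq_abs, sq_abs] at this
      linarith
    have h6 := mul_le_mul_of_nonneg_left h5 (mul_nonneg (sq_nonneg γ) (spec2_nonneg (VE R C D)))
    rw [h3, norm_toSpace hτ, hσdef, sigmaC]
    change _ + γ ^ 2 * _ ≤ _
    have : spec2 (secondMoment R C D fun d => centE R C d) = spec2 (VE R C D) := rfl
    rw [this] at h4
    linarith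
  have hy := sum_norm_add_sq_le (drawProb_nonneg R C) hσ0 hσ
    (fun d => toSpace τ D (w + γ • (expect R C drawE *ᵥ w))
      + toSpace τ D (γ • (centE R C d *ᵥ b)))
    (fun d => toSpace τ D (projY v *ᵥ g d))
  have hL : ∀ d, vecNorm τ D (projY v *ᵥ (drawC γ d *ᵥ b + g d))
      = ‖toSpace τ D (w + γ • (expect R C drawE *ᵥ w))
        + toSpace τ D (γ • (centE R C d *ᵥ b)) + toSpace τ D (projY v *ᵥ g d)‖ := by
    intro d
    rw [← map_add, ← map_add, norm_toSpace hτ, hsplit]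
  simp only [hL]
  refine hy.trans (add_le_add ?_ ?_)
  · have h7 := mul_le_mul_of_nonneg_left hmain
      (show 0 ≤ (1 + σ) / (2 * σ) by positivity)
    refine h7.trans (le_of_eq ?_)
    field_simp
  · refine mul_le_mul_of_nonneg_left ?_ (div_nonneg (by linarith) (by linarith))
    rw [Finset.mul_sum]
    refine Finset.sum_le_sum fun d _ => ?_
    rw [norm_toSpace hτ]
    have h8 : vecNorm τ D (projY v *ᵥ g d) ≤ matNorm D (projY v) * (δ * vec2 (g d)) := by
      have h9 := norm_mulVec_le_matNorm hD.isUnit_det (projY v) (g d)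
      calc vecNorm τ D (projY v *ᵥ g d)
          = τ * ‖WithLp.toLp 2 (D *ᵥ cvec (projY v *ᵥ g d))‖ := rfl
        _ ≤ τ * (matNorm D (projY v) * ‖WithLp.toLp 2 (D *ᵥ cvec (g d))‖) := by gcongr
        _ = matNorm D (projY v) * vecNorm τ D (g d) := by rw [vecNorm_eq]; ring
        _ ≤ _ := mul_le_mul_of_nonneg_left (hδ _) (spec2_nonneg _)
    have := mul_le_mul_of_nonneg_left
      (pow_le_pow_left₀ (vecNorm_nonneg hτ D _) h8 2) (drawProb_nonneg R C d)
    refine this.trans (le_of_eq ?_)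
    ring

end Column

/-! ### Columns of stacked variables -/

section Stacks

variable {n p : ℕ} {R C : Matrix (Fin n) (Fin n) ℝ} {u v : Fin n → ℝ}

/-- A column of the `n × p` matrix `x`. -/
def coord (x : Stack n p) (c : Fin p) : Fin n → ℝ := fun i => x i c

/-- The squared Frobenius norm. -/
def frobSq (x : Stack n p) : ℝ := ∑ i, ‖x i‖ ^ 2

theorem frobSq_eq (x : Stack n p) : frobSq x = ∑ c, vec2 (coord x c) ^ 2 := by
  simp only [frobSq, vec2_sq, coord, EuclideanSpace.norm_sq_eq, Real.norm_eq_abs, sq_abs]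
  exact Finset.sum_comm

theorem coord_act (W : Matrix (Fin n) (Fin n) ℝ) (x : Stack n p) (c : Fin p) :
    coord (act W x) c = W *ᵥ coord x c := by
  ext i
  simp [coord, act, mulVec, dotProduct]

theorem coord_add (x y : Stack n p) (c : Fin p) :
    coord (x + y) c = coord x c + coord y c := rfl

theorem coord_sub (x y : Stack n p) (c : Fin p) :
    coord (x - y) c = coord x c - coord y c := rfl

theorem coord_smul (a : ℝ) (x : Stack n p) (c : Fin p) :
    coord (a • x) c = a • coord x c := rfl

theorem stack_ext {x y : Stack n p} (h : ∀ c, coord x c = coord y c) : x = y := by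
  funext i
  ext c
  exact congrFun (h c) i

theorem wavg_apply (w : Fin n → ℝ) (x : Stack n p) (c : Fin p) :
    wavg w x c = 1 / n * (w ⬝ᵥ coord x c) := by
  simp [wavg, coord, dotProduct]

theorem wavg_add (w : Fin n → ℝ) (x y : Stack n p) : wavg w (x + y) = wavg w x + wavg w y := by
  ext c
  simp only [PiLp.add_apply, wavg_apply, coord_add, dotProduct_add, mul_add]

theorem wavg_sub (w : Fin n → ℝ) (x y : Stack n p) : wavg w (x - y) = wavg w x - wavg w y := by
  ext c
  simp only [PiLp.sub_apply, wavg_apply, coord_sub, dotProduct_sub, mul_sub]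

theorem wavg_smul (w : Fin n → ℝ) (a : ℝ) (x : Stack n p) : wavg w (a • x) = a • wavg w x := by
  ext c
  simp only [PiLp.smul_apply, wavg_apply, coord_smul, dotProduct_smul, smul_eq_mul]
  ring

/-- The consensus error `x - 1 x̄`. -/
def devX (u : Fin n → ℝ) (x : Stack n p) : Stack n p := fun i => x i - wavg u x

/-- The tracking error `y - v ȳ`. -/
def devY (v : Fin n → ℝ) (y : Stack n p) : Stack n p :=
  fun i => y i - v i • wavg (fun _ => 1) y

theorem coord_devX (x : Stack n p) (c : Fin p) :
    coord (devX u x) c = projX u *ᵥ coord x c := by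
  rw [projX_mulVec]
  ext i
  simp only [devX, coord, PiLp.sub_apply, Pi.sub_apply]
  rw [wavg_apply]

theorem coord_devY (y : Stack n p) (c : Fin p) :
    coord (devY v y) c = projY v *ᵥ coord y c := by
  rw [projY_mulVec]
  ext i
  simp only [devY, coord, PiLp.sub_apply, Pi.sub_apply, PiLp.smul_apply, Pi.smul_apply,
    smul_eq_mul]
  rw [wavg_apply]
  simp only [dotProduct, coord, one_mul]
  ring

/-- The stack with the rows `v_i w`. -/
def rankOne (v : Fin n → ℝ) (w : EuclideanSpace ℝ (Fin p)) : Stack n p := fun i => v i • w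

theorem coord_rankOne (w : EuclideanSpace ℝ (Fin p)) (c : Fin p) :
    coord (rankOne v w) c = w c • v := by
  ext i
  simp [coord, rankOne, mul_comm]

theorem devY_add_rankOne (y : Stack n p) : devY v y + rankOne v (wavg (fun _ => 1) y) = y := by
  funext i
  simp [devY, rankOne]

theorem rankOne_add (w w' : EuclideanSpace ℝ (Fin p)) :
    rankOne v (w + w') = rankOne v w + rankOne v w' := by
  funext i
  simp [rankOne]

theorem norm_sq_eq_sum (w : EuclideanSpace ℝ (Fin p)) : ‖w‖ ^ 2 = ∑ c, w c ^ 2 := by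
  simp [EuclideanSpace.norm_sq_eq]

theorem frobSq_rankOne (w : EuclideanSpace ℝ (Fin p)) :
    frobSq (rankOne v w) = vec2 v ^ 2 * ‖w‖ ^ 2 := by
  simp only [frobSq, rankOne, norm_smul, mul_pow, ← Finset.sum_mul, vec2_sq, Real.norm_eq_abs,
    sq_abs]

theorem frobSq_add_le (x y : Stack n p) : frobSq (x + y) ≤ 2 * frobSq x + 2 * frobSq y := by
  simp only [frobSq, Finset.mul_sum, ← Finset.sum_add_distrib]
  exact Finset.sum_le_sum fun i _ => norm_add_sq_le_two _ _

theorem frobSq_sub_le (x y : Stack n p) : frobSq (x - y) ≤ 2 * frobSq x + 2 * frobSq y := by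
  simp only [frobSq, Finset.mul_sum, ← Finset.sum_add_distrib]
  exact Finset.sum_le_sum fun i _ => norm_sub_sq_le_two _ _

theorem frobSq_smul (a : ℝ) (x : Stack n p) : frobSq (a • x) = a ^ 2 * frobSq x := by
  simp only [frobSq, Finset.mul_sum, Pi.smul_apply, norm_smul, mul_pow, Real.norm_eq_abs, sq_abs]

theorem frobSq_act_le (W : Matrix (Fin n) (Fin n) ℝ) (x : Stack n p) :
    frobSq (act W x) ≤ spec2 W ^ 2 * frobSq x := by
  rw [frobSq_eq, frobSq_eq, Finset.mul_sum]
  refine Finset.sum_le_sum fun c _ => ?_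
  rw [coord_act, ← mul_pow]
  exact pow_le_pow_left₀ (vec2_nonneg _) (vec2_mulVec_le _ _) 2

theorem stackNorm_sq (N : (Fin n → ℝ) → ℝ) (x : Stack n p) :
    stackNorm N x ^ 2 = ∑ c, N (coord x c) ^ 2 := by
  rw [stackNorm, Real.sq_sqrt (Finset.sum_nonneg fun _ _ => sq_nonneg _)]
  rfl

theorem frobSq_le_stackNorm_sq {N : (Fin n → ℝ) → ℝ} (h : ∀ z, vec2 z ≤ N z)
    (x : Stack n p) : frobSq x ≤ stackNorm N x ^ 2 := by
  rw [frobSq_eq, stackNorm_sq]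
  exact Finset.sum_le_sum fun c _ => pow_le_pow_left₀ (vec2_nonneg _) (h _) 2

theorem stackNorm_sq_le_mul {N N' : (Fin n → ℝ) → ℝ} {δ : ℝ} (h0 : ∀ z, 0 ≤ N z)
    (h : ∀ z, N z ≤ δ * N' z) (x : Stack n p) :
    stackNorm N x ^ 2 ≤ δ ^ 2 * stackNorm N' x ^ 2 := by
  rw [stackNorm_sq, stackNorm_sq, Finset.mul_sum]
  refine Finset.sum_le_sum fun c _ => ?_
  rw [← mul_pow]
  exact pow_le_pow_left₀ (h0 _) (h _) 2

theorem stackNorm_rankOne_sq {τ : ℝ} (S : Matrix (Fin n) (Fin n) ℂ) (hτ : 0 ≤ τ)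
    (w : EuclideanSpace ℝ (Fin p)) :
    stackNorm (vecNorm τ S) (rankOne v w) ^ 2 = vecNorm τ S v ^ 2 * ‖w‖ ^ 2 := by
  rw [stackNorm_sq, norm_sq_eq_sum, Finset.mul_sum]
  refine Finset.sum_congr rfl fun c _ => ?_
  rw [coord_rankOne, ← norm_toSpace hτ, map_smul, norm_smul, norm_toSpace hτ, mul_pow,
    Real.norm_eq_abs, sq_abs, mul_comm]

theorem stackNorm_add_add_sq_le {τ : ℝ} (S : Matrix (Fin n) (Fin n) ℂ) (hτ : 0 ≤ τ)
    (x y z : Stack n p) :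
    stackNorm (vecNorm τ S) (x + y + z) ^ 2 ≤ 3 * (stackNorm (vecNorm τ S) x ^ 2
      + stackNorm (vecNorm τ S) y ^ 2 + stackNorm (vecNorm τ S) z ^ 2) := by
  simp only [stackNorm_sq, ← Finset.sum_add_distrib, Finset.mul_sum]
  refine Finset.sum_le_sum fun c _ => ?_
  simp only [coord_add, ← norm_toSpace hτ, map_add]
  exact norm_add_add_sq_le_three _ _ _

/-- The mean square of `(1/n) uᵀ M_k x`. -/
theorem sum_norm_wavg_act_sq_le (M : Draw n → Matrix (Fin n) (Fin n) ℝ) (x : Stack n p) :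
    ∑ d, drawProb R C d * ‖wavg u (act (M d) x)‖ ^ 2 ≤
      spec2 (expect R C fun d => (M d)ᵀ * vecMulVec u u * M d) / n ^ 2 * frobSq x := by
  have h : ∀ c, ∑ d, drawProb R C d * (u ⬝ᵥ (M d *ᵥ coord x c)) ^ 2 ≤
      spec2 (expect R C fun d => (M d)ᵀ * vecMulVec u u * M d) * vec2 (coord x c) ^ 2 :=
    fun c => sum_sq_dotProduct_mulVec_le _ M u _
  calc _ = ∑ c, 1 / (n : ℝ) ^ 2 * ∑ d, drawProb R C d * (u ⬝ᵥ (M d *ᵥ coord x c)) ^ 2 := by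
        simp only [norm_sq_eq_sum, wavg_apply, coord_act, Finset.mul_sum]
        rw [Finset.sum_comm]
        refine Finset.sum_congr rfl fun c _ => Finset.sum_congr rfl fun d _ => ?_
        ring
    _ ≤ ∑ c, 1 / (n : ℝ) ^ 2 *
        (spec2 (expect R C fun d => (M d)ᵀ * vecMulVec u u * M d) * vec2 (coord x c) ^ 2) :=
        Finset.sum_le_sum fun c _ => mul_le_mul_of_nonneg_left (h c) (by positivity)
    _ = _ := by
        rw [frobSq_eq, Finset.mul_sum]
        exact Finset.sum_congr rfl fun c _ => by ring

theorem norm_wavg_act_sq_le (W : Matrix (Fin n) (Fin n) ℝ) (x : Stack n p) :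
    ‖wavg u (act W x)‖ ^ 2 ≤ vec2 (u ᵥ* W) ^ 2 / n ^ 2 * frobSq x := by
  rw [norm_sq_eq_sum, frobSq_eq, Finset.mul_sum]
  refine Finset.sum_le_sum fun c _ => ?_
  rw [wavg_apply, coord_act, dotProduct_mulVec, mul_pow]
  have h : ((u ᵥ* W) ⬝ᵥ coord x c) ^ 2 ≤ vec2 (u ᵥ* W) ^ 2 * vec2 (coord x c) ^ 2 := by
    rw [vec2_sq, vec2_sq]
    exact Finset.sum_mul_sq_le_sq_mul_sq _ _ _
  have := mul_le_mul_of_nonneg_left h (show 0 ≤ (1 / (n : ℝ)) ^ 2 by positivity)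
  refine this.trans (le_of_eq ?_)
  ring

end Stacks

/-! ### The averaged gradient -/

section Gradient

variable {n p : ℕ} {f : Fin n → EuclideanSpace ℝ (Fin p) → ℝ} {μ L : ℝ}
  {xs : EuclideanSpace ℝ (Fin p)}

/-- The gradient of `(1/n) ∑ f_i`. -/
def avgGrad (f : Fin n → EuclideanSpace ℝ (Fin p) → ℝ)
    (x : EuclideanSpace ℝ (Fin p)) : EuclideanSpace ℝ (Fin p) :=
  (1 / (n : ℝ)) • ∑ i, gradient (f i) x

theorem hasGradientAt_avg (hdiff : ∀ i, Differentiable ℝ (f i)) (x : EuclideanSpace ℝ (Fin p)) :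
    HasGradientAt (fun x => 1 / (n : ℝ) * ∑ i, f i x) (avgGrad f x) x := by
  rw [hasGradientAt_iff_hasFDerivAt]
  have h : HasFDerivAt (fun x => ∑ i, f i x)
      (∑ i, InnerProductSpace.toDual ℝ _ (gradient (f i) x)) x :=
    HasFDerivAt.fun_sum fun i _ => ((hdiff i) x).hasGradientAt.hasFDerivAt
  refine (h.const_mul (1 / (n : ℝ))).congr_fderiv ?_
  simp [avgGrad]

theorem avgGrad_eq_zero (hdiff : ∀ i, Differentiable ℝ (f i))
    (hxs : IsMinOn (fun x => ∑ i, f i x) Set.univ xs) : avgGrad f xs = 0 := by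
  have hmin : IsLocalMin (fun x => 1 / (n : ℝ) * ∑ i, f i x) xs := by
    refine Eventually.of_forall fun x => ?_
    exact mul_le_mul_of_nonneg_left (hxs (Set.mem_univ x)) (by positivity)
  have h := hmin.hasFDerivAt_eq_zero (hasGradientAt_avg hdiff xs).hasFDerivAt
  simpa using h

theorem norm_avg_sq_le (a : Fin n → EuclideanSpace ℝ (Fin p)) :
    ‖(1 / (n : ℝ)) • ∑ i, a i‖ ^ 2 ≤ 1 / n * ∑ i, ‖a i‖ ^ 2 := by
  rcases Nat.eq_zero_or_pos n with rfl | hn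
  · simp
  have hn' : (0 : ℝ) < n := Nat.cast_pos.2 hn
  have h1 : ‖∑ i, a i‖ ^ 2 ≤ n * ∑ i, ‖a i‖ ^ 2 := by
    calc ‖∑ i, a i‖ ^ 2 ≤ (∑ i, ‖a i‖) ^ 2 := by gcongr; exact norm_sum_le _ _
      _ ≤ _ := by
        have := sq_sum_le_card_mul_sum_sq (s := Finset.univ) (f := fun i => ‖a i‖)
        simpa using this
  rw [norm_smul, mul_pow, Real.norm_eq_abs, sq_abs]
  calc (1 / (n : ℝ)) ^ 2 * ‖∑ i, a i‖ ^ 2 ≤ (1 / (n : ℝ)) ^ 2 * (n * ∑ i, ‖a i‖ ^ 2) := by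
        gcongr
    _ = _ := by field_simp

theorem avgGrad_step (hn : 0 < n) (hdiff : ∀ i, Differentiable ℝ (f i))
    (hconv : ∀ i x x', μ * ‖x - x'‖ ^ 2 ≤
      inner ℝ (gradient (f i) x - gradient (f i) x') (x - x'))
    (hlip : ∀ i x x', ‖gradient (f i) x - gradient (f i) x'‖ ≤ L * ‖x - x'‖)
    (hxs : IsMinOn (fun x => ∑ i, f i x) Set.univ xs) {a : ℝ} (ha : 0 ≤ a) (haL : a * L ≤ 1)
    (x : EuclideanSpace ℝ (Fin p)) :
    ‖x - a • avgGrad f x - xs‖ ^ 2 ≤ (1 - a * μ) ^ 2 * ‖x - xs‖ ^ 2 := by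
  have hn' : (0 : ℝ) < n := Nat.cast_pos.2 hn
  have hsub : ∀ x y, avgGrad f x - avgGrad f y
      = (1 / (n : ℝ)) • ∑ i, (gradient (f i) x - gradient (f i) y) := by
    intro x y
    rw [avgGrad, avgGrad, ← smul_sub, Finset.sum_sub_distrib]
  have hm : ∀ x y, μ * ‖x - y‖ ^ 2 ≤ inner ℝ (avgGrad f x - avgGrad f y) (x - y) := by
    intro x y
    rw [hsub, real_inner_smul_left, sum_inner]
    calc μ * ‖x - y‖ ^ 2 = 1 / n * ∑ i : Fin n, μ * ‖x - y‖ ^ 2 := by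
          simp
          field_simp
      _ ≤ _ := by
          gcongr with i
          exact hconv i x y
  have hL : ∀ x y, ‖avgGrad f x - avgGrad f y‖ ≤ L * ‖x - y‖ := by
    intro x y
    rw [hsub, norm_smul, Real.norm_of_nonneg (by positivity)]
    calc 1 / (n : ℝ) * ‖∑ i, (gradient (f i) x - gradient (f i) y)‖
        ≤ 1 / n * ∑ i : Fin n, L * ‖x - y‖ := by
          gcongr
          exact (norm_sum_le _ _).trans (Finset.sum_le_sum fun i _ => hlip i x y)
      _ = _ := by
          simp
          field_simp
  have h := gradient_step_contraction (hasGradientAt_avg hdiff) ha haL hm hL x xs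
  rw [avgGrad_eq_zero hdiff hxs, smul_zero, sub_zero] at h
  exact h

theorem norm_avgGrad_sq_le (hn : 0 < n) (hdiff : ∀ i, Differentiable ℝ (f i))
    (hlip : ∀ i x x', ‖gradient (f i) x - gradient (f i) x'‖ ≤ L * ‖x - x'‖)
    (hxs : IsMinOn (fun x => ∑ i, f i x) Set.univ xs) (x : EuclideanSpace ℝ (Fin p)) :
    ‖avgGrad f x‖ ^ 2 ≤ L ^ 2 * ‖x - xs‖ ^ 2 := by
  have hn' : (0 : ℝ) < n := Nat.cast_pos.2 hn
  have h0 := avgGrad_eq_zero hdiff hxs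
  have hsub : avgGrad f x
      = (1 / (n : ℝ)) • ∑ i, (gradient (f i) x - gradient (f i) xs) := by
    rw [Finset.sum_sub_distrib, smul_sub]
    change avgGrad f x = avgGrad f x - avgGrad f xs
    rw [h0, sub_zero]
  rw [hsub]
  refine (norm_avg_sq_le _).trans ?_
  calc 1 / (n : ℝ) * ∑ i, ‖gradient (f i) x - gradient (f i) xs‖ ^ 2
      ≤ 1 / n * ∑ i : Fin n, (L * ‖x - xs‖) ^ 2 := by
        gcongr with i
        exact hlip i x xs
    _ = _ := by
        simp
        field_simp

/-- The average of `y` equals the average of the local gradients, so this is the error made in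
replacing it by the gradient at the weighted average. -/
theorem norm_avg_gradStack_sub_sq_le
    (hlip : ∀ i x x', ‖gradient (f i) x - gradient (f i) x'‖ ≤ L * ‖x - x'‖)
    (u : Fin n → ℝ) (x : Stack n p) :
    ‖wavg (fun _ => 1) (gradStack f x) - avgGrad f (wavg u x)‖ ^ 2 ≤
      L ^ 2 / n * frobSq (devX u x) := by
  have hsub : wavg (fun _ => 1) (gradStack f x) - avgGrad f (wavg u x)
      = (1 / (n : ℝ)) • ∑ i, (gradient (f i) (x i) - gradient (f i) (wavg u x)) := by
    rw [Finset.sum_sub_distrib, smul_sub]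
    simp [wavg, gradStack, avgGrad]
  rw [hsub]
  refine (norm_avg_sq_le _).trans ?_
  calc 1 / (n : ℝ) * ∑ i, ‖gradient (f i) (x i) - gradient (f i) (wavg u x)‖ ^ 2
      ≤ 1 / n * ∑ i, (L * ‖x i - wavg u x‖) ^ 2 := by
        gcongr with i
        exact hlip i _ _
    _ = _ := by
        simp only [frobSq, devX, mul_pow, ← Finset.mul_sum]
        ring

theorem frobSq_gradStack_sub_le
    (hlip : ∀ i x x', ‖gradient (f i) x - gradient (f i) x'‖ ≤ L * ‖x - x'‖)
    (x x' : Stack n p) :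
    frobSq (gradStack f x - gradStack f x') ≤ L ^ 2 * frobSq (x - x') := by
  simp only [frobSq, Finset.mul_sum, ← mul_pow]
  refine Finset.sum_le_sum fun i _ => ?_
  exact pow_le_pow_left₀ (norm_nonneg _) (hlip i _ _) 2

end Gradient

/-! ### One step of the iteration -/

section Step

variable {n p : ℕ} {R C : Matrix (Fin n) (Fin n) ℝ} {u v : Fin n → ℝ}
  {f : Fin n → EuclideanSpace ℝ (Fin p) → ℝ} {μ L γ α : ℝ} {xs : EuclideanSpace ℝ (Fin p)}

/-- The `x`-update for the draw `d`. -/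
def nextX (γ α : ℝ) (x y : Stack n p) (d : Draw n) : Stack n p :=
  act (drawR γ d) x - α • act (drawQ d) y

/-- The `y`-update for the draw `d`. -/
def nextY (γ α : ℝ) (f : Fin n → EuclideanSpace ℝ (Fin p) → ℝ) (x y : Stack n p) (d : Draw n) :
    Stack n p :=
  act (drawC γ d) y + gradStack f (nextX γ α x y d) - gradStack f x

theorem wavg_one_act_drawC (d : Draw n) (y : Stack n p) :
    wavg (fun _ => 1) (act (drawC γ d) y) = wavg (fun _ => 1) y := by
  ext c
  rw [wavg_apply, wavg_apply, coord_act, drawC, add_mulVec, one_mulVec, smul_mulVec,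
    dotProduct_add, dotProduct_smul]
  have : (fun _ => (1 : ℝ)) ⬝ᵥ (drawE d *ᵥ coord y c) = 0 := by
    simpa [dotProduct] using sum_drawE_mulVec d (coord y c)
  rw [this, smul_zero, add_zero]

/-- Gradient tracking: the average of `y` is the average gradient. -/
theorem wavg_one_nextY {x y : Stack n p}
    (h : wavg (fun _ => 1) y = wavg (fun _ => 1) (gradStack f x)) (d : Draw n) :
    wavg (fun _ => 1) (nextY γ α f x y d)
      = wavg (fun _ => 1) (gradStack f (nextX γ α x y d)) := by
  rw [nextY, wavg_sub, wavg_add, wavg_one_act_drawC, h]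
  abel

theorem norm_wavg_sq_le (hn : 0 < n) (hdiff : ∀ i, Differentiable ℝ (f i))
    (hlip : ∀ i x x', ‖gradient (f i) x - gradient (f i) x'‖ ≤ L * ‖x - x'‖)
    (hxs : IsMinOn (fun x => ∑ i, f i x) Set.univ xs) {x y : Stack n p}
    (h : wavg (fun _ => 1) y = wavg (fun _ => 1) (gradStack f x)) :
    ‖wavg (fun _ => 1) y‖ ^ 2 ≤ 2 * L ^ 2 * ‖wavg u x - xs‖ ^ 2
      + 2 * L ^ 2 / n * frobSq (devX u x) := by
  have h1 := norm_add_sq_le_two (avgGrad f (wavg u x))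
    (wavg (fun _ => 1) y - avgGrad f (wavg u x))
  rw [add_sub_cancel] at h1
  have h2 := norm_avgGrad_sq_le hn hdiff hlip hxs (wavg u x)
  have h3 := norm_avg_gradStack_sub_sq_le hlip u x
  rw [← h] at h3
  have e : 2 * L ^ 2 / n * frobSq (devX u x) = 2 * (L ^ 2 / n * frobSq (devX u x)) := by ring
  rw [e]
  linarith

theorem frobSq_le_dev (y : Stack n p) :
    frobSq y ≤ 2 * frobSq (devY v y) + 2 * (vec2 v ^ 2 * ‖wavg (fun _ => 1) y‖ ^ 2) := by
  have h := frobSq_add_le (devY v y) (rankOne v (wavg (fun _ => 1) y))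
  rwa [devY_add_rankOne, frobSq_rankOne] at h

theorem act_drawR_sub_one (x : Stack n p) (d : Draw n) :
    act (drawR γ d) x - x = act (drawR γ d - 1) (devX u x) := by
  refine stack_ext fun c => ?_
  rw [coord_sub, coord_act, coord_act, coord_devX, drawR, add_sub_cancel_left, add_mulVec,
    one_mulVec, add_sub_cancel_left, smul_mulVec, smul_mulVec, projX_mulVec, mulVec_sub,
    drawT_mulVec_const, sub_zero]

variable [NeZero n]

theorem consensus_step {S J : Matrix (Fin n) (Fin n) ℂ} {τ : ℝ} (hτ : 0 ≤ τ)
    (hS : IsScaledJordan (expect R C drawT) u S J) (huT : u ᵥ* expect R C drawT = 0)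
    (hu1 : ∑ i, u i = n) (hσ : sigmaR R C u S J γ < 1) (x y : Stack n p) :
    ∑ d, drawProb R C d * stackNorm (vecNorm τ S) (devX u (nextX γ α x y d)) ^ 2 ≤
      (1 + sigmaR R C u S J γ) / 2 * stackNorm (vecNorm τ S) (devX u x) ^ 2
      + (1 + sigmaR R C u S J γ) / (1 - sigmaR R C u S J γ) * (α ^ 2 *
        (spec2 (VQ R C u S) * stackNorm (vecNorm τ S) y ^ 2)) := by
  simp only [stackNorm_sq, Finset.mul_sum, ← Finset.sum_add_distrib]
  rw [Finset.sum_comm]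
  refine Finset.sum_le_sum fun c _ => ?_
  have h := consensus_contraction hτ hS huT hu1 hσ α (coord x c) (coord y c)
  simp only [coord_devX, nextX, coord_sub, coord_smul, coord_act]
  exact h

/-- The perturbation is the increment of the gradients, at most `L` times the increment `(R_k - I)(x
- 1 x̄) - α Q_k y` of `x`. -/
theorem tracking_step {D J : Matrix (Fin n) (Fin n) ℂ} {τ : ℝ} (hτ : 0 ≤ τ)
    (hD : IsScaledJordan (expect R C drawE) (fun _ => 1) D J)
    (hEv : expect R C drawE *ᵥ v = 0) (hv1 : ∑ i, v i = n)
    (hσ0 : 0 < sigmaC R C D J γ) (hσ : sigmaC R C D J γ < 1) {δ : ℝ}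
    (hδ : ∀ z : Fin n → ℝ, vecNorm τ D z ≤ δ * vec2 z)
    (hlip : ∀ i x x', ‖gradient (f i) x - gradient (f i) x'‖ ≤ L * ‖x - x'‖)
    (u : Fin n → ℝ) (x y : Stack n p) :
    ∑ d, drawProb R C d * stackNorm (vecNorm τ D) (devY v (nextY γ α f x y d)) ^ 2 ≤
      (1 + sigmaC R C D J γ) / 2 * stackNorm (vecNorm τ D) (devY v y) ^ 2
      + γ ^ 2 * ((1 + sigmaC R C D J γ) / sigmaC R C D J γ * spec2 (VE R C D)
        * vecNorm τ D v ^ 2) * ‖wavg (fun _ => 1) y‖ ^ 2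
      + (1 + sigmaC R C D J γ) / (1 - sigmaC R C D J γ) * (matNorm D (projY v) ^ 2 * δ ^ 2 *
        (2 * L ^ 2 * ((expect R C fun d => spec2 (drawR γ d - 1) ^ 2) * frobSq (devX u x)
          + α ^ 2 * (expect R C fun d => spec2 (drawQ d) ^ 2) * frobSq y))) := by
  set σ := sigmaC R C D J γ
  set G : Draw n → Stack n p := fun d => gradStack f (nextX γ α x y d) - gradStack f x with hG
  have h1 : ∑ d, drawProb R C d * stackNorm (vecNorm τ D) (devY v (nextY γ α f x y d)) ^ 2 ≤
      (1 + σ) / 2 * stackNorm (vecNorm τ D) (devY v y) ^ 2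
      + γ ^ 2 * ((1 + σ) / σ * spec2 (VE R C D) * vecNorm τ D v ^ 2)
        * ‖wavg (fun _ => 1) y‖ ^ 2
      + (1 + σ) / (1 - σ) * (matNorm D (projY v) ^ 2 * δ ^ 2 *
        ∑ d, drawProb R C d * frobSq (G d)) := by
    have e : ∑ d, drawProb R C d * frobSq (G d)
        = ∑ c, ∑ d, drawProb R C d * vec2 (coord (G d) c) ^ 2 := by
      simp only [frobSq_eq, Finset.mul_sum]
      exact Finset.sum_comm
    have e' : ∑ d, drawProb R C d * stackNorm (vecNorm τ D) (devY v (nextY γ α f x y d)) ^ 2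
        = ∑ c, ∑ d, drawProb R C d
          * vecNorm τ D (coord (devY v (nextY γ α f x y d)) c) ^ 2 := by
      simp only [stackNorm_sq, Finset.mul_sum]
      exact Finset.sum_comm
    rw [e, e', norm_sq_eq_sum, stackNorm_sq, Finset.mul_sum, Finset.mul_sum, Finset.mul_sum,
      Finset.mul_sum, ← Finset.sum_add_distrib, ← Finset.sum_add_distrib]
    refine Finset.sum_le_sum fun c _ => ?_
    have h := tracking_contraction hτ hD hEv hv1 hσ0 hσ hδ (coord y c) fun d => coord (G d) c
    have e1 : 1 / (n : ℝ) * ∑ i, coord y c i = wavg (fun _ => 1) y c := by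
      rw [wavg_apply]
      simp [dotProduct]
    rw [e1, ← coord_devY] at h
    refine le_of_eq_of_le ?_ h
    refine Finset.sum_congr rfl fun d _ => ?_
    rw [coord_devY, nextY, add_sub_assoc, coord_add, coord_act]
  have h2 : ∀ d, frobSq (G d) ≤ 2 * L ^ 2 * (spec2 (drawR γ d - 1) ^ 2 * frobSq (devX u x)
      + α ^ 2 * spec2 (drawQ d) ^ 2 * frobSq y) := by
    intro d
    have h3 := frobSq_gradStack_sub_le hlip (nextX γ α x y d) x
    have h4 : nextX γ α x y d - x
        = act (drawR γ d - 1) (devX u x) - α • act (drawQ d) y := by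
      rw [nextX, ← act_drawR_sub_one]
      abel
    have h5 := frobSq_sub_le (act (drawR γ d - 1) (devX u x)) (α • act (drawQ d) y)
    have h6 := frobSq_act_le (drawR γ d - 1) (devX u x)
    have h7 := mul_le_mul_of_nonneg_left (frobSq_act_le (drawQ d) y) (sq_nonneg α)
    rw [frobSq_smul] at h5
    rw [h4] at h3
    refine h3.trans ?_
    have h8 := mul_le_mul_of_nonneg_left (h5.trans (add_le_add
      (mul_le_mul_of_nonneg_left h6 zero_le_two) (mul_le_mul_of_nonneg_left h7 zero_le_two)))
      (sq_nonneg L)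
    linarith
  have h9 : ∑ d, drawProb R C d * frobSq (G d) ≤
      2 * L ^ 2 * ((expect R C fun d => spec2 (drawR γ d - 1) ^ 2) * frobSq (devX u x)
          + α ^ 2 * (expect R C fun d => spec2 (drawQ d) ^ 2) * frobSq y) := by
    refine (sum_drawProb_le fun d _ => h2 d).trans (le_of_eq ?_)
    simp only [expect, smul_eq_mul, Finset.mul_sum, Finset.sum_mul, mul_add,
      Finset.sum_add_distrib]
    congr 1 <;> exact Finset.sum_congr rfl fun d _ => by ring
  refine h1.trans (add_le_add le_rfl ?_)
  refine mul_le_mul_of_nonneg_left ?_ (div_nonneg (by linarith) (by linarith))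
  exact mul_le_mul_of_nonneg_left h9 (by positivity)

/-- The next average minus `x*` is its mean `x̄ - x* - α m` plus the centred part `r - α (s - m)`.
The mean is an exact gradient step of length `αη`, perturbed by the consensus and tracking errors.
-/
theorem optimality_step (hdiff : ∀ i, Differentiable ℝ (f i))
    (hconv : ∀ i x x', μ * ‖x - x'‖ ^ 2 ≤
      inner ℝ (gradient (f i) x - gradient (f i) x') (x - x'))
    (hlip : ∀ i x x', ‖gradient (f i) x - gradient (f i) x'‖ ≤ L * ‖x - x'‖)
    (hxs : IsMinOn (fun x => ∑ i, f i x) Set.univ xs)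
    (huT : u ᵥ* expect R C drawT = 0) {η : ℝ}
    (hη : η = u ⬝ᵥ (expect R C drawQ *ᵥ v) / n) (hμ : 0 < μ) (hη0 : 0 < η) (hα : 0 < α)
    (hα1 : α * η * μ < 1) (hαL : α * η * L ≤ 1) {x y : Stack n p}
    (hy : wavg (fun _ => 1) y = wavg (fun _ => 1) (gradStack f x)) :
    ∑ d, drawProb R C d * ‖wavg u (nextX γ α x y d) - xs‖ ^ 2 ≤
      (1 - α * η * μ) * ‖wavg u x - xs‖ ^ 2
      + 2 * α * η * L ^ 2 / (μ * n) * frobSq (devX u x)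
      + 2 * α / (η * μ) * (vec2 (u ᵥ* expect R C drawQ) ^ 2 / n ^ 2) * frobSq (devY v y)
      + 2 * (spec2 (expect R C fun d => (γ • centT R C d)ᵀ * vecMulVec u u *
        (γ • centT R C d)) / n ^ 2) * frobSq (devX u x)
      + 2 * α ^ 2 * (spec2 (expect R C fun d => (drawQ d)ᵀ * vecMulVec u u * drawQ d) / n ^ 2)
        * frobSq y := by
  set m := wavg u (act (expect R C drawQ) y) with hm
  set r := fun d => wavg u (act (γ • centT R C d) (devX u x)) with hr
  set s := fun d => wavg u (act (drawQ d) y) with hs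
  have hms : ∑ d, drawProb R C d • (s d - m) = 0 := by
    have : m = ∑ d, drawProb R C d • s d := by
      ext c
      simp only [hm, hs, wavg_apply, coord_act, expect, sum_mulVec, smul_mulVec,
        dotProduct_sum, dotProduct_smul, WithLp.ofLp_sum, Finset.sum_apply, WithLp.ofLp_smul,
        Pi.smul_apply, smul_eq_mul, Finset.mul_sum]
      exact Finset.sum_congr rfl fun d _ => by ring
    simp only [smul_sub, Finset.sum_sub_distrib, ← Finset.sum_smul, sum_drawProb, one_smul,
      ← this, sub_self]
  have hrs : ∑ d, drawProb R C d • r d = 0 := by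
    ext c
    simp only [hr, wavg_apply, coord_act, WithLp.ofLp_sum, Finset.sum_apply, WithLp.ofLp_smul,
      Pi.smul_apply, smul_eq_mul, smul_mulVec, dotProduct_smul]
    have h1 : ∑ d, drawProb R C d * (u ⬝ᵥ (centT R C d *ᵥ coord (devX u x) c)) = 0 := by
      have : ∀ d, drawProb R C d * (u ⬝ᵥ (centT R C d *ᵥ coord (devX u x) c))
          = u ⬝ᵥ ((drawProb R C d • centT R C d) *ᵥ coord (devX u x) c) := by
        intro d
        rw [smul_mulVec, dotProduct_smul, smul_eq_mul]
      simp only [this, ← dotProduct_sum, ← sum_mulVec, sum_drawProb_smul_centT]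
      simp
    have h2 : ∀ d, drawProb R C d *
        (1 / n * (γ * (u ⬝ᵥ (centT R C d *ᵥ coord (devX u x) c))))
        = 1 / n * γ * (drawProb R C d * (u ⬝ᵥ (centT R C d *ᵥ coord (devX u x) c))) := by
      intro d; ring
    simp only [h2, ← Finset.mul_sum, h1]
    simp
  have hsplit : ∀ d, wavg u (nextX γ α x y d) - xs
      = (wavg u x - xs - α • m) + (r d - α • (s d - m)) := by
    intro d
    have h1 : wavg u (act (drawR γ d) x) = wavg u x + r d := by
      have h2 := congrArg (wavg u) (act_drawR_sub_one (γ := γ) (u := u) x d)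
      rw [wavg_sub, sub_eq_iff_eq_add'] at h2
      rw [h2]
      congr 1
      ext c
      simp only [hr, wavg_apply, coord_act]
      rw [drawR, add_sub_cancel_left, smul_mulVec, smul_mulVec, centT, sub_mulVec,
        dotProduct_smul, dotProduct_smul, dotProduct_sub, dotProduct_mulVec u (expect R C drawT),
        huT, zero_dotProduct, sub_zero]
    rw [nextX, wavg_sub, wavg_smul, h1]
    simp only [hs, smul_sub]
    abel
  have hcent : ∑ d, drawProb R C d • (r d - α • (s d - m)) = 0 := by
    have : ∀ d, drawProb R C d • (r d - α • (s d - m))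
        = drawProb R C d • r d - α • (drawProb R C d • (s d - m)) := by
      intro d
      rw [smul_sub, smul_comm]
    simp only [this, Finset.sum_sub_distrib, ← Finset.smul_sum, hrs, hms]
    simp
  simp only [hsplit]
  rw [sum_norm_add_sq_of_centred (sum_drawProb R C) _ hcent]
  have hvar : ∑ d, drawProb R C d * ‖r d - α • (s d - m)‖ ^ 2 ≤
      2 * ∑ d, drawProb R C d * ‖r d‖ ^ 2 + 2 * α ^ 2 * ∑ d, drawProb R C d * ‖s d‖ ^ 2 := by
    have h1 : ∑ d, drawProb R C d * ‖s d - m‖ ^ 2 ≤ ∑ d, drawProb R C d * ‖s d‖ ^ 2 := by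
      have := sum_norm_add_sq_of_centred (sum_drawProb R C) m hms
      simp only [add_sub_cancel] at this
      rw [this]
      linarith [sq_nonneg ‖m‖]
    have h2 : ∑ d, drawProb R C d * ‖r d - α • (s d - m)‖ ^ 2 ≤
        2 * ∑ d, drawProb R C d * ‖r d‖ ^ 2
          + 2 * α ^ 2 * ∑ d, drawProb R C d * ‖s d - m‖ ^ 2 := by
      rw [Finset.mul_sum, Finset.mul_sum, ← Finset.sum_add_distrib]
      refine Finset.sum_le_sum fun d _ => ?_
      have h3 := norm_sub_sq_le_two (r d) (α • (s d - m))
      rw [norm_smul, mul_pow, Real.norm_eq_abs, sq_abs] at h3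
      have := mul_le_mul_of_nonneg_left h3 (drawProb_nonneg R C d)
      linarith
    have h4 := mul_le_mul_of_nonneg_left h1 (show 0 ≤ 2 * α ^ 2 by positivity)
    linarith
  have hvr : ∑ d, drawProb R C d * ‖r d‖ ^ 2 ≤ _ :=
    sum_norm_wavg_act_sq_le (R := R) (C := C) (u := u) (fun d => γ • centT R C d) (devX u x)
  have hvs : ∑ d, drawProb R C d * ‖s d‖ ^ 2 ≤ _ :=
    sum_norm_wavg_act_sq_le (R := R) (C := C) (u := u) drawQ y
  set ybar := wavg (fun _ => 1) y with hybar
  set q := wavg u (act (expect R C drawQ) (devY v y)) with hq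
  -- Writing `y = (y - v ȳ) + v ȳ` shows `η` as the effective stepsize factor.
  have hmq : m = q + η • ybar := by
    rw [hm, hq]
    conv_lhs => rw [← devY_add_rankOne (v := v) y]
    ext c
    simp only [hybar, PiLp.add_apply, PiLp.smul_apply, wavg_apply, coord_act, coord_add, mulVec_add,
      dotProduct_add, coord_rankOne, mulVec_smul, dotProduct_smul, smul_eq_mul, hη]
    ring
  set g := avgGrad f (wavg u x) with hg
  have hmean : wavg u x - xs - α • m
      = (wavg u x - (α * η) • g - xs) + -((α * η) • (ybar - g) + α • q) := by
    rw [hmq, smul_add, smul_smul, smul_sub]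
    abel
  have hn : 0 < n := NeZero.pos n
  have hθ : 0 < α * η * μ := by positivity
  have hθ' : 0 < 1 - α * η * μ := by linarith
  -- With this weight the squared contraction factor `(1 - αημ)²` of the gradient step loses one
  -- power.
  have h1 := norm_add_sq_le_div (θ := 1 - α * η * μ) hθ' (by linarith)
    (wavg u x - (α * η) • g - xs) (-((α * η) • (ybar - g) + α • q))
  rw [← hmean, sub_sub_cancel, norm_neg] at h1
  have h2 := avgGrad_step hn hdiff hconv hlip hxs (a := α * η) (by positivity) hαL (wavg u x)
  have h3 := norm_add_sq_le_two ((α * η) • (ybar - g)) (α • q)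
  rw [norm_smul, norm_smul, mul_pow, mul_pow, Real.norm_eq_abs, Real.norm_eq_abs, sq_abs,
    sq_abs] at h3
  have h4 := norm_avg_gradStack_sub_sq_le hlip u x
  rw [← hy] at h4
  have h5 := norm_wavg_act_sq_le (u := u) (expect R C drawQ) (devY v y)
  have h6 : ‖wavg u x - xs - α • m‖ ^ 2 ≤ (1 - α * η * μ) * ‖wavg u x - xs‖ ^ 2
      + 2 * α * η * L ^ 2 / (μ * n) * frobSq (devX u x)
      + 2 * α / (η * μ) * (vec2 (u ᵥ* expect R C drawQ) ^ 2 / n ^ 2) * frobSq (devY v y) := by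
    refine h1.trans ?_
    have a1 := mul_le_mul_of_nonneg_left h2 (show 0 ≤ 1 / (1 - α * η * μ) by positivity)
    have e1 : 1 / (1 - α * η * μ) * ((1 - α * η * μ) ^ 2 * ‖wavg u x - xs‖ ^ 2)
        = (1 - α * η * μ) * ‖wavg u x - xs‖ ^ 2 := by
      field_simp
    rw [e1] at a1
    have a2 : 1 / (α * η * μ) * ‖(α * η) • (ybar - g) + α • q‖ ^ 2 ≤
        1 / (α * η * μ) * (2 * ((α * η) ^ 2 * (L ^ 2 / n * frobSq (devX u x)))
          + 2 * (α ^ 2 * (vec2 (u ᵥ* expect R C drawQ) ^ 2 / n ^ 2 * frobSq (devY v y)))) := by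
      refine mul_le_mul_of_nonneg_left (h3.trans ?_) (by positivity)
      have b1 := mul_le_mul_of_nonneg_left h4 (show 0 ≤ 2 * (α * η) ^ 2 by positivity)
      have b2 := mul_le_mul_of_nonneg_left h5 (show 0 ≤ 2 * α ^ 2 by positivity)
      linarith
    have hn' : (n : ℝ) ≠ 0 := by positivity
    have e2 : 1 / (α * η * μ) * (2 * ((α * η) ^ 2 * (L ^ 2 / n * frobSq (devX u x)))
          + 2 * (α ^ 2 * (vec2 (u ᵥ* expect R C drawQ) ^ 2 / n ^ 2 * frobSq (devY v y))))
        = 2 * α * η * L ^ 2 / (μ * n) * frobSq (devX u x)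
        + 2 * α / (η * μ) * (vec2 (u ᵥ* expect R C drawQ) ^ 2 / n ^ 2)
          * frobSq (devY v y) := by
      field_simp
    rw [e2] at a2
    linarith
  have h7 := mul_le_mul_of_nonneg_left hvr zero_le_two
  have h8 := mul_le_mul_of_nonneg_left hvs (show 0 ≤ 2 * α ^ 2 by positivity)
  linarith

end Step

/-! ### The Perron vectors and the size of the constants -/

section Constants

variable {n : ℕ} {R C : Matrix (Fin n) (Fin n) ℝ} {u v : Fin n → ℝ}
  {S D J : Matrix (Fin n) (Fin n) ℂ} {γ τ δ : ℝ}

theorem drawR_nonneg (hγ : γ ∈ Set.Ioo (0 : ℝ) 1) (d : Draw n) (a b : Fin n) :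
    0 ≤ drawR γ d a b := by
  obtain ⟨i, j, l⟩ := d
  cases j with
  | none =>
    simp only [drawR, drawT, smul_zero, add_zero, one_apply]
    split_ifs <;> norm_num
  | some j =>
    have h1 : 0 ≤ γ * (unitVec j a * unitVec i b) :=
      mul_nonneg hγ.1.le (mul_nonneg (option_elim_unitVec_nonneg (some j) a)
        (option_elim_unitVec_nonneg (some i) b))
    have h2 : γ * (unitVec j a * unitVec j b) ≤ (1 : Matrix (Fin n) (Fin n) ℝ) a b := by
      simp only [unitVec, Pi.single_apply, one_apply]
      split_ifs with h3 h4 h5 h5 <;> simp_all [hγ.2.le]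
    simp only [drawR, drawT, Matrix.add_apply, Matrix.smul_apply, Matrix.sub_apply,
      vecMulVec_apply, smul_eq_mul]
    linarith

theorem sq_vecNorm_eq (z : Fin n → ℝ) :
    vecNorm τ S z ^ 2 = τ ^ 2 * ∑ i, ‖(S *ᵥ cvec z) i‖ ^ 2 := by
  rw [vecNorm_eq, mul_pow, EuclideanSpace.norm_sq_eq]

theorem spec2_le_of_bound {𝕜 : Type*} [RCLike 𝕜] {A : Matrix (Fin n) (Fin n) 𝕜} {K : ℝ}
    (hK : 0 ≤ K) (h : ∀ z : Fin n → 𝕜, ‖WithLp.toLp 2 (A *ᵥ z)‖ ≤ K * ‖WithLp.toLp 2 z‖) :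
    spec2 A ≤ K := by
  refine ContinuousLinearMap.opNorm_le_bound _ hK fun z => ?_
  have := h (WithLp.ofLp z)
  rwa [← toEuclideanCLM_toLp] at this

theorem one_le_spec2_drawQ (d : Draw n) : 1 ≤ spec2 (drawQ d) := by
  have h := norm_diag_le_spec2 (drawQ d) d.1
  refine le_trans ?_ h
  have h1 : drawQ d d.1 d.1 = drawQVec d d.1 := by simp [drawQ, drawQVec]
  rw [h1]
  exact (one_le_drawQVec d).trans (le_abs_self _)

theorem vecMul_expect_drawQ_apply (i : Fin n) :
    (u ᵥ* expect R C drawQ) i = u i * ∑ d, drawProb R C d * drawQVec d i := by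
  rw [expect_vecMul]
  simp only [expect, Finset.sum_apply, Pi.smul_apply, smul_eq_mul, Finset.mul_sum]
  refine Finset.sum_congr rfl fun d _ => ?_
  have : (u ᵥ* drawQ d) i = u i * drawQVec d i := by simp [drawQ, drawQVec, vecMul_diagonal]
  rw [this]
  ring

theorem sq_dotProduct_le (a b : Fin n → ℝ) : (a ⬝ᵥ b) ^ 2 ≤ vec2 a ^ 2 * vec2 b ^ 2 := by
  rw [vec2_sq, vec2_sq]
  exact Finset.sum_mul_sq_le_sq_mul_sq _ _ _

theorem dotProduct_le_vec2_mul (a b : Fin n → ℝ) : a ⬝ᵥ b ≤ vec2 a * vec2 b := by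
  refine (le_abs_self _).trans (abs_le_of_sq_le_sq ?_ (mul_nonneg (vec2_nonneg _) (vec2_nonneg _)))
  rw [mul_pow]
  exact sq_dotProduct_le a b

/-- The diagonal of `Q_k` has entries `q` in `[0, 2]`, so `q² ≤ 2 q`. The second moment is thus
controlled by the first, which ties `d₁` to `d₇`. -/
theorem spec2_second_moment_drawQ_le :
    spec2 (expect R C fun d => (drawQ d)ᵀ * vecMulVec u u * drawQ d) ≤
      2 * (vec2 u * vec2 (u ᵥ* expect R C drawQ)) := by
  have h1 : spec2 (expect R C fun d => (drawQ d)ᵀ * vecMulVec u u * drawQ d) ≤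
      ∑ d, drawProb R C d * vec2 (drawQVec d * u) ^ 2 := by
    refine spec2_le_of_bound (Finset.sum_nonneg fun d _ =>
      mul_nonneg (drawProb_nonneg R C d) (sq_nonneg _)) fun z => ?_
    have e : ∀ d, ((drawQ d)ᵀ * vecMulVec u u * drawQ d) *ᵥ z
        = ((drawQVec d * u) ⬝ᵥ z) • (drawQVec d * u) := by
      intro d
      have hQ : (drawQ d)ᵀ = drawQ d := diagonal_transpose _
      rw [hQ, ← mulVec_mulVec, ← mulVec_mulVec, vecMulVec_mulVec, drawQ_mulVec, drawQ_mulVec]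
      have : u ⬝ᵥ (drawQVec d * z) = (drawQVec d * u) ⬝ᵥ z := by
        simp only [dotProduct, Pi.mul_apply]
        exact Finset.sum_congr rfl fun i _ => by ring
      rw [this]
      ext i
      simp
      ring
    rw [expect_mulVec]
    simp only [e, expect, WithLp.toLp_sum, WithLp.toLp_smul]
    refine (norm_sum_le _ _).trans ?_
    rw [Finset.sum_mul]
    refine Finset.sum_le_sum fun d _ => ?_
    rw [norm_smul, norm_smul, Real.norm_of_nonneg (drawProb_nonneg R C d), mul_assoc]
    refine mul_le_mul_of_nonneg_left ?_ (drawProb_nonneg R C d)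
    have h2 : ‖(drawQVec d * u) ⬝ᵥ z‖ ≤ vec2 (drawQVec d * u) * vec2 z := by
      rw [Real.norm_eq_abs]
      refine abs_le_of_sq_le_sq ?_ (mul_nonneg (vec2_nonneg _) (vec2_nonneg _))
      rw [mul_pow]
      exact sq_dotProduct_le _ _
    calc _ ≤ vec2 (drawQVec d * u) * vec2 z * vec2 (drawQVec d * u) :=
          mul_le_mul_of_nonneg_right h2 (norm_nonneg _)
      _ = _ := by rw [vec2, vec2]; ring
  refine h1.trans ?_
  calc ∑ d, drawProb R C d * vec2 (drawQVec d * u) ^ 2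
      ≤ ∑ d, drawProb R C d * (2 * ∑ i, u i * (u i * drawQVec d i)) := by
        refine sum_drawProb_le fun d hd => ?_
        rw [vec2_sq, Finset.mul_sum]
        refine Finset.sum_le_sum fun i _ => ?_
        have h2 := drawQVec_le_two hd i
        have h3 := drawQVec_nonneg d i
        have h4 := mul_le_mul_of_nonneg_left h2 (mul_nonneg (sq_nonneg (u i)) h3)
        rw [Pi.mul_apply]
        linarith
    _ = 2 * (u ⬝ᵥ (u ᵥ* expect R C drawQ)) := by
        simp only [dotProduct, vecMul_expect_drawQ_apply, Finset.mul_sum]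
        rw [Finset.sum_comm]
        refine Finset.sum_congr rfl fun i _ => Finset.sum_congr rfl fun d _ => ?_
        ring
    _ ≤ _ := mul_le_mul_of_nonneg_left (dotProduct_le_vec2_mul _ _) zero_le_two

theorem vec2_sq_le_vecNorm_sq (h : ∀ z : Fin n → ℝ, vec2 z ≤ vecNorm τ S z) (z : Fin n → ℝ) :
    vec2 z ^ 2 ≤ vecNorm τ S z ^ 2 := pow_le_pow_left₀ (vec2_nonneg z) (h z) 2

/-- With probability `1/n` the agent `i₀` wakes up and passes its `x` to some `j`; then `R_k - I`
has the diagonal entry `-γ`. -/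
theorem gamma_sq_div_le_expect (hout : ∃ i, outNbr R i ≠ ∅) :
    γ ^ 2 / n ≤ expect R C fun d => spec2 (drawR γ d - 1) ^ 2 := by
  classical
  obtain ⟨i₀, hi₀⟩ := hout
  have h1 : ∑ d, drawProb R C d * (if d.1 = i₀ then γ ^ 2 else 0) ≤
      ∑ d, drawProb R C d * spec2 (drawR γ d - 1) ^ 2 := by
    refine sum_drawProb_le fun d hd => ?_
    obtain ⟨i, j, l⟩ := d
    simp only
    split_ifs with h
    · subst h
      have hp := pick_left_ne_zero hd
      cases j with
      | none => exact absurd (outNbr_eq_empty_of_pick_none R hp) hi₀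
      | some j =>
        have hj : j ≠ i := ne_of_pick_ne_zero R hp
        have h2 := norm_diag_le_spec2 (drawR γ (i, some j, l) - 1) j
        have h3 : (drawR γ (i, some j, l) - 1) j j = -γ := by
          simp [drawR, drawT, vecMulVec_apply, unitVec, hj]
        rw [h3, norm_neg, Real.norm_eq_abs] at h2
        rw [← sq_abs γ]
        exact pow_le_pow_left₀ (abs_nonneg _) h2 2
    · positivity
  rw [sum_drawProb_fst R C fun i => if i = i₀ then γ ^ 2 else 0] at h1
  simp only [Finset.sum_ite_eq', Finset.mem_univ, if_true] at h1
  refine le_trans (le_of_eq ?_) h1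
  ring

/-- The projection fixes the nonzero vector `e_i - e_j`. -/
theorem one_le_matNorm_projY (hn : 2 ≤ n) (hD : IsUnit D.det) :
    1 ≤ matNorm D (projY v) := by
  have : Nontrivial (Fin n) := Fin.nontrivial_iff_two_le.2 hn
  obtain ⟨i, j, hij⟩ := exists_pair_ne (Fin n)
  set z : Fin n → ℝ := unitVec i - unitVec j with hz
  have hz0 : ∑ a, z a = 0 := by simp [hz, unitVec]
  have h := norm_mulVec_le_matNorm hD (projY v) z
  have hfix : projY v *ᵥ z = z := by
    rw [projY_mulVec, hz0]
    simp
  rw [hfix] at h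
  have hpos : 0 < ‖WithLp.toLp 2 (D *ᵥ cvec z)‖ := by
    rw [norm_pos_iff]
    intro h0
    have h1 : D *ᵥ cvec z = 0 := by simpa using h0
    have h2 := congrArg (D⁻¹ *ᵥ ·) h1
    simp only [mulVec_mulVec, nonsing_inv_mul _ hD, one_mulVec, mulVec_zero] at h2
    have h3 := congrFun h2 i
    simp [cvec, hz, unitVec, hij] at h3
  exact (le_mul_iff_one_le_left hpos).1 h

theorem vec2_le_of_nonneg (hu0 : ∀ i, 0 ≤ u i) (hu1 : ∑ i, u i = n) : vec2 u ≤ n := by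
  refine (le_abs_self _).trans (abs_le_of_sq_le_sq ?_ (Nat.cast_nonneg n))
  rw [vec2_sq, ← hu1]
  exact Finset.sum_sq_le_sq_sum_of_nonneg fun i _ => hu0 i

variable [NeZero n]

theorem one_le_expect_spec2_drawQ : 1 ≤ expect R C fun d => spec2 (drawQ d) ^ 2 := by
  have h : ∑ d, drawProb R C d * 1 ≤ ∑ d, drawProb R C d * spec2 (drawQ d) ^ 2 :=
    sum_drawProb_le fun d _ => one_le_pow₀ (one_le_spec2_drawQ d)
  simp only [mul_one, sum_drawProb] at h
  exact h

/-- Jensen's inequality for the random number `uᵀ Q_k b` with `b` the mean of `Q_k u`: its mean is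
`‖b‖²`, so its mean square is at least `‖b‖⁴`. -/
theorem vec2_sq_le_spec2_second_moment (h0 : u ᵥ* expect R C drawQ ≠ 0) :
    vec2 (u ᵥ* expect R C drawQ) ^ 2 ≤
      spec2 (expect R C fun d => (drawQ d)ᵀ * vecMulVec u u * drawQ d) := by
  set b := u ᵥ* expect R C drawQ with hb
  have h1 : ∑ d, drawProb R C d * (u ⬝ᵥ (drawQ d *ᵥ b)) ^ 2 ≤
      spec2 (expect R C fun d => (drawQ d)ᵀ * vecMulVec u u * drawQ d) * vec2 b ^ 2 :=
    sum_sq_dotProduct_mulVec_le _ drawQ u b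
  have h2 : ∑ d, drawProb R C d * (u ⬝ᵥ (drawQ d *ᵥ b)) = vec2 b ^ 2 := by
    have : b ⬝ᵥ b = vec2 b ^ 2 := by
      rw [vec2_sq]
      exact Finset.sum_congr rfl fun i _ => by ring
    rw [← this]
    have h8 : b ⬝ᵥ b = u ⬝ᵥ (expect R C drawQ *ᵥ b) := by rw [dotProduct_mulVec]
    rw [h8, expect_mulVec]
    generalize b = b'
    simp only [expect, dotProduct_sum, dotProduct_smul, smul_eq_mul]
  have h3 : (vec2 b ^ 2) ^ 2 ≤ ∑ d, drawProb R C d * (u ⬝ᵥ (drawQ d *ᵥ b)) ^ 2 := by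
    set m := vec2 b ^ 2
    have h4 : 0 ≤ ∑ d, drawProb R C d * ((u ⬝ᵥ (drawQ d *ᵥ b)) - m) ^ 2 :=
      Finset.sum_nonneg fun d _ => mul_nonneg (drawProb_nonneg R C d) (sq_nonneg _)
    have h5 : ∑ d, drawProb R C d * ((u ⬝ᵥ (drawQ d *ᵥ b)) - m) ^ 2
        = ∑ d, drawProb R C d * (u ⬝ᵥ (drawQ d *ᵥ b)) ^ 2
          - 2 * m * ∑ d, drawProb R C d * (u ⬝ᵥ (drawQ d *ᵥ b))
          + m ^ 2 * ∑ d, drawProb R C d := by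
      simp only [Finset.mul_sum, ← Finset.sum_add_distrib, ← Finset.sum_sub_distrib]
      exact Finset.sum_congr rfl fun d _ => by ring
    rw [h5, h2, sum_drawProb] at h4
    linarith
  have h6 : 0 < vec2 b ^ 2 := pow_pos (vec2_pos h0) 2
  have h7 : vec2 b ^ 2 * vec2 b ^ 2 ≤
      spec2 (expect R C fun d => (drawQ d)ᵀ * vecMulVec u u * drawQ d) * vec2 b ^ 2 := by
    linarith
  exact le_of_mul_le_mul_right h7 h6

/-- The left Perron vector is nonnegative. -/
theorem perron_left_nonneg (hγ : γ ∈ Set.Ioo (0 : ℝ) 1)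
    (hS : IsScaledJordan (expect R C drawT) u S J) (hs : spec2 (shiftJ γ J) < 1)
    (hu : u ᵥ* expect R C (drawR γ) = u) (hu1 : ∑ i, u i = n) (i : Fin n) : 0 ≤ u i := by
  have hR0 : ∀ a b, 0 ≤ expect R C (drawR γ) a b := by
    intro a b
    simp only [expect, Matrix.sum_apply, Matrix.smul_apply, smul_eq_mul]
    exact Finset.sum_nonneg fun d _ =>
      mul_nonneg (drawProb_nonneg R C d) (drawR_nonneg hγ d a b)
  have hR1 : ∀ a, ∑ b, expect R C (drawR γ) a b = 1 := by
    intro a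
    have h1 : expect R C (drawR γ) *ᵥ (fun _ => 1) = fun _ => 1 := by
      rw [expect_drawR, add_mulVec, one_mulVec, smul_mulVec, expect_drawT_mulVec_const,
        smul_zero, add_zero]
    have := congrFun h1 a
    simpa [mulVec, dotProduct] using this
  -- The vector `|u|` is at most `|u|` times the mean matrix, with equal total mass since the rows
  -- sum to one, so it is also invariant. The left kernel is a line, hence `|u| = c u`, and
  -- comparing sums gives `c > 0`.
  set w : Fin n → ℝ := fun i => |u i| with hw
  have hle : ∀ b, w b ≤ (w ᵥ* expect R C (drawR γ)) b := by
    intro b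
    calc w b = |∑ a, u a * expect R C (drawR γ) a b| := by
          rw [hw]
          conv_lhs => rw [← hu]
          rfl
      _ ≤ ∑ a, |u a * expect R C (drawR γ) a b| := Finset.abs_sum_le_sum_abs _ _
      _ = _ := Finset.sum_congr rfl fun a _ => by rw [abs_mul, abs_of_nonneg (hR0 a b)]
  have hsum : ∑ b, (w ᵥ* expect R C (drawR γ)) b = ∑ b, w b := by
    simp only [vecMul, dotProduct]
    rw [Finset.sum_comm]
    simp only [← Finset.mul_sum, hR1, mul_one]
  have heq : w ᵥ* expect R C (drawR γ) = w := by
    ext b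
    have := (Finset.sum_eq_sum_iff_of_le fun b _ => hle b).1 hsum.symm b (Finset.mem_univ b)
    exact this.symm
  obtain ⟨c, hc⟩ := hS.exists_smul_of_vecMul_eq_zero hs
    (vecMul_expect_drawT_eq_zero hγ.1.ne' hu) (vecMul_expect_drawT_eq_zero hγ.1.ne' heq)
  have hre : ∀ i, w i = c.re * u i := by
    intro i
    have := congrArg Complex.re (congrFun hc i)
    simpa [cvec] using this
  have hn : (0 : ℝ) < n := Nat.cast_pos.2 (NeZero.pos n)
  have hc0 : 0 < c.re := by
    have h1 : ∑ i, w i = c.re * n := by rw [← hu1, Finset.mul_sum]; simp only [hre]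
    have h2 : (n : ℝ) ≤ ∑ i, w i := by
      rw [← hu1]
      exact Finset.sum_le_sum fun i _ => le_abs_self _
    rw [h1] at h2
    nlinarith
  have h3 : 0 ≤ c.re * u i := by
    rw [← hre]
    exact abs_nonneg _
  exact nonneg_of_mul_nonneg_right h3 hc0

/-- The conditioning of `D` controls the distance between `v` and the vector `1`. -/
theorem four_mul_vec2_sq_le (hD : IsScaledJordan (expect R C drawE) (fun _ => 1) D J)
    (hs : spec2 (shiftJ γ J) < 1) (hEv : expect R C drawE *ᵥ v = 0) (hv1 : ∑ i, v i = n)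
    (hD2 : ∀ z : Fin n → ℝ, vec2 z ≤ vecNorm τ D z)
    (hδ : ∀ z : Fin n → ℝ, vecNorm τ D z ≤ δ * vec2 z) :
    4 * vec2 v ^ 2 ≤ n * (δ ^ 2 + 3) := by
  have hDv : D *ᵥ cvec v = Pi.single 0 (n : ℂ) := by
    rw [hD.mulVec_eq_single hs hEv]
    congr 1
    rw [← Complex.ofReal_natCast, ← hv1]
    simp [dotProduct]
  set o : Fin n → ℝ := fun _ => 1
  have ho0 : (D *ᵥ cvec o) 0 = n := by
    rw [hD.mulVec_zero]
    simp [o, dotProduct]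
  -- In the coordinates of `D`, `v` is `n e_1` and `1` has top entry `n`, so `2 v - 1` is `1` with
  -- all other coordinates negated. Comparing with Euclidean norms gives `‖2 v - 1‖₂² ≤ δ² n`.
  have hrefl : vecNorm τ D ((2 : ℝ) • v - o) ^ 2 = vecNorm τ D o ^ 2 := by
    rw [sq_vecNorm_eq, sq_vecNorm_eq]
    congr 1
    refine Finset.sum_congr rfl fun i _ => ?_
    rw [cvec_sub, cvec_smul, mulVec_sub, mulVec_smul, hDv]
    by_cases hi : i = 0
    · subst hi
      simp only [Pi.sub_apply, Pi.smul_apply, ho0, Pi.single_eq_same, smul_eq_mul]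
      congr 2
      push_cast
      ring
    · simp [hi]
  have h1 := vec2_sq_le_vecNorm_sq hD2 ((2 : ℝ) • v - o)
  have hnn : 0 ≤ vecNorm τ D o := (vec2_nonneg _).trans (hD2 o)
  have h2 := pow_le_pow_left₀ hnn (hδ o) 2
  rw [hrefl] at h1
  have h3 := h1.trans h2
  rw [mul_pow, vec2_sq, vec2_sq] at h3
  have h4 : ∑ i, ((2 : ℝ) • v - o) i ^ 2 = 4 * vec2 v ^ 2 - 3 * n := by
    have : ∀ i, ((2 : ℝ) • v - o) i ^ 2 = 4 * v i ^ 2 - 4 * v i + 1 := by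
      intro i
      simp only [o, Pi.sub_apply, Pi.smul_apply, smul_eq_mul]
      ring
    simp only [this, Finset.sum_add_distrib, Finset.sum_sub_distrib, ← Finset.mul_sum, hv1,
      vec2_sq]
    simp
    ring
  have h5 : ∑ i, o i ^ 2 = (n : ℝ) := by simp [o]
  rw [h4, h5] at h3
  linarith

theorem card_le_vec2_sq (hv1 : ∑ i, v i = n) : (n : ℝ) ≤ vec2 v ^ 2 := by
  have hn : (0 : ℝ) < n := Nat.cast_pos.2 (NeZero.pos n)
  have h := sq_sum_le_card_mul_sum_sq (s := Finset.univ) (f := v)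
  rw [hv1, Finset.card_univ, Fintype.card_fin, ← vec2_sq] at h
  nlinarith

/-- The mean of `E_k` has trace at least `-1`; it is shared by `n - 1` diagonal entries. -/
theorem one_sub_le_spec2_shiftJ (hn : 2 ≤ n) (hγ : 0 ≤ γ)
    (hD : IsScaledJordan (expect R C drawE) (fun _ => 1) D J) :
    1 - γ / (n - 1) ≤ spec2 (shiftJ γ J) := by
  classical
  have h := hD.le_spec2_shiftJ γ
  have hn' : (2 : ℝ) ≤ n := by exact_mod_cast hn
  have hpos : (0 : ℝ) < n - 1 := by linarith
  rw [trace_expect_drawE] at h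
  have h1 : ∑ i, (if outNbr C i = ∅ then (0 : ℝ) else 1) ≤ n := by
    calc _ ≤ ∑ i : Fin n, (1 : ℝ) := Finset.sum_le_sum fun i _ => by split_ifs <;> norm_num
      _ = n := by simp
  have h2 : 1 / (n : ℝ) * ∑ i, (if outNbr C i = ∅ then (0 : ℝ) else 1) ≤ 1 := by
    rw [one_div_mul_eq_div, div_le_one (by linarith)]
    exact h1
  have h3 := mul_le_mul_of_nonneg_left h2 hγ
  have h4 : (n - 1 : ℝ) - γ ≤ (n - 1) * spec2 (shiftJ γ J) := by linarith
  rw [sub_le_iff_le_add, ← sub_le_iff_le_add', le_div_iff₀ hpos]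
  linarith

/-- A sink contributes nothing to the trace, which is then at least `-(n-1)/n`. -/
theorem one_sub_le_spec2_shiftJ_of_empty (hn : 2 ≤ n) (hγ : 0 ≤ γ)
    (hD : IsScaledJordan (expect R C drawE) (fun _ => 1) D J) {s : Fin n}
    (hs : outNbr C s = ∅) : 1 - γ / n ≤ spec2 (shiftJ γ J) := by
  classical
  have h := hD.le_spec2_shiftJ γ
  have hn' : (2 : ℝ) ≤ n := by exact_mod_cast hn
  have hpos : (0 : ℝ) < n - 1 := by linarith
  rw [trace_expect_drawE] at h
  have h1 : ∑ i, (if outNbr C i = ∅ then (0 : ℝ) else 1) ≤ n - 1 := by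
    calc _ ≤ ∑ i : Fin n, (if i = s then (0 : ℝ) else 1) := Finset.sum_le_sum fun i _ => by
          by_cases h : i = s
          · subst h
            simp [hs]
          · rw [if_neg h]
            split_ifs <;> norm_num
      _ = n - 1 := by
          have : ∀ i : Fin n, (if i = s then (0 : ℝ) else 1) = 1 - if i = s then 1 else 0 := by
            intro i
            split_ifs <;> norm_num
          simp only [this, Finset.sum_sub_distrib, Finset.sum_ite_eq', Finset.mem_univ, if_true]
          simp
  have h3 := mul_le_mul_of_nonneg_left h1 (show 0 ≤ γ * (1 / n) by positivity)
  have h4 : (n - 1 : ℝ) * (1 - γ / n) ≤ (n - 1) * spec2 (shiftJ γ J) := by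
    have e : (n - 1 : ℝ) * (1 - γ / n) = (n - 1 : ℝ) - γ * (1 / n) * (n - 1) := by ring
    rw [e]
    linarith
  exact le_of_mul_le_mul_left h4 hpos

/-- If every agent has an out-neighbour, the gossip noise in `y` is not small. -/
theorem two_mul_vec2_sq_le (hD : IsScaledJordan (expect R C drawE) (fun _ => 1) D J)
    (hs : spec2 (shiftJ γ J) < 1) (hEv : expect R C drawE *ᵥ v = 0) (hv1 : ∑ i, v i = n)
    (hD2 : ∀ z : Fin n → ℝ, vec2 z ≤ vecNorm τ D z)
    (hδ : ∀ z : Fin n → ℝ, vecNorm τ D z ≤ δ * vec2 z) (hout : ∀ i, outNbr C i ≠ ∅) :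
    2 * vec2 v ^ 2 ≤ n ^ 2 * (δ ^ 2 * spec2 (VE R C D)) := by
  have hn : (0 : ℝ) < n := Nat.cast_pos.2 (NeZero.pos n)
  have hDv : D *ᵥ cvec v = Pi.single 0 (n : ℂ) := by
    rw [hD.mulVec_eq_single hs hEv]
    congr 1
    rw [← Complex.ofReal_natCast, ← hv1]
    simp [dotProduct]
  set o : Fin n → ℝ := fun _ => 1
  -- Both vectors have top coordinate `n` under `D`, and `v` has no other.
  have hvo : vecNorm τ D v ^ 2 ≤ vecNorm τ D o ^ 2 := by
    rw [sq_vecNorm_eq, sq_vecNorm_eq, hDv]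
    refine mul_le_mul_of_nonneg_left ?_ (sq_nonneg τ)
    refine Finset.sum_le_sum fun i _ => ?_
    by_cases hi : i = 0
    · subst hi
      rw [hD.mulVec_zero]
      simp [o, dotProduct]
    · simp [hi]
  have ho : vecNorm τ D o ^ 2 ≤ δ ^ 2 * n := by
    have hnn : 0 ≤ vecNorm τ D o := (vec2_nonneg _).trans (hD2 o)
    have h2 := pow_le_pow_left₀ hnn (hδ o) 2
    rw [mul_pow, vec2_sq] at h2
    simpa [o] using h2
  have h1 := sum_vecNorm_sq_le_secondMoment (τ := τ) (R := R) (C := C) hD.isUnit_det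
    (fun d => centE R C d) v
  have h2 : 2 / n * vec2 v ^ 2 ≤
      ∑ d, drawProb R C d * vecNorm τ D (centE R C d *ᵥ v) ^ 2 := by
    rw [vec2_sq, ← sum_sq_drawE_mulVec (R := R) hout]
    refine Finset.sum_le_sum fun d _ => mul_le_mul_of_nonneg_left ?_ (drawProb_nonneg R C d)
    rw [centE, sub_mulVec, hEv, sub_zero, ← vec2_sq]
    exact vec2_sq_le_vecNorm_sq hD2 _
  have h3 : 2 / n * vec2 v ^ 2 ≤ spec2 (VE R C D) * (δ ^ 2 * n) :=
    (h2.trans h1).trans (mul_le_mul_of_nonneg_left (hvo.trans ho) (spec2_nonneg _))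
  rw [div_mul_eq_mul_div, div_le_iff₀ hn] at h3
  linarith

/-- The mean of `E_k` kills `e_s` for a sink `s`, and its kernel is a line, so `v = n e_s`. -/
theorem vec2_sq_eq_of_empty (hD : IsScaledJordan (expect R C drawE) (fun _ => 1) D J)
    (hs : spec2 (shiftJ γ J) < 1) (hEv : expect R C drawE *ᵥ v = 0) (hv1 : ∑ i, v i = n)
    {s : Fin n} (h : outNbr C s = ∅) : vec2 v ^ 2 = n ^ 2 := by
  have h1 : v = (n : ℝ) • unitVec s := by
    refine hD.eq_of_mulVec_eq_zero hs hEv ?_ ?_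
    · rw [mulVec_smul, expect_drawE_mulVec_unitVec h, smul_zero]
    · rw [dotProduct_smul]
      simp [dotProduct, hv1, unitVec]
  rw [h1, vec2_sq]
  simp only [Pi.smul_apply, smul_eq_mul, mul_pow, ← Finset.mul_sum]
  simp [unitVec, Pi.single_apply]

/-- Otherwise `Q_k e_i`, for a possible draw waking `i`, would be a constant vector, though it is
nonzero at `i` only. -/
theorem spec2_VQ_pos (hn : 2 ≤ n) (hS : IsUnit S.det) : 0 < spec2 (VQ R C u S) := by
  have hn' : (n : ℝ) ≠ 0 := Nat.cast_ne_zero.2 (NeZero.ne n)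
  refine lt_of_le_of_ne (spec2_nonneg _) fun h0 => ?_
  obtain ⟨d, hd⟩ : ∃ d, drawProb R C d ≠ 0 := by
    by_contra! hcon
    have := sum_drawProb R C
    simp [hcon] at this
  set z : Fin n → ℝ := unitVec d.1 with hz
  have h1 := sum_sq_le_secondMoment R C hS (fun d => projX u * drawQ d) z
  have h2 : spec2 (secondMoment R C S fun d => projX u * drawQ d) = 0 := h0.symm
  rw [h2, zero_mul] at h1
  have h3 := (Finset.sum_eq_zero_iff_of_nonneg fun d _ =>
    mul_nonneg (drawProb_nonneg R C d) (sq_nonneg _)).1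
    (le_antisymm h1 (Finset.sum_nonneg fun d _ =>
      mul_nonneg (drawProb_nonneg R C d) (sq_nonneg _))) d (Finset.mem_univ d)
  have h4 : S *ᵥ cvec ((projX u * drawQ d) *ᵥ z) = 0 := by
    simpa [hd] using h3
  have h5 : cvec ((projX u * drawQ d) *ᵥ z) = 0 := by
    have := congrArg (S⁻¹ *ᵥ ·) h4
    simpa only [mulVec_mulVec, nonsing_inv_mul _ hS, one_mulVec, mulVec_zero] using this
  have h6 : projX u *ᵥ (drawQVec d * z) = 0 := by
    rw [← drawQ_mulVec, mulVec_mulVec]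
    refine cvec_injective (h5.trans ?_)
    ext i
    simp [cvec]
  rw [projX_mulVec] at h6
  have : Nontrivial (Fin n) := Fin.nontrivial_iff_two_le.2 hn
  obtain ⟨j, hj⟩ := exists_ne d.1
  have h7 := congrFun h6 j
  have h8 := congrFun h6 d.1
  have h9 := one_le_drawQVec d
  simp only [Pi.sub_apply, Pi.mul_apply, Pi.zero_apply, hz, unitVec, Pi.single_eq_same,
    Pi.single_eq_of_ne hj, mul_zero, mul_one] at h7 h8
  linarith

end Constants

/-! ### The stepsize condition -/

section Stepsize

/-- The bound is the positive root of `a x² + b x = c` in rationalised form, which also covers `a =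
0`. -/
theorem quadratic_le_of_le_root {a b c x : ℝ} (ha : 0 ≤ a) (hb : 0 ≤ b) (hc : 0 < c)
    (hx : 0 < x) (h : x ≤ 2 * c / (b + √(b ^ 2 + 4 * a * c))) : a * x ^ 2 + b * x ≤ c := by
  set q := √(b ^ 2 + 4 * a * c) with hq
  have hq0 : 0 ≤ q := Real.sqrt_nonneg _
  have hq2 : q ^ 2 = b ^ 2 + 4 * a * c := Real.sq_sqrt (by positivity)
  have hpos : 0 < b + q := by
    rcases (add_nonneg hb hq0).eq_or_lt with h0 | h0
    · rw [← h0, div_zero] at h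
      linarith
    · exact h0
  rw [le_div_iff₀ hpos] at h
  have h1 : 2 * a * x ≤ q - b := by
    refine le_of_mul_le_mul_right ?_ hpos
    have := mul_le_mul_of_nonneg_left h (show 0 ≤ 2 * a by positivity)
    linarith
  have := mul_le_mul_of_nonneg_left h1 hx.le
  linarith

/-- Here `V = ‖v‖²`, `D = δ²`, `W = ‖V_E‖`. The mean contraction would prefer a large `g = γ/(N-1)`,
but the noise grows like `g²`. -/
theorem noise_bound_of_full {N V D σ W s γ : ℝ} (hN : 2 ≤ N) (hV : 0 < V) (hD : 0 < D)
    (hσ : σ = s ^ 2 + 2 * γ ^ 2 * W) (hσ1 : σ < 1) (hγ : γ ∈ Set.Ioo (0 : ℝ) 1)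
    (hs : 1 - γ / (N - 1) ≤ s) (hW : 2 * V ≤ N ^ 2 * (D * W)) :
    4 * (V * (1 - σ) ^ 2) ≤ D := by
  have hN1 : 0 < N - 1 := by linarith
  set g := γ / (N - 1) with hg
  have hγg : γ = g * (N - 1) := by rw [hg]; field_simp
  have hg1 : g ≤ 1 := by
    rw [hg, div_le_one hN1]
    linarith [hγ.2]
  have hs2 : (1 - g) ^ 2 ≤ s ^ 2 := pow_le_pow_left₀ (by linarith) hs 2
  have h1 : g ^ 2 * V ≤ 2 * γ ^ 2 * (D * W) := by
    have hN2 : N ^ 2 ≤ 4 * (N - 1) ^ 2 := by nlinarith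
    have hNp : 0 < N ^ 2 := by positivity
    have h2 : g ^ 2 * V * N ^ 2 ≤ 2 * γ ^ 2 * (D * W) * N ^ 2 := by
      have h3 := mul_le_mul_of_nonneg_left hW (show 0 ≤ 2 * γ ^ 2 by positivity)
      have h4 := mul_le_mul_of_nonneg_left hN2 (show 0 ≤ g ^ 2 * V by positivity)
      have h5 : γ ^ 2 = g ^ 2 * (N - 1) ^ 2 := by rw [hγg]; ring
      rw [h5] at h3 ⊢
      linarith
    exact le_of_mul_le_mul_right h2 hNp
  -- Maximising `(2g - g²) D - g² V` over `g` by completing the square gives `1 - σ ≤ D/(D + V)`;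
  -- then `4 D V ≤ (D + V)²` finishes.
  have h6 : (1 - σ) * (D + V) * D ≤ D * D := by
    have h7 : (1 - σ) * D ≤ (2 * g - g ^ 2) * D - g ^ 2 * V := by
      rw [hσ]
      nlinarith
    have h8 := mul_le_mul_of_nonneg_right h7 (show 0 ≤ D + V by positivity)
    nlinarith [sq_nonneg (D - g * (D + V))]
  have h9 : (1 - σ) * (D + V) ≤ D := le_of_mul_le_mul_right h6 hD
  have h10 : 0 ≤ (1 - σ) * (D + V) := mul_nonneg (by linarith) (by positivity)
  have h11 := pow_le_pow_left₀ h10 h9 2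
  have h12 : (1 - σ) ^ 2 * (4 * D * V) ≤ (1 - σ) ^ 2 * (D + V) ^ 2 :=
    mul_le_mul_of_nonneg_left (by nlinarith [sq_nonneg (D - V)]) (sq_nonneg _)
  have h13 : 4 * (V * (1 - σ) ^ 2) * D ≤ D * D := by nlinarith
  exact le_of_mul_le_mul_right h13 hD

/-- With `V = N²` the conditioning bound forces `D ≥ 4N - 3`, while `N² (1 - σ) ≤ 2N - 1` and `σ ≥
1/4`. The polynomial inequality left over is nearly sharp at `N = 2`. -/
theorem noise_bound_of_sink {N V D σ W s γ : ℝ} (hN : 2 ≤ N) (hV : V = N ^ 2)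
    (hVD : 4 * V ≤ N * (D + 3)) (hW : 0 ≤ W) (hσ : σ = s ^ 2 + 2 * γ ^ 2 * W) (hσ1 : σ < 1)
    (hγ : γ ∈ Set.Ioo (0 : ℝ) 1) (hs : 1 - γ / N ≤ s) :
    V * (1 - σ) ^ 2 ≤ 147 / 400 * (D * (1 + σ)) := by
  have hN0 : 0 < N := by linarith
  have hs1 : 1 - 1 / N ≤ s := by
    refine le_trans ?_ hs
    have : γ / N ≤ 1 / N := div_le_div_of_nonneg_right hγ.2.le hN0.le
    linarith
  have hN2 : 1 / N ≤ 1 / 2 := one_div_le_one_div_of_le two_pos hN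
  have hs2 : (1 - 1 / N) ^ 2 ≤ σ := by
    have h1 := pow_le_pow_left₀ (by linarith) hs1 2
    have h2 : 0 ≤ 2 * γ ^ 2 * W := by positivity
    linarith
  have hσ4 : 1 / 4 ≤ σ := by nlinarith
  have hD : 4 * N - 3 ≤ D := by
    rw [hV] at hVD
    have : N * (4 * N) ≤ N * (D + 3) := by linarith
    linarith [le_of_mul_le_mul_left this hN0]
  have hP : N ^ 2 * (1 - σ) ≤ 2 * N - 1 := by
    have h3 := mul_le_mul_of_nonneg_left hs2 (sq_nonneg N)
    have h4 : N ^ 2 * (1 - 1 / N) ^ 2 = (N - 1) ^ 2 := by field_simp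
    rw [h4] at h3
    nlinarith
  have hP0 : 0 ≤ N ^ 2 * (1 - σ) := mul_nonneg (sq_nonneg N) (by linarith)
  have h5 := pow_le_pow_left₀ hP0 hP 2
  have h6 : (2 * N - 1) ^ 2 ≤ 147 / 320 * (4 * N - 3) * N ^ 2 := by
    nlinarith [mul_nonneg (sub_nonneg.2 hN) (sq_nonneg N), mul_nonneg (sub_nonneg.2 hN) hN0.le]
  have h7 : 147 / 320 * (4 * N - 3) * N ^ 2 ≤ 147 / 400 * (D * (1 + σ)) * N ^ 2 := by
    refine mul_le_mul_of_nonneg_right ?_ (sq_nonneg N)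
    nlinarith
  have h8 : V * (1 - σ) ^ 2 * N ^ 2 ≤ 147 / 400 * (D * (1 + σ)) * N ^ 2 := by
    rw [hV]
    nlinarith
  exact le_of_mul_le_mul_right h8 (by positivity)

/-! ### Smallness of `α` extracted from single summands of `c₄` -/

section Bounds

variable {N μ L η α γ σ P V D K EQ ER d₁ d₂ d₃ d₆ d₇ vS : ℝ}

theorem tracking_stepsize_bound (hη : 0 < η) (hμ : 0 < μ) (hP : 0 < P)
    (h3 : 3 * P / 2 * (L ^ 4 * d₃ * d₇ / (η * μ)) * V * α ^ 2 ≤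
      1 / 32 * η * μ * P * (1 - σ)) :
    48 * (α ^ 2 * L ^ 4 * d₃) * (d₇ * V) ≤ η ^ 2 * μ ^ 2 * (1 - σ) := by
  have e : 3 * P / 2 * (L ^ 4 * d₃ * d₇ / (η * μ)) * V * α ^ 2
      = 48 * (α ^ 2 * L ^ 4 * d₃) * (d₇ * V) * (P / (32 * (η * μ))) := by
    field_simp
    ring
  have e' : 1 / 32 * η * μ * P * (1 - σ)
      = η ^ 2 * μ ^ 2 * (1 - σ) * (P / (32 * (η * μ))) := by
    field_simp
  rw [e, e'] at h3
  exact le_of_mul_le_mul_right h3 (by positivity)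

theorem tracking_stepsize_bound_sq (hσ0 : 0 < σ) (hσ1 : σ < 1) (hV : 0 < V) (hD : 0 < D)
    (hK : 1 ≤ K) (hEQ : 1 ≤ EQ) (hd₇ : 0 < d₇)
    (hd₃ : d₃ = 4 * D * ((1 + σ) / (1 - σ)) * K * EQ)
    (h : 48 * (α ^ 2 * L ^ 4 * d₃) * (d₇ * V) ≤ η ^ 2 * μ ^ 2 * (1 - σ)) :
    192 * (α ^ 2 * L ^ 4 * (D * (1 + σ) * EQ)) * (d₇ * V) ≤ η ^ 2 * μ ^ 2 * (1 - σ) ^ 2 := by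
  have hP2 : 0 < 1 - σ := by linarith
  have hd3 : d₃ * (1 - σ) = 4 * (D * (1 + σ) * K * EQ) := by
    rw [hd₃]
    field_simp
  have hEQ0 : 0 < EQ := by linarith
  have t1 := mul_le_mul_of_nonneg_right h hP2.le
  have t2 : D * (1 + σ) * EQ ≤ D * (1 + σ) * K * EQ :=
    mul_le_mul_of_nonneg_right (le_mul_of_one_le_right (by positivity) hK) hEQ0.le
  have t3 := mul_le_mul_of_nonneg_left t2
    (show 0 ≤ 192 * (α ^ 2 * L ^ 4) * (d₇ * V) by positivity)
  have t4 : 48 * (α ^ 2 * L ^ 4 * d₃) * (d₇ * V) * (1 - σ)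
      = 192 * (α ^ 2 * L ^ 4) * (d₇ * V) * (D * (1 + σ) * K * EQ) := by
    linear_combination 48 * α ^ 2 * L ^ 4 * (d₇ * V) * hd3
  calc 192 * (α ^ 2 * L ^ 4 * (D * (1 + σ) * EQ)) * (d₇ * V)
      = 192 * (α ^ 2 * L ^ 4) * (d₇ * V) * (D * (1 + σ) * EQ) := by ring
    _ ≤ _ := t3
    _ = _ := t4.symm
    _ ≤ _ := t1
    _ = _ := by ring

/-- Keeps the noise in the average below the gain `αημ`. The constant `147/400` is chosen for `4/3 ·
147/400 = (7/10)²`. -/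
theorem optimality_stepsize_bound (hη : 0 < η) (hμ : 0 < μ) (hσ0 : 0 < σ) (hV : 0 < V)
    (hD : 0 < D) (hEQ : 1 ≤ EQ) (hd₇ : 0 < d₇) (hd₁ : d₁ ^ 2 ≤ 64 * d₇)
    (hnoise : V * (1 - σ) ^ 2 ≤ 147 / 400 * (D * (1 + σ)))
    (h : 192 * (α ^ 2 * L ^ 4 * (D * (1 + σ) * EQ)) * (d₇ * V) ≤
      η ^ 2 * μ ^ 2 * (1 - σ) ^ 2) :
    2 * α * L ^ 2 * V * d₁ ≤ 7 / 10 * (η * μ) := by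
  refine (le_abs_self _).trans (abs_le_of_sq_le_sq ?_ (by positivity))
  have hDσ : 0 < D * (1 + σ) := by positivity
  refine le_of_mul_le_mul_right ?_ hDσ
  have h' : 192 * (α ^ 2 * L ^ 4 * (D * (1 + σ))) * (d₇ * V) ≤
      η ^ 2 * μ ^ 2 * (1 - σ) ^ 2 := by
    refine le_trans ?_ h
    have := mul_le_mul_of_nonneg_left (le_mul_of_one_le_right hDσ.le hEQ)
      (show 0 ≤ 192 * (α ^ 2 * L ^ 4) * (d₇ * V) by positivity)
    linarith
  have g₁ := mul_le_mul_of_nonneg_left hd₁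
    (show 0 ≤ 4 * α ^ 2 * L ^ 4 * V ^ 2 * (D * (1 + σ)) by positivity)
  have g₂ := mul_le_mul_of_nonneg_left h' (show 0 ≤ 4 / 3 * V by positivity)
  have g₃ := mul_le_mul_of_nonneg_left hnoise (show 0 ≤ 4 / 3 * (η ^ 2 * μ ^ 2) by positivity)
  calc (2 * α * L ^ 2 * V * d₁) ^ 2 * (D * (1 + σ))
      = 4 * α ^ 2 * L ^ 4 * V ^ 2 * (D * (1 + σ)) * d₁ ^ 2 := by ring
    _ ≤ 4 * α ^ 2 * L ^ 4 * V ^ 2 * (D * (1 + σ)) * (64 * d₇) := g₁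
    _ = 4 / 3 * V * (192 * (α ^ 2 * L ^ 4 * (D * (1 + σ))) * (d₇ * V)) := by ring
    _ ≤ 4 / 3 * V * (η ^ 2 * μ ^ 2 * (1 - σ) ^ 2) := g₂
    _ = 4 / 3 * (η ^ 2 * μ ^ 2) * (V * (1 - σ) ^ 2) := by ring
    _ ≤ 4 / 3 * (η ^ 2 * μ ^ 2) * (147 / 400 * (D * (1 + σ))) := g₃
    _ = _ := by ring

theorem stepsize_mul_d₁_le (hη : 0 < η) (hμ : 0 < μ) (hL : 0 < L) (hV : 0 < V) (hd₇ : 0 < d₇)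
    (hηL : η ^ 2 * μ ^ 2 ≤ d₇ * V * L ^ 2)
    (h : 2 * α * L ^ 2 * V * d₁ ≤ 7 / 10 * (η * μ)) : α * η * μ * d₁ ≤ d₇ := by
  have hLV : 0 < L ^ 2 * V := by positivity
  refine le_of_mul_le_mul_right ?_ hLV
  have t1 := mul_le_mul_of_nonneg_right h (show 0 ≤ η * μ by positivity)
  have t2 : 0 < d₇ * V * L ^ 2 := by positivity
  have e : α * η * μ * d₁ * (L ^ 2 * V) = 1 / 2 * (2 * α * L ^ 2 * V * d₁ * (η * μ)) := by ring
  have e' : 7 / 10 * (η * μ) * (η * μ) = 7 / 10 * (η ^ 2 * μ ^ 2) := by ring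
  have e'' : d₇ * (L ^ 2 * V) = d₇ * V * L ^ 2 := by ring
  rw [e, e'']
  rw [e'] at t1
  linarith

/-- Makes the effective stepsize `αη` admissible for the gradient step contraction. -/
theorem stepsize_mul_lipschitz_le (hη : 0 < η) (hμL : μ ≤ L) (hL : 0 < L) (hα : 0 < α)
    (hV : 0 < V) (hd₁₇ : 4 * d₇ ≤ d₁) (hη7 : η ^ 2 ≤ d₇ * V)
    (h : 2 * α * L ^ 2 * V * d₁ ≤ 7 / 10 * (η * μ)) : α * η * L ≤ 1 / 2 := by
  have t1 := mul_le_mul_of_nonneg_left hd₁₇ (show 0 ≤ 2 * α * L ^ 2 * V by positivity)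
  have t2 := mul_le_mul_of_nonneg_left hη7 (show 0 ≤ 8 * α * L ^ 2 by positivity)
  have t3 := mul_le_mul_of_nonneg_left hμL hη.le
  have t4 : (8 * (α * η * L)) * (η * L) ≤ 7 / 10 * (η * L) := by
    have e : (8 * (α * η * L)) * (η * L) = 8 * α * L ^ 2 * η ^ 2 := by ring
    have e' : 8 * α * L ^ 2 * (d₇ * V) = 2 * α * L ^ 2 * V * (4 * d₇) := by ring
    rw [e]
    linarith
  have t5 := le_of_mul_le_mul_right t4 (show 0 < η * L by positivity)
  linarith

/-- `d₃` and `d₆` share all factors but `4 EQ` and `ER`. The stepsize bound makes `α²` of order `(1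
- σ)²`, which is at most `16 γ²/N²`, while `ER ≥ γ²/N`. -/
theorem tracking_term_le_d₆ (hN : 2 ≤ N) (hL : 0 < L) (hσ0 : 0 < σ) (hσ1 : σ < 1)
    (hV : 0 < V) (hD : 0 < D) (hK : 1 ≤ K) (hEQ : 1 ≤ EQ) (hER : γ ^ 2 / N ≤ ER)
    (hd₇ : 0 < d₇)
    (hd₃ : d₃ = 4 * D * ((1 + σ) / (1 - σ)) * K * EQ)
    (hd₆ : d₆ = D * ((1 + σ) / (1 - σ)) * K * ER)
    (hVD : V ≤ N * D) (hσγ : N * (1 - σ) ≤ 4 * γ)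
    (hηL : η ^ 2 * μ ^ 2 ≤ d₇ * V * L ^ 2)
    (h : 192 * (α ^ 2 * L ^ 4 * (D * (1 + σ) * EQ)) * (d₇ * V) ≤
      η ^ 2 * μ ^ 2 * (1 - σ) ^ 2) :
    α ^ 2 * L ^ 2 * d₃ * V ≤ 2 * d₆ := by
  have hP2 : 0 < 1 - σ := by linarith
  have hN0 : 0 < N := by linarith
  have hEQ0 : 0 < EQ := by linarith
  have hK0 : 0 < K := by linarith
  have t1 : 192 * (α ^ 2 * L ^ 2 * D * EQ) ≤ (1 - σ) ^ 2 := by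
    have hc : 0 < L ^ 2 * (d₇ * V) := by positivity
    refine le_of_mul_le_mul_right ?_ hc
    have g₁ := mul_le_mul_of_nonneg_left (show 1 ≤ 1 + σ by linarith)
      (show 0 ≤ 192 * (α ^ 2 * L ^ 4 * D * EQ) * (d₇ * V) by positivity)
    have g₂ := mul_le_mul_of_nonneg_right hηL (sq_nonneg (1 - σ))
    linarith
  have t3 := mul_le_mul_of_nonneg_left hVD (show 0 ≤ α ^ 2 * L ^ 2 * EQ by positivity)
  have t4 : (N * (1 - σ)) ^ 2 ≤ (4 * γ) ^ 2 := pow_le_pow_left₀ (by positivity) hσγ 2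
  have t5 : N * (α ^ 2 * L ^ 2 * D * EQ) * 4 ≤ 2 * (γ ^ 2 / N) := by
    rw [mul_div_assoc', le_div_iff₀ hN0]
    have := mul_le_mul_of_nonneg_left t1 (show 0 ≤ N ^ 2 by positivity)
    linarith [sq_nonneg γ]
  have t2 : α ^ 2 * L ^ 2 * EQ * V * 4 ≤ 2 * ER := by linarith
  have t6 := mul_le_mul_of_nonneg_left t2
    (show 0 ≤ D * ((1 + σ) / (1 - σ)) * K by positivity)
  rw [hd₃, hd₆]
  linarith

theorem tracking_term_le (hL : 0 < L) (hσ1 : σ < 1) (hV : 0 < V) (hd₇ : 0 < d₇)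
    (hηL : η ^ 2 * μ ^ 2 ≤ d₇ * V * L ^ 2)
    (h : 48 * (α ^ 2 * L ^ 4 * d₃) * (d₇ * V) ≤ η ^ 2 * μ ^ 2 * (1 - σ)) :
    48 * (α ^ 2 * L ^ 2 * d₃) ≤ 1 - σ := by
  have hc : 0 < L ^ 2 * (d₇ * V) := by positivity
  refine le_of_mul_le_mul_right ?_ hc
  have g := mul_le_mul_of_nonneg_right hηL (show 0 ≤ 1 - σ by linarith)
  linarith

theorem consensus_term_le (hN : 0 < N) (hμ : 0 < μ) (hμL : μ ≤ L) (hη : 0 < η) (hσ1 : σ < 1)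
    (hP : 0 < P)
    (h : 3 * (1 - σ) / 4 * (η * L ^ 4 * d₂ / (μ * N)) * vS ^ 2 * α ^ 2 ≤
      1 / 32 * η * μ * P * (1 - σ)) :
    24 * (α ^ 2 * L ^ 2 * d₂ * vS ^ 2 / N) ≤ P := by
  have hL : 0 < L := hμ.trans_le hμL
  have hP2 : 0 < 1 - σ := by linarith
  have e : 3 * (1 - σ) / 4 * (η * L ^ 4 * d₂ / (μ * N)) * vS ^ 2 * α ^ 2
      = 24 * (α ^ 2 * L ^ 2 * d₂ * vS ^ 2 / N) * L ^ 2 * ((1 - σ) * η / (32 * μ)) := by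
    field_simp
    ring
  have e' : 1 / 32 * η * μ * P * (1 - σ) = P * μ ^ 2 * ((1 - σ) * η / (32 * μ)) := by
    field_simp
  rw [e, e'] at h
  have t1 := le_of_mul_le_mul_right h (show 0 < (1 - σ) * η / (32 * μ) by positivity)
  have t2 := mul_le_mul_of_nonneg_left (pow_le_pow_left₀ hμ.le hμL 2) hP.le
  exact le_of_mul_le_mul_right (t1.trans t2) (by positivity)

end Bounds

/-- The `A_i` are `1 - b_ii`. After the entries are replaced by simpler bounds, the negative terms
of the determinant are at most `2α` times the quadratic in `hc` with its `γ²` term moved to the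
left. -/
theorem transition_det_pos {N μ L η α γ P₁ P₂ V d₁ d₂ d₃ d₄ d₅ d₆ d₇ δ vS A₁ A₂ A₃ b₁₂ b₁₃ b₂₁
      b₂₃ b₃₁ b₃₂ : ℝ}
    (hN : 2 ≤ N) (hμ : 0 < μ) (hμL : μ ≤ L) (hη : 0 < η) (hα : 0 < α)
    (hP₁ : 0 < P₁) (hP₂ : 0 < P₂) (hV : 0 < V) (hd₁ : 0 ≤ d₁) (hd₂ : 0 ≤ d₂) (hd₃ : 0 ≤ d₃)
    (hd₄ : 0 ≤ d₄) (hd₅ : 0 ≤ d₅) (hd₆ : 0 ≤ d₆) (hd₇ : 0 ≤ d₇)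
    (s₁ : 2 * α * L ^ 2 * V * d₁ ≤ 7 / 10 * (η * μ)) (s₂ : α * η * μ * d₁ ≤ d₇)
    (s₃ : α ^ 2 * L ^ 2 * d₃ * V ≤ 2 * d₆) (s₄ : 48 * (α ^ 2 * L ^ 2 * d₃) ≤ P₂)
    (s₅ : 24 * (α ^ 2 * L ^ 2 * d₂ * vS ^ 2 / N) ≤ P₁)
    (hc : (6 * η * L ^ 4 / (μ * N) * d₂ * δ ^ 2 * (d₆ + γ ^ 2 * d₄)
      + 6 * L ^ 4 / (η * μ) * d₂ * d₇ * vS ^ 2 * (2 * d₆ + γ ^ 2 * d₄)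
      + 3 * P₁ / 2 * (L ^ 4 * d₃ * d₇ / (η * μ)) * V
      + η * μ * L ^ 2 * d₂ * δ ^ 2 * (2 * d₆ + γ ^ 2 * d₄)
      + 3 * P₂ / 4 * (η * L ^ 4 * d₂ / (μ * N)) * vS ^ 2) * α ^ 2
      + (2 * L ^ 2 * d₂ * d₅ * δ ^ 2 * (d₆ + γ ^ 2 * d₄) + P₂ / 4 * L ^ 2 * d₂ * d₅ * vS ^ 2) * α
      ≤ 1 / 32 * η * μ * P₁ * P₂ - 3 * P₁ / 2 * (L ^ 2 * d₄ * d₇ / (η * μ)) * γ ^ 2)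
    (hA₁ : A₁ = α * η * μ - 2 * α ^ 2 * L ^ 2 * V * d₁)
    (hA₂ : A₂ = P₁ / 2 - α ^ 2 * L ^ 2 * d₂ * vS ^ 2 / N)
    (hA₃ : A₃ = P₂ / 2 - α ^ 2 * L ^ 2 * d₃)
    (hb₁₂ : b₁₂ = 2 * α * η * L ^ 2 / (μ * N) + 2 * α ^ 2 * L ^ 2 * V * d₁ / N + d₅)
    (hb₁₃ : b₁₃ = 2 * α * d₇ / (η * μ) + α ^ 2 * d₁)
    (hb₂₁ : b₂₁ = α ^ 2 * L ^ 2 * d₂ * vS ^ 2) (hb₂₃ : b₂₃ = α ^ 2 * d₂ * δ ^ 2)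
    (hb₃₁ : b₃₁ = 2 * L ^ 2 * (γ ^ 2 * d₄ + α ^ 2 * L ^ 2 * d₃ * V))
    (hb₃₂ : b₃₂ = 2 * L ^ 2 * (d₆ + α ^ 2 * L ^ 2 * d₃ * V / N + γ ^ 2 * d₄ / N)) :
    0 < A₁ ∧ 0 < A₂ ∧ 0 < A₃ ∧
      0 < A₁ * A₂ * A₃ - b₁₂ * b₂₃ * b₃₁ - b₁₃ * b₂₁ * b₃₂ - b₁₃ * b₃₁ * A₂ - b₁₂ * b₂₁ * A₃
        - b₂₃ * b₃₂ * A₁ := by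
  have hL : 0 < L := hμ.trans_le hμL
  have hN0 : 0 < N := by linarith
  have hμL2 : μ ^ 2 ≤ L ^ 2 := pow_le_pow_left₀ hμ.le hμL 2
  have lA₁ : 3 / 10 * (α * η * μ) ≤ A₁ := by
    have := mul_le_mul_of_nonneg_left s₁ hα.le
    rw [hA₁]
    linarith
  have lA₂ : 11 / 24 * P₁ ≤ A₂ := by rw [hA₂]; linarith
  have lA₃ : 23 / 48 * P₂ ≤ A₃ := by rw [hA₃]; linarith
  have hαημ : 0 < α * η * μ := by positivity
  have pA₁ : 0 < A₁ := by linarith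
  have pA₂ : 0 < A₂ := by linarith
  have pA₃ : 0 < A₃ := by linarith
  have uA₁ : A₁ ≤ α * η * μ := by
    have : 0 ≤ 2 * α ^ 2 * L ^ 2 * V * d₁ := by positivity
    linarith
  have uA₂ : A₂ ≤ P₁ / 2 := by
    have : 0 ≤ α ^ 2 * L ^ 2 * d₂ * vS ^ 2 / N := by positivity
    linarith
  have uA₃ : A₃ ≤ P₂ / 2 := by
    have : 0 ≤ α ^ 2 * L ^ 2 * d₃ := by positivity
    linarith
  have n₂₁ : 0 ≤ b₂₁ := by rw [hb₂₁]; positivity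
  have n₂₃ : 0 ≤ b₂₃ := by rw [hb₂₃]; positivity
  have n₃₁ : 0 ≤ b₃₁ := by rw [hb₃₁]; positivity
  have n₃₂ : 0 ≤ b₃₂ := by rw [hb₃₂]; positivity
  have n₁₂ : 0 ≤ b₁₂ := by rw [hb₁₂]; positivity
  have n₁₃ : 0 ≤ b₁₃ := by rw [hb₁₃]; positivity
  have u₁₂ : b₁₂ ≤ 3 * α * η * L ^ 2 / (μ * N) + d₅ := by
    have t1 : 2 * α ^ 2 * L ^ 2 * V * d₁ / N ≤ α * η * L ^ 2 / (μ * N) := by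
      rw [div_le_div_iff₀ hN0 (by positivity)]
      have t2 := mul_le_mul_of_nonneg_left s₁ (show 0 ≤ α * (μ * N) by positivity)
      have t3 := mul_le_mul_of_nonneg_left hμL2 (show 0 ≤ α * η * N by positivity)
      have t4 : 0 ≤ α * η * N * μ ^ 2 := by positivity
      linarith
    have e : 3 * α * η * L ^ 2 / (μ * N)
        = 2 * α * η * L ^ 2 / (μ * N) + α * η * L ^ 2 / (μ * N) := by ring
    rw [hb₁₂, e]
    linarith
  have u₁₃ : b₁₃ ≤ 3 * α * d₇ / (η * μ) := by
    have t1 : α ^ 2 * d₁ ≤ α * d₇ / (η * μ) := by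
      rw [le_div_iff₀ (by positivity)]
      have := mul_le_mul_of_nonneg_left s₂ hα.le
      linarith
    have e : 3 * α * d₇ / (η * μ) = 2 * α * d₇ / (η * μ) + α * d₇ / (η * μ) := by ring
    rw [hb₁₃, e]
    linarith
  have hg : 0 ≤ γ ^ 2 * d₄ := by positivity
  have u₃₁ : b₃₁ ≤ 4 * L ^ 2 * (d₆ + γ ^ 2 * d₄) := by
    rw [hb₃₁]
    have : γ ^ 2 * d₄ + α ^ 2 * L ^ 2 * d₃ * V ≤ 2 * (d₆ + γ ^ 2 * d₄) := by linarith
    have := mul_le_mul_of_nonneg_left this (show 0 ≤ 2 * L ^ 2 by positivity)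
    linarith
  have u₃₂ : b₃₂ ≤ 2 * L ^ 2 * (2 * d₆ + γ ^ 2 * d₄) := by
    rw [hb₃₂]
    refine mul_le_mul_of_nonneg_left ?_ (by positivity)
    have t1 : α ^ 2 * L ^ 2 * d₃ * V / N ≤ d₆ := by
      rw [div_le_iff₀ hN0]
      linarith [mul_le_mul_of_nonneg_left hN hd₆]
    have t2 : γ ^ 2 * d₄ / N ≤ γ ^ 2 * d₄ := div_le_self hg (by linarith)
    linarith
  have m₁ : b₁₂ * b₂₃ * b₃₁ ≤ (3 * α * η * L ^ 2 / (μ * N) + d₅) * b₂₃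
      * (4 * L ^ 2 * (d₆ + γ ^ 2 * d₄)) := by gcongr
  have m₂ : b₁₃ * b₂₁ * b₃₂ ≤ (3 * α * d₇ / (η * μ)) * b₂₁
      * (2 * L ^ 2 * (2 * d₆ + γ ^ 2 * d₄)) := by gcongr
  have m₃ : b₁₃ * b₃₁ * A₂ ≤ (3 * α * d₇ / (η * μ)) * b₃₁ * (P₁ / 2) := by gcongr
  have m₄ : b₁₂ * b₂₁ * A₃ ≤ (3 * α * η * L ^ 2 / (μ * N) + d₅) * b₂₁ * (P₂ / 2) := by gcongr
  have m₅ : b₂₃ * b₃₂ * A₁ ≤ b₂₃ * (2 * L ^ 2 * (2 * d₆ + γ ^ 2 * d₄)) * (α * η * μ) := by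
    gcongr
  -- The product of the three fractions exceeds `1/16 = 2 · 1/32`, which makes the final inequality
  -- strict.
  have m₀ : 3 / 10 * (α * η * μ) * (11 / 24 * P₁) * (23 / 48 * P₂) ≤ A₁ * A₂ * A₃ := by gcongr
  -- The second summand of `c₄` is twice what the term `b₁₃ b₂₁ b₃₂` requires.
  have slack : 0 ≤ 6 * L ^ 4 / (η * μ) * d₂ * d₇ * vS ^ 2 * (2 * d₆ + γ ^ 2 * d₄) * α ^ 3 := by
    positivity
  have total : (3 * α * η * L ^ 2 / (μ * N) + d₅) * b₂₃ * (4 * L ^ 2 * (d₆ + γ ^ 2 * d₄))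
      + (3 * α * d₇ / (η * μ)) * b₂₁ * (2 * L ^ 2 * (2 * d₆ + γ ^ 2 * d₄))
      + (3 * α * d₇ / (η * μ)) * b₃₁ * (P₁ / 2)
      + (3 * α * η * L ^ 2 / (μ * N) + d₅) * b₂₁ * (P₂ / 2)
      + b₂₃ * (2 * L ^ 2 * (2 * d₆ + γ ^ 2 * d₄)) * (α * η * μ)
      + 6 * L ^ 4 / (η * μ) * d₂ * d₇ * vS ^ 2 * (2 * d₆ + γ ^ 2 * d₄) * α ^ 3
      = 2 * α * ((6 * η * L ^ 4 / (μ * N) * d₂ * δ ^ 2 * (d₆ + γ ^ 2 * d₄)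
      + 6 * L ^ 4 / (η * μ) * d₂ * d₇ * vS ^ 2 * (2 * d₆ + γ ^ 2 * d₄)
      + 3 * P₁ / 2 * (L ^ 4 * d₃ * d₇ / (η * μ)) * V
      + η * μ * L ^ 2 * d₂ * δ ^ 2 * (2 * d₆ + γ ^ 2 * d₄)
      + 3 * P₂ / 4 * (η * L ^ 4 * d₂ / (μ * N)) * vS ^ 2) * α ^ 2
      + (2 * L ^ 2 * d₂ * d₅ * δ ^ 2 * (d₆ + γ ^ 2 * d₄) + P₂ / 4 * L ^ 2 * d₂ * d₅ * vS ^ 2) * α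
      + 3 * P₁ / 2 * (L ^ 2 * d₄ * d₇ / (η * μ)) * γ ^ 2) := by
    rw [hb₂₃, hb₂₁, hb₃₁]
    field_simp
    ring
  have hfin := mul_le_mul_of_nonneg_left hc (show 0 ≤ 2 * α by positivity)
  have hpp : 0 < α * η * μ * P₁ * P₂ := by positivity
  refine ⟨pA₁, pA₂, pA₃, ?_⟩
  linarith

end Stepsize

/-! ### The recursion of the mean square errors -/

section Recursion

variable {n p : ℕ} {R C : Matrix (Fin n) (Fin n) ℝ} {u v : Fin n → ℝ}
  {f : Fin n → EuclideanSpace ℝ (Fin p) → ℝ} {μ L γ α : ℝ} {xs : EuclideanSpace ℝ (Fin p)}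
  {S D J J' : Matrix (Fin n) (Fin n) ℂ} {τ τ' : ℝ}

theorem wavg_one_iter (x₀ : Stack n p) (s : ℕ → Draw n) (k : ℕ) :
    wavg (fun _ => 1) (iter γ α f x₀ s k).2
      = wavg (fun _ => 1) (gradStack f (iter γ α f x₀ s k).1) := by
  induction k with
  | zero => rfl
  | succ k ih => exact wavg_one_nextY ih (s k)

variable {Ω : Type*} [MeasurableSpace Ω] {P : Measure Ω} [IsProbabilityMeasure P]
  {ξ : ℕ → Ω → Draw n}

/-- A one-step inequality for the conditional means gives one for the means. -/
theorem integral_iter_succ_le (hξm : ∀ k, Measurable (ξ k)) (hξi : iIndepFun ξ P)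
    (hξ : ∀ k d, P.real (ξ k ⁻¹' {d}) = drawProb R C d) (x₀ : Stack n p)
    (φ φ₁ φ₂ φ₃ : Stack n p → Stack n p → ℝ) {b₁ b₂ b₃ : ℝ}
    (h : ∀ x y, wavg (fun _ => 1) y = wavg (fun _ => 1) (gradStack f x) →
      ∑ d, drawProb R C d * φ (nextX γ α x y d) (nextY γ α f x y d) ≤
        b₁ * φ₁ x y + b₂ * φ₂ x y + b₃ * φ₃ x y) (k : ℕ) :
    ∫ ω, φ (iter γ α f x₀ (fun m => ξ m ω) (k + 1)).1 (iter γ α f x₀ (fun m => ξ m ω) (k + 1)).2 ∂P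
      ≤ b₁ * ∫ ω, φ₁ (iter γ α f x₀ (fun m => ξ m ω) k).1 (iter γ α f x₀ (fun m => ξ m ω) k).2 ∂P
      + b₂ * ∫ ω, φ₂ (iter γ α f x₀ (fun m => ξ m ω) k).1 (iter γ α f x₀ (fun m => ξ m ω) k).2 ∂P
      + b₃ * ∫ ω, φ₃ (iter γ α f x₀ (fun m => ξ m ω) k).1
        (iter γ α f x₀ (fun m => ξ m ω) k).2 ∂P := by
  have hint : ∀ χ : Stack n p → Stack n p → ℝ, Integrable (fun ω =>
      χ (iter γ α f x₀ (fun m => ξ m ω) k).1 (iter γ α f x₀ (fun m => ξ m ω) k).2) P :=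
    fun χ => integrable_of_past (ψ := fun s => χ (iter γ α f x₀ s k).1 (iter γ α f x₀ s k).2)
      hξm (k := k) fun s s' hs => by rw [iter_congr hs]
  have hdraw := integral_draw (P := P) R C hξm hξi hξ (k := k)
    (ψ := fun s d => φ (nextX γ α (iter γ α f x₀ s k).1 (iter γ α f x₀ s k).2 d)
      (nextY γ α f (iter γ α f x₀ s k).1 (iter γ α f x₀ s k).2 d))
    fun s s' d hs => by rw [iter_congr hs]
  refine le_of_eq_of_le hdraw ?_
  rw [← integral_const_mul, ← integral_const_mul, ← integral_const_mul,
    ← integral_add ((hint φ₁).const_mul b₁) ((hint φ₂).const_mul b₂),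
    ← integral_add (hint fun x y => b₁ * φ₁ x y + b₂ * φ₂ x y)
      ((hint φ₃).const_mul b₃)]
  refine integral_mono (hint fun x y =>
    ∑ d, drawProb R C d * φ (nextX γ α x y d) (nextY γ α f x y d))
    ((((hint φ₁).const_mul b₁).add ((hint φ₂).const_mul b₂)).add ((hint φ₃).const_mul b₃))
    fun ω => ?_
  exact h _ _ (wavg_one_iter x₀ _ k)

variable [NeZero n]

theorem optimality_recursion (hdiff : ∀ i, Differentiable ℝ (f i))
    (hconv : ∀ i x x', μ * ‖x - x'‖ ^ 2 ≤
      inner ℝ (gradient (f i) x - gradient (f i) x') (x - x'))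
    (hlip : ∀ i x x', ‖gradient (f i) x - gradient (f i) x'‖ ≤ L * ‖x - x'‖)
    (hxs : IsMinOn (fun x => ∑ i, f i x) Set.univ xs)
    (huT : u ᵥ* expect R C drawT = 0)
    (hS2 : ∀ z : Fin n → ℝ, vec2 z ≤ vecNorm τ S z)
    (hD2 : ∀ z : Fin n → ℝ, vec2 z ≤ vecNorm τ' D z) {η d₁ d₅ d₇ : ℝ}
    (hη : η = u ⬝ᵥ (expect R C drawQ *ᵥ v) / n)
    (hd₁ : d₁ = 4 * spec2 (expect R C fun d => (drawQ d)ᵀ * vecMulVec u u * drawQ d) / n ^ 2)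
    (hd₅ : d₅ = 2 * spec2 (expect R C fun d =>
      (γ • centT R C d)ᵀ * vecMulVec u u * (γ • centT R C d)) / n ^ 2)
    (hd₇ : d₇ = vec2 (u ᵥ* expect R C drawQ) ^ 2 / n ^ 2)
    (hμ : 0 < μ) (hη0 : 0 < η) (hα : 0 < α)
    (hα1 : α * η * μ < 1) (hαL : α * η * L ≤ 1) {x y : Stack n p}
    (hy : wavg (fun _ => 1) y = wavg (fun _ => 1) (gradStack f x)) :
    ∑ d, drawProb R C d * ‖wavg u (nextX γ α x y d) - xs‖ ^ 2 ≤
      (1 - α * η * μ + 2 * α ^ 2 * L ^ 2 * vec2 v ^ 2 * d₁) * ‖wavg u x - xs‖ ^ 2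
      + (2 * α * η * L ^ 2 / (μ * n) + 2 * α ^ 2 * L ^ 2 * vec2 v ^ 2 * d₁ / n + d₅)
        * stackNorm (vecNorm τ S) (devX u x) ^ 2
      + (2 * α * d₇ / (η * μ) + α ^ 2 * d₁) * stackNorm (vecNorm τ' D) (devY v y) ^ 2 := by
  have h := optimality_step (γ := γ) hdiff hconv hlip hxs huT hη hμ hη0 hα hα1 hαL hy
  have e₁ := frobSq_le_stackNorm_sq hS2 (devX u x)
  have e₂ := frobSq_le_stackNorm_sq hD2 (devY v y)
  have e₃ := frobSq_le_dev (v := v) y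
  have e₄ := norm_wavg_sq_le (u := u) (NeZero.pos n) hdiff hlip hxs hy
  have hd₁0 : 0 ≤ d₁ := by
    rw [hd₁]
    exact div_nonneg (mul_nonneg (by norm_num) (spec2_nonneg _)) (sq_nonneg _)
  have hd₅0 : 0 ≤ d₅ := by
    rw [hd₅]
    exact div_nonneg (mul_nonneg (by norm_num) (spec2_nonneg _)) (sq_nonneg _)
  have hd₇0 : 0 ≤ d₇ := by rw [hd₇]; positivity
  have r₅ : 2 * (spec2 (expect R C fun d => (γ • centT R C d)ᵀ * vecMulVec u u *
      (γ • centT R C d)) / n ^ 2) = d₅ := by rw [hd₅]; ring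
  have r₁ : 2 * α ^ 2 * (spec2 (expect R C fun d => (drawQ d)ᵀ * vecMulVec u u * drawQ d)
      / n ^ 2) = α ^ 2 * d₁ / 2 := by rw [hd₁]; ring
  rw [r₅, r₁, ← hd₇] at h
  have e₅ := mul_le_mul_of_nonneg_left e₄ (sq_nonneg (vec2 v))
  have e₆ : frobSq y ≤ 2 * stackNorm (vecNorm τ' D) (devY v y) ^ 2 + 2 * (vec2 v ^ 2 *
      (2 * L ^ 2 * ‖wavg u x - xs‖ ^ 2
        + 2 * L ^ 2 / n * stackNorm (vecNorm τ S) (devX u x) ^ 2)) := by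
    have := mul_le_mul_of_nonneg_left e₁
      (show 0 ≤ vec2 v ^ 2 * (2 * L ^ 2 / n) by positivity)
    linarith
  have hn : (0 : ℝ) < n := by exact_mod_cast NeZero.pos n
  have g₁ := mul_le_mul_of_nonneg_left e₆ (show 0 ≤ α ^ 2 * d₁ / 2 by positivity)
  have hL2 : 0 ≤ L ^ 2 := sq_nonneg L
  have g₂ := mul_le_mul_of_nonneg_left e₁
    (show 0 ≤ 2 * α * η * L ^ 2 / (μ * n) + d₅ by positivity)
  have g₃ := mul_le_mul_of_nonneg_left e₂ (show 0 ≤ 2 * α / (η * μ) * d₇ by positivity)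
  refine h.trans (le_trans (add_le_add_right g₁ _) ?_)
  have key : ∀ c : ℝ, (2 * α * d₇ / (η * μ) + α ^ 2 * d₁) * c
      = 2 * α / (η * μ) * d₇ * c + α ^ 2 * d₁ * c := fun c => by ring
  rw [key]
  have key' : ∀ b : ℝ, (2 * α * η * L ^ 2 / (μ * n) + 2 * α ^ 2 * L ^ 2 * vec2 v ^ 2 * d₁ / n
      + d₅) * b = (2 * α * η * L ^ 2 / (μ * n) + d₅) * b
      + α ^ 2 * d₁ * (vec2 v ^ 2 * (2 * L ^ 2 / n * b)) := fun b => by ring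
  rw [key']
  linarith

theorem consensus_recursion (hdiff : ∀ i, Differentiable ℝ (f i))
    (hlip : ∀ i x x', ‖gradient (f i) x - gradient (f i) x'‖ ≤ L * ‖x - x'‖)
    (hxs : IsMinOn (fun x => ∑ i, f i x) Set.univ xs) (hτ : 0 ≤ τ)
    (hS : IsScaledJordan (expect R C drawT) u S J) (huT : u ᵥ* expect R C drawT = 0)
    (hu1 : ∑ i, u i = n)
    (hS2 : ∀ z : Fin n → ℝ, vec2 z ≤ vecNorm τ S z) {δ : ℝ}
    (hδ : ∀ z : Fin n → ℝ, vecNorm τ S z ≤ δ * vecNorm τ' D z) {σ d₂ : ℝ}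
    (hσ : σ = sigmaR R C u S J γ) (hσ0 : 0 ≤ σ) (hσ1 : σ < 1)
    (hd₂ : d₂ = 3 * ((1 + σ) / (1 - σ)) * spec2 (VQ R C u S)) {x y : Stack n p}
    (hy : wavg (fun _ => 1) y = wavg (fun _ => 1) (gradStack f x)) :
    ∑ d, drawProb R C d * stackNorm (vecNorm τ S) (devX u (nextX γ α x y d)) ^ 2 ≤
      α ^ 2 * L ^ 2 * d₂ * vecNorm τ S v ^ 2 * ‖wavg u x - xs‖ ^ 2
      + ((1 + σ) / 2 + α ^ 2 * L ^ 2 * d₂ * vecNorm τ S v ^ 2 / n)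
        * stackNorm (vecNorm τ S) (devX u x) ^ 2
      + α ^ 2 * d₂ * δ ^ 2 * stackNorm (vecNorm τ' D) (devY v y) ^ 2 := by
  have h := consensus_step (α := α) hτ hS huT hu1 (hσ ▸ hσ1) x y
  rw [← hσ] at h
  set g := avgGrad f (wavg u x)
  set ybar := wavg (fun _ => 1) y
  have hsplit : devY v y + rankOne v (ybar - g) + rankOne v g = y := by
    rw [add_assoc, ← rankOne_add, sub_add_cancel, devY_add_rankOne]
  have e₁ := stackNorm_add_add_sq_le S hτ (devY v y) (rankOne v (ybar - g)) (rankOne v g)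
  rw [hsplit, stackNorm_rankOne_sq S hτ, stackNorm_rankOne_sq S hτ] at e₁
  have e₂ := stackNorm_sq_le_mul (vecNorm_nonneg hτ S) hδ (devY v y)
  have e₃ := norm_avg_gradStack_sub_sq_le hlip u x
  rw [← hy] at e₃
  have e₄ := norm_avgGrad_sq_le (NeZero.pos n) hdiff hlip hxs (wavg u x)
  have e₅ := mul_le_mul_of_nonneg_left (frobSq_le_stackNorm_sq hS2 (devX u x))
    (show 0 ≤ L ^ 2 / n by positivity)
  have e₆ := mul_le_mul_of_nonneg_left (e₃.trans e₅) (sq_nonneg (vecNorm τ S v))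
  have e₇ := mul_le_mul_of_nonneg_left e₄ (sq_nonneg (vecNorm τ S v))
  have hd₂0 : 0 ≤ d₂ := by
    rw [hd₂]
    exact mul_nonneg (mul_nonneg (by norm_num) (div_nonneg (by linarith) (by linarith)))
      (spec2_nonneg _)
  have r₂ : (1 + σ) / (1 - σ) * (α ^ 2 * (spec2 (VQ R C u S)
      * stackNorm (vecNorm τ S) y ^ 2)) = α ^ 2 * d₂ / 3 * stackNorm (vecNorm τ S) y ^ 2 := by
    rw [hd₂]; ring
  rw [r₂] at h
  have e₈ : stackNorm (vecNorm τ S) y ^ 2 ≤ 3 * (δ ^ 2 * stackNorm (vecNorm τ' D) (devY v y) ^ 2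
      + vecNorm τ S v ^ 2 * (L ^ 2 / n * stackNorm (vecNorm τ S) (devX u x) ^ 2)
      + vecNorm τ S v ^ 2 * (L ^ 2 * ‖wavg u x - xs‖ ^ 2)) := by linarith
  have e₉ := mul_le_mul_of_nonneg_left e₈ (show 0 ≤ α ^ 2 * d₂ / 3 by positivity)
  refine h.trans ((add_le_add_right e₉ _).trans (le_of_eq ?_))
  ring

theorem tracking_recursion (hdiff : ∀ i, Differentiable ℝ (f i))
    (hlip : ∀ i x x', ‖gradient (f i) x - gradient (f i) x'‖ ≤ L * ‖x - x'‖)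
    (hxs : IsMinOn (fun x => ∑ i, f i x) Set.univ xs) (hτ : 0 ≤ τ')
    (hD : IsScaledJordan (expect R C drawE) (fun _ => 1) D J)
    (hEv : expect R C drawE *ᵥ v = 0) (hv1 : ∑ i, v i = n)
    (hS2 : ∀ z : Fin n → ℝ, vec2 z ≤ vecNorm τ S z)
    (hD2 : ∀ z : Fin n → ℝ, vec2 z ≤ vecNorm τ' D z) {δ : ℝ}
    (hδ : ∀ z : Fin n → ℝ, vecNorm τ' D z ≤ δ * vec2 z) {σ d₃ d₄ d₆ : ℝ}
    (hσ : σ = sigmaC R C D J γ) (hσ0 : 0 < σ) (hσ1 : σ < 1)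
    (hd₃ : d₃ = 4 * δ ^ 2 * ((1 + σ) / (1 - σ)) * matNorm D (projY v) ^ 2 *
      expect R C fun d => spec2 (drawQ d) ^ 2)
    (hd₄ : d₄ = (1 + σ) / σ * spec2 (VE R C D) * vecNorm τ' D v ^ 2)
    (hd₆ : d₆ = δ ^ 2 * ((1 + σ) / (1 - σ)) * matNorm D (projY v) ^ 2 *
      expect R C fun d => spec2 (drawR γ d - 1) ^ 2) (hd₃0 : 0 ≤ d₃) (hd₄0 : 0 ≤ d₄)
    (hd₆0 : 0 ≤ d₆) {x y : Stack n p}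
    (hy : wavg (fun _ => 1) y = wavg (fun _ => 1) (gradStack f x)) :
    ∑ d, drawProb R C d * stackNorm (vecNorm τ' D) (devY v (nextY γ α f x y d)) ^ 2 ≤
      2 * L ^ 2 * (γ ^ 2 * d₄ + α ^ 2 * L ^ 2 * d₃ * vec2 v ^ 2) * ‖wavg u x - xs‖ ^ 2
      + 2 * L ^ 2 * (d₆ + α ^ 2 * L ^ 2 * d₃ * vec2 v ^ 2 / n + γ ^ 2 * d₄ / n)
        * stackNorm (vecNorm τ S) (devX u x) ^ 2
      + ((1 + σ) / 2 + α ^ 2 * L ^ 2 * d₃) * stackNorm (vecNorm τ' D) (devY v y) ^ 2 := by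
  have h := tracking_step (α := α) (f := f) hτ hD hEv hv1 (hσ ▸ hσ0) (hσ ▸ hσ1) hδ hlip u x y
  rw [← hσ, ← hd₄] at h
  have e₁ := frobSq_le_stackNorm_sq hS2 (devX u x)
  have e₂ := frobSq_le_stackNorm_sq hD2 (devY v y)
  have e₃ := frobSq_le_dev (v := v) y
  have e₄ := norm_wavg_sq_le (u := u) (NeZero.pos n) hdiff hlip hxs hy
  set ybar := wavg (fun _ => 1) y
  have e₅ : ‖ybar‖ ^ 2 ≤ 2 * L ^ 2 * ‖wavg u x - xs‖ ^ 2
        + 2 * L ^ 2 / n * stackNorm (vecNorm τ S) (devX u x) ^ 2 := by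
    have := mul_le_mul_of_nonneg_left e₁ (show 0 ≤ 2 * L ^ 2 / n by positivity)
    linarith
  have r : (1 + σ) / (1 - σ) * (matNorm D (projY v) ^ 2 * δ ^ 2 *
        (2 * L ^ 2 * ((expect R C fun d => spec2 (drawR γ d - 1) ^ 2) * frobSq (devX u x)
          + α ^ 2 * (expect R C fun d => spec2 (drawQ d) ^ 2) * frobSq y)))
      = 2 * L ^ 2 * d₆ * frobSq (devX u x) + α ^ 2 * L ^ 2 * d₃ / 2 * frobSq y := by
    rw [hd₃, hd₆]; ring
  rw [r] at h
  have e₆ : frobSq y ≤ 2 * stackNorm (vecNorm τ' D) (devY v y) ^ 2 + 2 * (vec2 v ^ 2 *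
      (2 * L ^ 2 * ‖wavg u x - xs‖ ^ 2
        + 2 * L ^ 2 / n * stackNorm (vecNorm τ S) (devX u x) ^ 2)) := by
    have := mul_le_mul_of_nonneg_left e₅ (sq_nonneg (vec2 v))
    linarith
  have g₁ := mul_le_mul_of_nonneg_left e₆ (show 0 ≤ α ^ 2 * L ^ 2 * d₃ / 2 by positivity)
  have g₂ := mul_le_mul_of_nonneg_left e₁ (show 0 ≤ 2 * L ^ 2 * d₆ by positivity)
  have g₃ := mul_le_mul_of_nonneg_left e₅ (show 0 ≤ γ ^ 2 * d₄ by positivity)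
  refine h.trans ((add_le_add (add_le_add_right g₃ _) (add_le_add g₂ g₁)).trans (le_of_eq ?_))
  ring

end Recursion

/-! ### The conditions on the mixing weight and the stepsize -/

section Conditions

theorem strongConvexity_le_lipschitz {n p : ℕ} [NeZero n] (hp : 1 ≤ p)
    {f : Fin n → EuclideanSpace ℝ (Fin p) → ℝ} {μ L : ℝ}
    (hconv : ∀ i x x', μ * ‖x - x'‖ ^ 2 ≤
      inner ℝ (gradient (f i) x - gradient (f i) x') (x - x'))
    (hlip : ∀ i x x', ‖gradient (f i) x - gradient (f i) x'‖ ≤ L * ‖x - x'‖) : μ ≤ L := by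
  set e : EuclideanSpace ℝ (Fin p) := EuclideanSpace.single ⟨0, hp⟩ 1
  have he : ‖e - 0‖ = 1 := by simp [e]
  have h1 := hconv 0 e 0
  have h2 := hlip 0 e 0
  have h3 := real_inner_le_norm (gradient (f 0) e - gradient (f 0) 0) (e - 0)
  rw [he] at h1 h2 h3
  linarith

/-- What the bound on the mixing weight says about the constants in it. -/
theorem mixing_bound {η μ L σ d₄ d₇ γ : ℝ} (hμ : 0 < μ) (hL : 0 < L) (hγ : 0 < γ)
    (hd₄ : 0 ≤ d₄) (hd₇ : 0 ≤ d₇)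
    (h : γ < η * μ * √(1 - σ) / (8 * L * √(d₄ * d₇))) :
    0 < η ∧ 0 < d₄ ∧ 0 < d₇ ∧ 64 * (γ ^ 2 * L ^ 2 * (d₄ * d₇)) < η ^ 2 * μ ^ 2 * (1 - σ) := by
  -- Division by zero gives zero, so a vanishing denominator would contradict `γ > 0`. Positivity of
  -- `η`, `d₄`, `d₇` is thus part of the bound on `γ`.
  have hs : 0 < √(d₄ * d₇) := by
    refine (Real.sqrt_nonneg _).lt_of_ne fun h0 => ?_
    rw [← h0, mul_zero, div_zero] at h
    linarith
  have hdd : 0 < d₄ * d₇ := Real.sqrt_pos.1 hs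
  rw [lt_div_iff₀ (by positivity)] at h
  have hnum : 0 < η * μ * √(1 - σ) := lt_trans (by positivity) h
  have hr : 0 < √(1 - σ) :=
    (Real.sqrt_nonneg _).lt_of_ne fun h0 => by rw [← h0, mul_zero] at hnum; exact hnum.false
  have hη : 0 < η := pos_of_mul_pos_left (pos_of_mul_pos_left hnum hr.le) hμ.le
  have h2 := pow_lt_pow_left₀ h (by positivity) two_ne_zero
  rw [mul_pow, mul_pow, mul_pow, mul_pow, mul_pow, Real.sq_sqrt hdd.le,
    Real.sq_sqrt (Real.sqrt_pos.1 hr).le] at h2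
  refine ⟨hη, hd₄.lt_of_ne fun h0 => ?_, hd₇.lt_of_ne fun h0 => ?_, by linarith⟩
  · rw [← h0, zero_mul] at hdd
    exact hdd.false
  · rw [← h0, mul_zero] at hdd
    exact hdd.false

theorem stepsize_slack_pos {η μ L σ P d₄ d₇ γ : ℝ} (hη : 0 < η) (hμ : 0 < μ) (hP : 0 < P)
    (hd₄ : 0 < d₄) (hd₇ : 0 < d₇)
    (h : 64 * (γ ^ 2 * L ^ 2 * (d₄ * d₇)) < η ^ 2 * μ ^ 2 * (1 - σ)) :
    0 < 1 / 32 * η * μ * P * (1 - σ) - 3 * P / 2 * (L ^ 2 * d₄ * d₇ / (η * μ)) * γ ^ 2 := by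
  have e : 1 / 32 * η * μ * P * (1 - σ) - 3 * P / 2 * (L ^ 2 * d₄ * d₇ / (η * μ)) * γ ^ 2
      = P / (η * μ) * (1 / 32 * (η ^ 2 * μ ^ 2 * (1 - σ))
        - 3 / 2 * (γ ^ 2 * L ^ 2 * (d₄ * d₇))) := by
    field_simp
  rw [e]
  have : 0 ≤ γ ^ 2 * L ^ 2 * (d₄ * d₇) := by positivity
  exact mul_pos (by positivity) (by linarith)

/-- `1 - σ ≤ 1 - (1 - g)² ≤ 2 g` with `g = γ/(N-1)`, and `N ≤ 2 (N - 1)`. -/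
theorem card_mul_one_sub_le {N σ W s γ : ℝ} (hN : 2 ≤ N) (hW : 0 ≤ W)
    (hσ : σ = s ^ 2 + 2 * γ ^ 2 * W) (hγ : γ ∈ Set.Ioo (0 : ℝ) 1)
    (hs : 1 - γ / (N - 1) ≤ s) : N * (1 - σ) ≤ 4 * γ := by
  have hN1 : 0 < N - 1 := by linarith
  set g := γ / (N - 1) with hg
  have hγg : γ = g * (N - 1) := by rw [hg]; field_simp
  have hg0 : 0 < g := div_pos hγ.1 hN1
  have hg1 : g ≤ 1 := by
    rw [hg, div_le_one hN1]
    linarith [hγ.2]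
  have h1 := pow_le_pow_left₀ (by linarith) hs 2
  have h2 : 0 ≤ 2 * γ ^ 2 * W := by positivity
  have h3 : 1 - σ ≤ 2 * g := by
    rw [hσ]
    linarith [sq_nonneg g]
  have h4 := mul_le_mul_of_nonneg_left h3 (show 0 ≤ N by linarith)
  have h5 := mul_le_mul_of_nonneg_right hN hg0.le
  linarith

variable {n : ℕ} {R C : Matrix (Fin n) (Fin n) ℝ} {u v : Fin n → ℝ}
  {D J : Matrix (Fin n) (Fin n) ℂ} {γ τ δ σ : ℝ}

theorem sq_eta_le {η d₇ : ℝ} (hη : η = u ⬝ᵥ (expect R C drawQ *ᵥ v) / n)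
    (hd₇ : d₇ = vec2 (u ᵥ* expect R C drawQ) ^ 2 / n ^ 2) : η ^ 2 ≤ d₇ * vec2 v ^ 2 := by
  rw [hη, hd₇, dotProduct_mulVec, div_pow, div_mul_eq_mul_div]
  exact div_le_div_of_nonneg_right (sq_dotProduct_le _ _) (sq_nonneg _)

variable [NeZero n]

theorem le_sigmaR (u : Fin n → ℝ) (S : Matrix (Fin n) (Fin n) ℂ) :
    spec2 (shiftJ γ J) ^ 2 ≤ sigmaR R C u S J γ :=
  le_add_of_nonneg_right (mul_nonneg (sq_nonneg _) (spec2_nonneg _))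

theorem le_sigmaC : spec2 (shiftJ γ J) ^ 2 ≤ sigmaC R C D J γ :=
  le_add_of_nonneg_right
    (mul_nonneg (mul_nonneg zero_le_two (sq_nonneg _)) (spec2_nonneg _))

theorem spec2_shiftJ_lt_one (h : spec2 (shiftJ γ J) ^ 2 < 1) : spec2 (shiftJ γ J) < 1 :=
  (pow_lt_one_iff_of_nonneg (spec2_nonneg _) two_ne_zero).1 h

theorem vec2_sq_le_card_mul (hD : IsScaledJordan (expect R C drawE) (fun _ => 1) D J)
    (hs : spec2 (shiftJ γ J) < 1) (hEv : expect R C drawE *ᵥ v = 0) (hv1 : ∑ i, v i = n)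
    (hD2 : ∀ z : Fin n → ℝ, vec2 z ≤ vecNorm τ D z)
    (hδ : ∀ z : Fin n → ℝ, vecNorm τ D z ≤ δ * vec2 z) : vec2 v ^ 2 ≤ n * δ ^ 2 := by
  have h1 := four_mul_vec2_sq_le hD hs hEv hv1 hD2 hδ
  have h2 := card_le_vec2_sq hv1
  linarith

theorem tracking_noise_bound (hn : 2 ≤ n)
    (hD : IsScaledJordan (expect R C drawE) (fun _ => 1) D J) (hγ : γ ∈ Set.Ioo (0 : ℝ) 1)
    (hσ : σ = sigmaC R C D J γ) (hσ0 : 0 < σ) (hσ1 : σ < 1) (hs : spec2 (shiftJ γ J) < 1)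
    (hEv : expect R C drawE *ᵥ v = 0) (hv1 : ∑ i, v i = n)
    (hD2 : ∀ z : Fin n → ℝ, vec2 z ≤ vecNorm τ D z)
    (hδ : ∀ z : Fin n → ℝ, vecNorm τ D z ≤ δ * vec2 z) :
    vec2 v ^ 2 * (1 - σ) ^ 2 ≤ 147 / 400 * (δ ^ 2 * (1 + σ)) := by
  have hN : (2 : ℝ) ≤ n := by exact_mod_cast hn
  have hV : 0 < vec2 v ^ 2 := by linarith [card_le_vec2_sq hv1]
  by_cases hout : ∀ i, outNbr C i ≠ ∅
  · have hδ0 : 0 < δ ^ 2 := by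
      have := hV.trans_le (vec2_sq_le_card_mul hD hs hEv hv1 hD2 hδ)
      exact pos_of_mul_pos_right this (by linarith)
    have h := noise_bound_of_full hN hV hδ0 hσ hσ1 hγ (one_sub_le_spec2_shiftJ hn hγ.1.le hD)
      (two_mul_vec2_sq_le hD hs hEv hv1 hD2 hδ hout)
    have := mul_pos hδ0 hσ0
    linarith
  · push Not at hout
    obtain ⟨i, hi⟩ := hout
    exact noise_bound_of_sink hN (vec2_sq_eq_of_empty hD hs hEv hv1 hi)
      (four_mul_vec2_sq_le hD hs hEv hv1 hD2 hδ) (spec2_nonneg _) hσ hσ1 hγ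
      (one_sub_le_spec2_shiftJ_of_empty hn hγ.1.le hD hi)

theorem second_moment_sq_le {d₁ d₇ : ℝ} (hu0 : ∀ i, 0 ≤ u i) (hu1 : ∑ i, u i = n)
    (hd₁ : d₁ = 4 * spec2 (expect R C fun d => (drawQ d)ᵀ * vecMulVec u u * drawQ d) / n ^ 2)
    (hd₇ : d₇ = vec2 (u ᵥ* expect R C drawQ) ^ 2 / n ^ 2) : d₁ ^ 2 ≤ 64 * d₇ := by
  have hN : (0 : ℝ) < n := by exact_mod_cast NeZero.pos n
  have h1 := spec2_second_moment_drawQ_le (R := R) (C := C) (u := u)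
  set A := spec2 (expect R C fun d => (drawQ d)ᵀ * vecMulVec u u * drawQ d)
  set w := vec2 (u ᵥ* expect R C drawQ)
  have hw : 0 ≤ w := vec2_nonneg _
  have h2 : A ≤ 2 * (n * w) := h1.trans (mul_le_mul_of_nonneg_left
    (mul_le_mul_of_nonneg_right (vec2_le_of_nonneg hu0 hu1) hw) zero_le_two)
  have h3 := pow_le_pow_left₀ (spec2_nonneg _) h2 2
  rw [hd₁, hd₇, div_pow, mul_div_assoc', div_le_div_iff₀ (by positivity) (by positivity)]
  have h4 := mul_le_mul_of_nonneg_right h3 (show (0 : ℝ) ≤ 16 * n ^ 2 by positivity)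
  linarith

theorem four_mul_le_second_moment {d₁ d₇ : ℝ} (h0 : u ᵥ* expect R C drawQ ≠ 0)
    (hd₁ : d₁ = 4 * spec2 (expect R C fun d => (drawQ d)ᵀ * vecMulVec u u * drawQ d) / n ^ 2)
    (hd₇ : d₇ = vec2 (u ᵥ* expect R C drawQ) ^ 2 / n ^ 2) : 4 * d₇ ≤ d₁ := by
  rw [hd₁, hd₇, mul_div_assoc']
  exact div_le_div_of_nonneg_right
    (mul_le_mul_of_nonneg_left (vec2_sq_le_spec2_second_moment h0) (by norm_num)) (sq_nonneg _)

end Conditions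

end GPushPull

end

/-! ### The convergence theorem -/

set_option maxHeartbeats 1000000 in
theorem theorem5p1
    {n p : ℕ} [NeZero n] (hn : 2 ≤ n) (hp : 1 ≤ p)
    -- the objective functions and the optimal solution
    (f : Fin n → EuclideanSpace ℝ (Fin p) → ℝ) (μ L : ℝ) (hμ : 0 < μ)
    (hdiff : ∀ i, Differentiable ℝ (f i))
    (hconv : ∀ i x x', μ * ‖x - x'‖ ^ 2 ≤
      inner ℝ (gradient (f i) x - gradient (f i) x') (x - x'))
    (hlip : ∀ i x x', ‖gradient (f i) x - gradient (f i) x'‖ ≤ L * ‖x - x'‖)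
    (xs : EuclideanSpace ℝ (Fin p)) (hxs : IsMinOn (fun x => ∑ i, f i x) Set.univ xs)
    -- the matrices that induce the two graphs
    (R C : Matrix (Fin n) (Fin n) ℝ)
    (hR : GPushPull.IsRowStochastic R) (hC : GPushPull.IsColStochastic C)
    (hroot : (GPushPull.roots R ∩ GPushPull.roots Cᵀ).Nonempty)
    -- mixing weight, stepsize, and the random iteration
    (γ α : ℝ) (hγ : γ ∈ Set.Ioo (0 : ℝ) 1) (hα : 0 < α)
    {Ω : Type*} [MeasurableSpace Ω] (P : Measure Ω) [IsProbabilityMeasure P]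
    (ξ : ℕ → Ω → GPushPull.Draw n) (hξm : ∀ k, Measurable (ξ k)) (hξi : iIndepFun ξ P)
    (hξ : ∀ k d, P.real (ξ k ⁻¹' {d}) = GPushPull.drawProb R C d)
    (x₀ : GPushPull.Stack n p)
    (x y : ℕ → Ω → GPushPull.Stack n p)
    (hx : ∀ k ω, x k ω = (GPushPull.iter γ α f x₀ (fun m => ξ m ω) k).1)
    (hy : ∀ k ω, y k ω = (GPushPull.iter γ α f x₀ (fun m => ξ m ω) k).2)
    -- the Perron vectors of the mean matrices
    (u v : Fin n → ℝ)
    (hu : u ᵥ* GPushPull.expect R C (GPushPull.drawR γ) = u) (hu1 : ∑ i, u i = n)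
    (hv : GPushPull.expect R C (GPushPull.drawC γ) *ᵥ v = v) (hv1 : ∑ i, v i = n)
    -- the decompositions that define the norms
    (S JT D JE : Matrix (Fin n) (Fin n) ℂ)
    (hS : GPushPull.IsScaledJordan (GPushPull.expect R C GPushPull.drawT) u S JT)
    (hD : GPushPull.IsScaledJordan (GPushPull.expect R C GPushPull.drawE) (fun _ => 1) D JE)
    (τS τD : ℝ) (hτS : 0 < τS) (hτD : 0 < τD)
    (hS2 : ∀ z : Fin n → ℝ, GPushPull.vec2 z ≤ GPushPull.vecNorm τS S z)
    (hD2 : ∀ z : Fin n → ℝ, GPushPull.vec2 z ≤ GPushPull.vecNorm τD D z)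
    (δSD δD2 : ℝ)
    (hδSD : ∀ z : Fin n → ℝ, GPushPull.vecNorm τS S z ≤ δSD * GPushPull.vecNorm τD D z)
    (hδD2 : ∀ z : Fin n → ℝ, GPushPull.vecNorm τD D z ≤ δD2 * GPushPull.vec2 z)
    -- the constants
    (σR σC η vS vD : ℝ)
    (hσR : σR = GPushPull.sigmaR R C u S JT γ) (hσC : σC = GPushPull.sigmaC R C D JE γ)
    (hη : η = u ⬝ᵥ (GPushPull.expect R C GPushPull.drawQ *ᵥ v) / n)
    (hvS : vS = GPushPull.vecNorm τS S v) (hvD : vD = GPushPull.vecNorm τD D v)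
    (d₁ d₂ d₃ d₄ d₅ d₆ d₇ : ℝ)
    (hd₁ : d₁ = 4 * GPushPull.spec2 (GPushPull.expect R C fun d =>
      (GPushPull.drawQ d)ᵀ * vecMulVec u u * GPushPull.drawQ d) / n ^ 2)
    (hd₂ : d₂ = 3 * ((1 + σR) / (1 - σR)) * GPushPull.spec2 (GPushPull.VQ R C u S))
    (hd₃ : d₃ = 4 * δD2 ^ 2 * ((1 + σC) / (1 - σC)) *
      GPushPull.matNorm D (GPushPull.projY v) ^ 2 *
      GPushPull.expect R C fun d => GPushPull.spec2 (GPushPull.drawQ d) ^ 2)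
    (hd₄ : d₄ = (1 + σC) / σC * GPushPull.spec2 (GPushPull.VE R C D) * vD ^ 2)
    (hd₅ : d₅ = 2 * GPushPull.spec2 (GPushPull.expect R C fun d =>
      (γ • GPushPull.centT R C d)ᵀ * vecMulVec u u * (γ • GPushPull.centT R C d)) / n ^ 2)
    (hd₆ : d₆ = δD2 ^ 2 * ((1 + σC) / (1 - σC)) *
      GPushPull.matNorm D (GPushPull.projY v) ^ 2 *
      GPushPull.expect R C fun d => GPushPull.spec2 (GPushPull.drawR γ d - 1) ^ 2)
    (hd₇ : d₇ = GPushPull.vec2 (u ᵥ* GPushPull.expect R C GPushPull.drawQ) ^ 2 / n ^ 2)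
    (c₄ c₅ c₆ : ℝ)
    (hc₄ : c₄ = 6 * η * L ^ 4 / (μ * n) * d₂ * δSD ^ 2 * (d₆ + γ ^ 2 * d₄)
      + 6 * L ^ 4 / (η * μ) * d₂ * d₇ * vS ^ 2 * (2 * d₆ + γ ^ 2 * d₄)
      + 3 * (1 - σR) / 2 * (L ^ 4 * d₃ * d₇ / (η * μ)) * GPushPull.vec2 v ^ 2
      + η * μ * L ^ 2 * d₂ * δSD ^ 2 * (2 * d₆ + γ ^ 2 * d₄)
      + 3 * (1 - σC) / 4 * (η * L ^ 4 * d₂ / (μ * n)) * vS ^ 2)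
    (hc₅ : c₅ = 2 * L ^ 2 * d₂ * d₅ * δSD ^ 2 * (d₆ + γ ^ 2 * d₄)
      + (1 - σC) / 4 * L ^ 2 * d₂ * d₅ * vS ^ 2)
    (hc₆ : c₆ = 1 / 32 * η * μ * (1 - σR) * (1 - σC)
      - 3 * (1 - σR) / 2 * (L ^ 2 * d₄ * d₇ / (η * μ)) * γ ^ 2)
    -- the conditions on the mixing weight and on the stepsize
    (γR γC : ℝ)
    (hγR : ∀ g ∈ Set.Ioo 0 γR, GPushPull.sigmaR R C u S JT g < 1)
    (hγC : ∀ g ∈ Set.Ioo 0 γC, GPushPull.sigmaC R C D JE g < 1)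
    (hγlt : γ < min (min γR γC) (η * μ * √(1 - σC) / (8 * L * √(d₄ * d₇))))
    (hαle : α ≤ 2 * c₆ / (c₅ + √(c₅ ^ 2 + 4 * c₄ * c₆)))
    -- the transition matrix
    (B : Matrix (Fin 3) (Fin 3) ℝ)
    (hB : B = !![
      1 - α * η * μ + 2 * α ^ 2 * L ^ 2 * GPushPull.vec2 v ^ 2 * d₁,
      2 * α * η * L ^ 2 / (μ * n) + 2 * α ^ 2 * L ^ 2 * GPushPull.vec2 v ^ 2 * d₁ / n + d₅,
      2 * α * d₇ / (η * μ) + α ^ 2 * d₁;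
      α ^ 2 * L ^ 2 * d₂ * vS ^ 2,
      (1 + σR) / 2 + α ^ 2 * L ^ 2 * d₂ * vS ^ 2 / n,
      α ^ 2 * d₂ * δSD ^ 2;
      2 * L ^ 2 * (γ ^ 2 * d₄ + α ^ 2 * L ^ 2 * d₃ * GPushPull.vec2 v ^ 2),
      2 * L ^ 2 * (d₆ + α ^ 2 * L ^ 2 * d₃ * GPushPull.vec2 v ^ 2 / n + γ ^ 2 * d₄ / n),
      (1 + σC) / 2 + α ^ 2 * L ^ 2 * d₃]) :
    GPushPull.rho B < 1 ∧
    GPushPull.ConvergesAtRate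
      (fun k => ∫ ω, ‖GPushPull.wavg u (x k ω) - xs‖ ^ 2 ∂P) (GPushPull.rho B).toReal ∧
    GPushPull.ConvergesAtRate
      (fun k => ∫ ω, GPushPull.stackNorm (GPushPull.vecNorm τS S)
        (fun i => x k ω i - GPushPull.wavg u (x k ω)) ^ 2 ∂P) (GPushPull.rho B).toReal ∧
    GPushPull.ConvergesAtRate
      (fun k => ∫ ω, GPushPull.stackNorm (GPushPull.vecNorm τD D)
        (fun i => y k ω i - v i • GPushPull.wavg (fun _ => 1) (y k ω)) ^ 2 ∂P)
      (GPushPull.rho B).toReal := by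
  have hN : (2 : ℝ) ≤ n := by exact_mod_cast hn
  have hN0 : (0 : ℝ) < n := by linarith
  have hμL := GPushPull.strongConvexity_le_lipschitz hp hconv hlip
  have hL : 0 < L := hμ.trans_le hμL
  rw [lt_min_iff, lt_min_iff] at hγlt
  obtain ⟨⟨hγlR, hγlC⟩, hγl⟩ := hγlt
  have hσR1 : σR < 1 := hσR ▸ hγR γ ⟨hγ.1, hγlR⟩
  have hσC1 : σC < 1 := hσC ▸ hγC γ ⟨hγ.1, hγlC⟩
  have hVE := GPushPull.spec2_nonneg (GPushPull.VE R C D)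
  have hsR' := hσR ▸ GPushPull.le_sigmaR (R := R) (C := C) (γ := γ) (J := JT) u S
  have hsC' := hσC ▸ GPushPull.le_sigmaC (R := R) (C := C) (D := D) (γ := γ) (J := JE)
  have hσR0 : 0 ≤ σR := (sq_nonneg _).trans hsR'
  have hσC0' : 0 ≤ σC := (sq_nonneg _).trans hsC'
  have hsR := GPushPull.spec2_shiftJ_lt_one (hsR'.trans_lt hσR1)
  have hsC := GPushPull.spec2_shiftJ_lt_one (hsC'.trans_lt hσC1)
  have huT := GPushPull.vecMul_expect_drawT_eq_zero hγ.1.ne' hu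
  have hEv := GPushPull.expect_drawE_mulVec_eq_zero hγ.1.ne' hv
  have hPR : 0 < 1 - σR := by linarith
  have hPC : 0 < 1 - σC := by linarith
  -- signs of the constants
  have hd₄0' : 0 ≤ d₄ := by
    rw [hd₄]
    exact mul_nonneg (mul_nonneg (div_nonneg (by linarith) hσC0') hVE) (sq_nonneg _)
  have hd₇0' : 0 ≤ d₇ := by rw [hd₇]; exact div_nonneg (sq_nonneg _) (sq_nonneg _)
  obtain ⟨hη0, hd₄0, hd₇0, hmix⟩ := GPushPull.mixing_bound hμ hL hγ.1 hd₄0' hd₇0' hγl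
  -- With `σC = 0` the quotient in `d₄` would be `0`, contradicting `d₄ > 0`.
  have hσC0 : 0 < σC := hσC0'.lt_of_ne fun h0 => by
    rw [← h0, div_zero, zero_mul, zero_mul] at hd₄
    exact hd₄0.ne' hd₄
  have hc₆0 : 0 < c₆ := by
    rw [hc₆]
    exact GPushPull.stepsize_slack_pos hη0 hμ hPR hd₄0 hd₇0 hmix
  set V := GPushPull.vec2 v ^ 2 with hV
  have hV0 : 0 < V := hN0.trans_le (GPushPull.card_le_vec2_sq hv1)
  have hVD : V ≤ n * δD2 ^ 2 := GPushPull.vec2_sq_le_card_mul hD hsC hEv hv1 hD2 hδD2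
  have hδ0 : 0 < δD2 ^ 2 := pos_of_mul_pos_right (hV0.trans_le hVD) hN0.le
  have hK : 1 ≤ GPushPull.matNorm D (GPushPull.projY v) ^ 2 :=
    one_le_pow₀ (GPushPull.one_le_matNorm_projY hn hD.isUnit_det)
  have hEQ := GPushPull.one_le_expect_spec2_drawQ (R := R) (C := C)
  -- The common root has an out-neighbour in the graph of `R`, which keeps `d₆` away from zero.
  obtain ⟨i₀, hi₀⟩ := hroot
  have hER := GPushPull.gamma_sq_div_le_expect (R := R) (C := C) (γ := γ)
    ⟨i₀, GPushPull.outNbr_ne_empty_of_mem_roots hn hi₀.1⟩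
  have hQ0 : u ᵥ* GPushPull.expect R C GPushPull.drawQ ≠ 0 := fun h0 => by
    rw [dotProduct_mulVec, h0, zero_dotProduct, zero_div] at hη
    exact hη0.ne' hη
  have hd₁7 := GPushPull.second_moment_sq_le
    (GPushPull.perron_left_nonneg hγ hS hsR hu hu1) hu1 hd₁ hd₇
  have hd₇1 := GPushPull.four_mul_le_second_moment hQ0 hd₁ hd₇
  have hη7 := GPushPull.sq_eta_le hη hd₇
  have hnoise := GPushPull.tracking_noise_bound hn hD hγ hσC hσC0 hσC1 hsC hEv hv1 hD2 hδD2
  have hσγ := GPushPull.card_mul_one_sub_le hN hVE hσC hγ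
    (GPushPull.one_sub_le_spec2_shiftJ hn hγ.1.le hD)
  have hd₁0 : 0 < d₁ := by linarith
  have hd₂0 : 0 < d₂ := by
    rw [hd₂]
    exact mul_pos (mul_pos three_pos (div_pos (by linarith) hPR))
      (GPushPull.spec2_VQ_pos hn hS.isUnit_det)
  have hd₃0 : 0 < d₃ := by
    rw [hd₃]
    exact mul_pos (mul_pos (mul_pos (by linarith) (div_pos (by linarith) hPC)) (by linarith))
      (by linarith)
  have hd₅0 : 0 ≤ d₅ := by
    rw [hd₅]
    exact div_nonneg (mul_nonneg zero_le_two (GPushPull.spec2_nonneg _)) (sq_nonneg _)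
  have hd₆0 : 0 < d₆ := by
    rw [hd₆]
    have h2 : 0 < γ ^ 2 / n := div_pos (pow_pos hγ.1 2) hN0
    exact mul_pos (mul_pos (mul_pos hδ0 (div_pos (by linarith) hPC)) (by linarith))
      (by linarith)
  have hvS0 : 0 < vS := by
    rw [hvS]
    refine lt_of_lt_of_le ?_ (hS2 v)
    exact (GPushPull.vec2_nonneg v).lt_of_ne fun h0 => by
      rw [hV, ← h0] at hV0
      norm_num at hV0
  have hδSD0 : 0 < δSD ^ 2 := by
    refine sq_pos_of_ne_zero fun h0 => ?_
    have := hδSD v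
    rw [h0, zero_mul, ← hvS] at this
    linarith
  -- the stepsize
  have hc₅0 : 0 ≤ c₅ := by rw [hc₅]; positivity
  have hc₄0 : 0 ≤ c₄ := by rw [hc₄]; positivity
  have hquad := GPushPull.quadratic_le_of_le_root hc₄0 hc₅0 hc₆0 hα hαle
  have hslack : c₆ ≤ 1 / 32 * η * μ * (1 - σR) * (1 - σC) := by
    have : 0 ≤ 3 * (1 - σR) / 2 * (L ^ 2 * d₄ * d₇ / (η * μ)) * γ ^ 2 := by positivity
    rw [hc₆]
    linarith
  have hc₄α : c₄ * α ^ 2 ≤ 1 / 32 * η * μ * (1 - σR) * (1 - σC) := by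
    have : 0 ≤ c₅ * α := by positivity
    linarith
  have hγd : 0 ≤ γ ^ 2 * d₄ := by positivity
  have t₁ : 0 ≤ 6 * η * L ^ 4 / (μ * n) * d₂ * δSD ^ 2 * (d₆ + γ ^ 2 * d₄) := by positivity
  have t₂ : 0 ≤ 6 * L ^ 4 / (η * μ) * d₂ * d₇ * vS ^ 2 * (2 * d₆ + γ ^ 2 * d₄) := by positivity
  have t₃ : 0 ≤ 3 * (1 - σR) / 2 * (L ^ 4 * d₃ * d₇ / (η * μ)) * V := by positivity
  have t₄ : 0 ≤ η * μ * L ^ 2 * d₂ * δSD ^ 2 * (2 * d₆ + γ ^ 2 * d₄) := by positivity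
  have t₅ : 0 ≤ 3 * (1 - σC) / 4 * (η * L ^ 4 * d₂ / (μ * n)) * vS ^ 2 := by positivity
  -- The third and fifth summands of `c₄`, each bounded separately.
  have h3 := (mul_le_mul_of_nonneg_right (show _ ≤ c₄ by rw [hc₄]; linarith)
    (sq_nonneg α) : 3 * (1 - σR) / 2 * (L ^ 4 * d₃ * d₇ / (η * μ)) * V * α ^ 2 ≤ _).trans hc₄α
  have h5 := (mul_le_mul_of_nonneg_right (show _ ≤ c₄ by rw [hc₄]; linarith)
    (sq_nonneg α) :
    3 * (1 - σC) / 4 * (η * L ^ 4 * d₂ / (μ * n)) * vS ^ 2 * α ^ 2 ≤ _).trans hc₄α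
  have hb₁ := GPushPull.tracking_stepsize_bound hη0 hμ hPR h3
  have hb₂ := GPushPull.tracking_stepsize_bound_sq hσC0 hσC1 hV0 hδ0 hK hEQ hd₇0 hd₃ hb₁
  have s₁ := GPushPull.optimality_stepsize_bound hη0 hμ hσC0 hV0 hδ0 hEQ hd₇0 hd₁7 hnoise hb₂
  have hηL : η ^ 2 * μ ^ 2 ≤ d₇ * V * L ^ 2 :=
    mul_le_mul hη7 (pow_le_pow_left₀ hμ.le hμL 2) (sq_nonneg _) (by positivity)
  have s₂ := GPushPull.stepsize_mul_d₁_le hη0 hμ hL hV0 hd₇0 hηL s₁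
  have hαηL := GPushPull.stepsize_mul_lipschitz_le hη0 hμL hL hα hV0 hd₇1 hη7 s₁
  have s₃ := GPushPull.tracking_term_le_d₆ hN hL hσC0 hσC1 hV0 hδ0 hK hEQ hER hd₇0 hd₃ hd₆ hVD
    hσγ hηL hb₂
  have s₄ := GPushPull.tracking_term_le hL hσC1 hV0 hd₇0 hηL hb₁
  have s₅ := GPushPull.consensus_term_le hN0 hμ hμL hη0 hσC1 hPR h5
  have hαημ : α * η * μ ≤ 1 / 2 :=
    (mul_le_mul_of_nonneg_left hμL (by positivity)).trans hαηL
  -- the transition matrix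
  obtain ⟨a₁, a₂, a₃, hdet⟩ := GPushPull.transition_det_pos (γ := γ) (δ := δSD) hN hμ hμL hη0 hα
    hPR hPC hV0 hd₁0.le hd₂0.le hd₃0.le hd₄0.le hd₅0 hd₆0.le hd₇0.le s₁ s₂ s₃ s₄ s₅
    (by rw [← hc₄, ← hc₅, ← hc₆]; exact hquad) rfl rfl rfl rfl rfl rfl rfl rfl rfl
  have hpos : ∀ i j, 0 < B i j := by
    have q₁ : 0 < 1 - α * η * μ + 2 * α ^ 2 * L ^ 2 * V * d₁ :=
      add_pos (by linarith) (by positivity)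
    intro i j
    rw [hB]
    fin_cases i <;> fin_cases j <;> simp <;> positivity
  have b₀₀ : B 0 0 = 1 - α * η * μ + 2 * α ^ 2 * L ^ 2 * V * d₁ := by rw [hB]; rfl
  have b₁₁ : B 1 1 = (1 + σR) / 2 + α ^ 2 * L ^ 2 * d₂ * vS ^ 2 / n := by rw [hB]; rfl
  have b₂₂ : B 2 2 = (1 + σC) / 2 + α ^ 2 * L ^ 2 * d₃ := by rw [hB]; rfl
  obtain ⟨r, w, hr, hw, hBw⟩ := GPushPull.exists_perron_vector B hpos
  have hr1 : r < 1 := by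
    refine GPushPull.eigenvalue_lt_one_of_det_pos hpos (by rw [b₀₀]; linarith)
      (by rw [b₁₁]; linarith) (by rw [b₂₂]; linarith) (lt_of_lt_of_eq hdet ?_) hw hBw
    rw [hB]
    simp
    ring
  have hρ := GPushPull.rho_eq_of_pos_eigenvector (fun i j => (hpos i j).le) hr.le hw hBw
  rw [hρ, ENNReal.toReal_ofReal hr.le]
  refine ⟨by rw [← ENNReal.ofReal_one]; exact (ENNReal.ofReal_lt_ofReal_iff one_pos).2 hr1, ?_⟩
  -- the mean square errors
  set φ₁ : GPushPull.Stack n p → GPushPull.Stack n p → ℝ :=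
    fun x _ => ‖GPushPull.wavg u x - xs‖ ^ 2
  set φ₂ : GPushPull.Stack n p → GPushPull.Stack n p → ℝ :=
    fun x _ => GPushPull.stackNorm (GPushPull.vecNorm τS S) (GPushPull.devX u x) ^ 2
  set φ₃ : GPushPull.Stack n p → GPushPull.Stack n p → ℝ :=
    fun _ y => GPushPull.stackNorm (GPushPull.vecNorm τD D) (GPushPull.devY v y) ^ 2
  -- Each row of `z (k+1) ≤ B z k` is one of the three one-step recursions, averaged over the past.
  set z : ℕ → Fin 3 → ℝ := fun k => ![∫ ω, φ₁ (x k ω) (y k ω) ∂P, ∫ ω, φ₂ (x k ω) (y k ω) ∂P,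
    ∫ ω, φ₃ (x k ω) (y k ω) ∂P] with hz
  have hz0 : ∀ k i, 0 ≤ z k i := by
    intro k i
    fin_cases i
    · exact integral_nonneg fun ω => sq_nonneg _
    · exact integral_nonneg fun ω => sq_nonneg _
    · exact integral_nonneg fun ω => sq_nonneg _
  have hrow : ∀ k i, (B *ᵥ z k) i = B i 0 * ∫ ω, φ₁ (x k ω) (y k ω) ∂P
      + B i 1 * ∫ ω, φ₂ (x k ω) (y k ω) ∂P + B i 2 * ∫ ω, φ₃ (x k ω) (y k ω) ∂P := by
    intro k i
    simp [mulVec, dotProduct, Fin.sum_univ_three, hz]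
  have hstep : ∀ k i, z (k + 1) i ≤ (B *ᵥ z k) i := by
    intro k i
    rw [hrow, hB]
    simp only [hx, hy, hz]
    fin_cases i
    · exact GPushPull.integral_iter_succ_le hξm hξi hξ x₀ φ₁ φ₁ φ₂ φ₃ (fun x y hxy =>
        GPushPull.optimality_recursion hdiff hconv hlip hxs huT hS2 hD2 hη hd₁ hd₅ hd₇ hμ hη0 hα
          (by linarith) (by linarith) hxy) k
    · exact GPushPull.integral_iter_succ_le hξm hξi hξ x₀ φ₂ φ₁ φ₂ φ₃ (fun x y hxy => by
        rw [hvS]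
        exact GPushPull.consensus_recursion hdiff hlip hxs hτS.le hS huT hu1 hS2 hδSD hσR hσR0
          hσR1 hd₂ hxy) k
    · exact GPushPull.integral_iter_succ_le hξm hξi hξ x₀ φ₃ φ₁ φ₂ φ₃ (fun x y hxy =>
        GPushPull.tracking_recursion hdiff hlip hxs hτD.le hD hEv hv1 hS2 hD2 hδD2 hσC hσC0
          hσC1 hd₃ (hvD ▸ hd₄) hd₆ hd₃0.le hd₄0.le hd₆0.le hxy) k
  have hconvg := GPushPull.convergesAtRate_of_le_mulVec (fun i j => (hpos i j).le) hr.le hr1 hw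
    hBw hz0 hstep
  exact ⟨hconvg 0, hconvg 1, hconvg 2⟩
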